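/- **Setting.** Let $M\ge 1$ be an integer, $L,T>0$, $\mathbb{T}^2=(\mathbb{R}/\mathbb{Z})^2$, and let $a$ be a bounded continuous function on $(0,T]$. Let $\rho_0^\pm\in L^2_{\rm loc}(\mathbb{R}^2)$ satisfy, almost everywhere, $\rho_0^\pm(x_1+1,x_2)=\rho_0^\pm(x_1,x_2)+L$, $\rho_0^\pm(x_1,x_2+1)=\rho_0^\pm(x_1,x_2)$ and $\partial_{x_1}\rho_0^\pm\ge 0$, with $\partial_{x_1}\rho_0^\pm\in L\log L(\mathbb{T}^2)$, i.e. $\int_{\mathbb{T}^2}|\partial_{x_1}\rho_0^\pm|\ln(e+|\partial_{x_1}\rho_0^\pm|)<\infty$. Put $\rho_0^{\pm,\mathrm{per}}(x)=\rho_0^\pm(x)-Lx_1$. Let $F_M(z)=\frac1M\sum_{\ell=0}^{M-1}\sum_{|j|\le \ell}e^{2i\pi jz}$ be the Fejér kernel, $F_M^2(x)=F_M(x_1)F_M(x_2)$, $\rho_{M,0}^{\pm,\mathrm{per}}=F_M^2*\rho_0^{\pm,\mathrm{per}}$ (convolution on $\mathbb{T}^2$), and $$\sigma_M(x)=\frac1{M^2}\sum_{n_1,n_2=0}^{M-1}\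 \sum_{|m_1|\le n_1}\ \sum_{|m_2|\le n_2}c_{(m_1,m_2)}e^{2i\pi(m_1x_1+m_2x_2)},\qquad c_{(0,0)}=0,\quad c_{(m_1,m_2)}=\frac{m_1^2m_2^2}{(m_1^2+m_2^2)^2}\ \text{ for }(m_1,m_2)\neq(0,0).$$ **Scheme.** For integers $N,N_T\ge1$ put $\Delta x=1/N$, $\Delta t=T/N_T$, $t_n=n\Delta t$, $x_i=i\Delta x$ ($i\in\mathbb{Z}/N\mathbb{Z}$), $y_+=\max(y,0)$, $y_-=\max(-y,0)$. The scheme looks for $\rho^{\pm,n}_{i,j}$, $0\le n\le N_T$, $i,j\in\mathbb{Z}/N\mathbb{Z}$, with $\rho^{\pm,0}_{i,j}=\rho_{M,0}^{\pm,\mathrm{per}}(x_i,x_j)$ and, for $0\le n<N_T$, $$\frac{\rho^{\pm,n+1}_{i,j}-\rho^{\pm,n}_{i,j}}{\Delta t}=(\lambda^{\pm,n+1}_{i,j})_+\Big(\frac{\rho^{\pm,n}_{i+1,j}-\rho^{\pm,n}_{i,j}}{\Delta x}+L\Big)-(\lambda^{\pm,n+1}_{i,j})_-\Big(\frac{\rho^{\pm,n}_{i,j}-\rho^{\pm,n}_{i-1,j}}{\Delta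 x}+L\Big),$$ $$\lambda^{\pm,n+1}_{i,j}=\mp\Big(a(t_{n+1})+\sum_{\ell,r\in\mathbb{Z}/N\mathbb{Z}}(\Delta x)^2\sigma_M(x_\ell,x_r)\big(\rho^{+,n+1}_{i-\ell,j-r}-\rho^{-,n+1}_{i-\ell,j-r}\big)\Big).$$ Its $Q^1$ reconstruction on $[0,T]\times\mathbb{T}^2$ is the function that takes the value $\rho^{\pm,n}_{i,j}$ at $(t_n,x_i,x_j)$ and is affine in each of $t,x_1,x_2$ separately on every mesh cell $[t_n,t_{n+1}]\times[x_i,x_{i+1}]\times[x_j,x_{j+1}]$. **Theorem (convergence of the scheme).** Let $(N_m,N_{T,m})_{m\in\mathbb{N}}$ be a sequence of meshes with $N_m\ge M$, with $\varepsilon_m=\max(\Delta t_m,\Delta x_m)\to0$, and such that, for every $m$, $$\frac{\Delta t_m}{\Delta x_m}<\min\Big\{\frac1{4(4M^2L+\|a\|_{L^\infty(0,T)})},\frac1{18M^2L}\Big\},\qquad \Delta t_m<\frac1{2L(4M^2L+\|a\|_{L^\infty(0,T)})}.$$ Then, for every $m$, the scheme has a unique solution. Let $\rho^{\pm,m}$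 be the $Q^1$ reconstructions of these solutions. There exist functions $\rho^\pm_M\in W^{1,\infty}((0,T)\times\mathbb{T}^2)$ such that, up to a subsequence (common to both signs), $\rho^{\pm,m}\to\rho^\pm_M$ strongly in $C([0,T]\times\mathbb{T}^2)$. Moreover, $\rho^\pm_M$ solve $$\partial_t\rho^\pm_M=\mp\big(\sigma_M*(\rho^+_M-\rho^-_M)+a(t)\big)\big(\partial_{x_1}\rho^\pm_M+L\big)$$ in the sense of distributions on $(0,T)\times\mathbb{T}^2$, with the initial data $\rho^\pm_M(0,x)=\rho_{M,0}^{\pm,\mathrm{per}}(x)$ for all $x\in\mathbb{T}^2$. -/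

import Mathlib

open Set Filter Topology MeasureTheory
open scoped ContDiff

/-! Functions on the flat torus `𝕋² = (ℝ/ℤ)²` are represented by functions on `ℝ × ℝ` that are
`1`-periodic in each variable, functions on `[0,T] × 𝕋²` by functions of `(t, x₁, x₂)` that are
`1`-periodic in `x₁` and in `x₂`, and integrals over `𝕋²` by integrals over the unit cell.
The sign `±` is an element `s` of `ℤˣ = {1, -1}`: `ρ 1` stands for `ρ⁺` and `ρ (-1)` for `ρ⁻`. -/

/-- The unit cell `[0,1)²` of the torus. -/
def unitCell : Set (ℝ × ℝ) := Ico (0 : ℝ) 1 ×ˢ Ico (0 : ℝ) 1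

/-- The sign `±1` as a real number. -/
def sgnVal (s : ℤˣ) : ℝ := ((s : ℤ) : ℝ)

/-! ### Kernels -/

/-- The Dirichlet kernel `D_ℓ(z) = ∑_{|j| ≤ ℓ} e^{2iπjz}`. -/
noncomputable def dirichletKernel (l : ℕ) (z : ℝ) : ℂ :=
  ∑ j ∈ Finset.Icc (-(l : ℤ)) (l : ℤ), Complex.exp (2 * Real.pi * Complex.I * (j : ℂ) * (z : ℂ))

/-- The Fejér kernel `F_M(z) = (1/M) ∑_{ℓ<M} D_ℓ(z)`; the sum is a real number. -/
noncomputable def fejerKernel (M : ℕ) (z : ℝ) : ℝ :=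
  ((1 / (M : ℂ)) * ∑ l ∈ Finset.range M, dirichletKernel l z).re

/-- The two-dimensional Fejér kernel `F_M(x₁) F_M(x₂)`. -/
noncomputable def fejerKernel2 (M : ℕ) (x : ℝ × ℝ) : ℝ :=
  fejerKernel M x.1 * fejerKernel M x.2

/-- Fourier coefficients `m₁² m₂² / |m|⁴` of the singular kernel `𝒦`, and `0` at `m = 0`. -/
noncomputable def kernelCoeff (m₁ m₂ : ℤ) : ℝ :=
  if m₁ = 0 ∧ m₂ = 0 then 0
  else ((m₁ : ℝ) ^ 2 * (m₂ : ℝ) ^ 2) / ((m₁ : ℝ) ^ 2 + (m₂ : ℝ) ^ 2) ^ 2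

/-- The generalized Cesàro mean `σ_M^𝒦` of order `M` of the Fourier series of `𝒦`; the sum is a
real number because the coefficients are real and even. -/
noncomputable def sigmaKernel (M : ℕ) (x : ℝ × ℝ) : ℝ :=
  ((1 / (M : ℂ) ^ 2) * ∑ n₁ ∈ Finset.range M, ∑ n₂ ∈ Finset.range M,
    ∑ m₁ ∈ Finset.Icc (-(n₁ : ℤ)) (n₁ : ℤ), ∑ m₂ ∈ Finset.Icc (-(n₂ : ℤ)) (n₂ : ℤ),
      (kernelCoeff m₁ m₂ : ℂ) *
        Complex.exp (2 * Real.pi * Complex.I *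
          ((m₁ : ℂ) * (x.1 : ℂ) + (m₂ : ℂ) * (x.2 : ℂ)))).re

/-- Periodic convolution `(k ∗ f)(x) = ∫_{𝕋²} k(x - y) f(y) dy`. -/
noncomputable def torusConv (k f : ℝ × ℝ → ℝ) (x : ℝ × ℝ) : ℝ :=
  ∫ y in unitCell, k (x - y) * f y

/-! ### Initial data -/

/-- `g` is the weak derivative in `x₁` of `f` on `ℝ²`. -/
def HasWeakDerivX1 (f g : ℝ × ℝ → ℝ) : Prop :=
  ∀ φ : ℝ × ℝ → ℝ, ContDiff ℝ ∞ φ → HasCompactSupport φ →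
    ∫ x, f x * fderiv ℝ φ x (1, 0) = -∫ x, g x * φ x

/-- The assumption on an initial datum `ρ₀ = ρ₀^per + L x₁` on `ℝ²`: it is in `L²_loc`, it is
periodic up to the increment `L` in `x₁`, and its weak derivative in `x₁` is nonnegative and
belongs to the Zygmund space `L log L` of the torus. -/
structure IsInitialDatum (L : ℝ) (ρ₀ : ℝ × ℝ → ℝ) : Prop where
  memL2loc : ∀ K : Set (ℝ × ℝ), IsCompact K → MemLp ρ₀ 2 (volume.restrict K)
  shift_x1 : ∀ᵐ x : ℝ × ℝ, ρ₀ (x.1 + 1, x.2) = ρ₀ x + L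
  shift_x2 : ∀ᵐ x : ℝ × ℝ, ρ₀ (x.1, x.2 + 1) = ρ₀ x
  deriv_x1 : ∃ g : ℝ × ℝ → ℝ, LocallyIntegrable g ∧ HasWeakDerivX1 ρ₀ g ∧ (∀ᵐ x, 0 ≤ g x) ∧
    IntegrableOn (fun x => |g x| * Real.log (Real.exp 1 + |g x|)) unitCell

/-- The periodic part `ρ₀^per = ρ₀ - L x₁`. -/
def perPart (L : ℝ) (ρ₀ : ℝ × ℝ → ℝ) (x : ℝ × ℝ) : ℝ := ρ₀ x - L * x.1

/-- The regularized initial datum `F_M² ∗ ρ₀^per`. -/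
noncomputable def regInitial (M : ℕ) (L : ℝ) (ρ₀ : ℝ × ℝ → ℝ) : ℝ × ℝ → ℝ :=
  torusConv (fejerKernel2 M) (perPart L ρ₀)

/-! ### The scheme -/

/-- The norm of `a` in `L^∞(0,T)`. -/
noncomputable def supNormOn (T : ℝ) (a : ℝ → ℝ) : ℝ :=
  (eLpNorm a ⊤ (volume.restrict (Ioo 0 T))).toReal

/-- The space step `Δx = 1/N`. -/
noncomputable def spaceStep (N : ℕ) : ℝ := 1 / (N : ℝ)

/-- The time step `Δt = T/N_T`. -/
noncomputable def timeStep (T : ℝ) (NT : ℕ) : ℝ := T / (NT : ℝ)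

/-- The grid point `x_i = i Δx`, for the representative of `i ∈ ℤ/Nℤ` in `{0, …, N-1}`. -/
noncomputable def gridPt (N : ℕ) (i : ZMod N) : ℝ := (i.val : ℝ) * spaceStep N

/-- The two CFL conditions that link `Δt`, `Δx`, `M`, `L` and `‖a‖_{L^∞(0,T)}`. -/
def CFL (M : ℕ) (L T : ℝ) (a : ℝ → ℝ) (Δt Δx : ℝ) : Prop :=
  Δt / Δx < min (1 / (4 * (4 * (M : ℝ) ^ 2 * L + supNormOn T a))) (1 / (18 * (M : ℝ) ^ 2 * L)) ∧
    Δt < 1 / (2 * L * (4 * (M : ℝ) ^ 2 * L + supNormOn T a))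

/-- The discrete velocity `λ^s_{i,j}[v] = -s (α + ∑ Δx² σ_M(x_ℓ,x_r) v_{i-ℓ,j-r})`, where `α` is
the value of `a` at the new time. -/
noncomputable def discVelocity (M N : ℕ) [NeZero N] (α : ℝ) (s : ℤˣ)
    (v : ZMod N → ZMod N → ℝ) (i j : ZMod N) : ℝ :=
  -(sgnVal s) * (α + ∑ l : ZMod N, ∑ r : ZMod N,
    spaceStep N ^ 2 * sigmaKernel M (gridPt N l, gridPt N r) * v (i - l) (j - r))

/-- The discrete `x₁`-derivative `θ_{i+1/2,j} = (v_{i+1,j} - v_{i,j}) / Δx`. -/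
noncomputable def discDerivX1 (N : ℕ) (v : ZMod N → ZMod N → ℝ) (i j : ZMod N) : ℝ :=
  (v (i + 1) j - v i j) / spaceStep N

/-- `u s n i j = ρ^{s,n,per}_{M,i,j}`, for `0 ≤ n ≤ N_T`, solves the semi-implicit upwind scheme
that starts from the values on the grid of the regularized initial data. -/
structure IsSchemeSolution (M : ℕ) (L T : ℝ) (a : ℝ → ℝ) (ρ₀ : ℤˣ → ℝ × ℝ → ℝ)
    (N NT : ℕ) [NeZero N] (u : ℤˣ → ℕ → ZMod N → ZMod N → ℝ) : Prop where
  initial : ∀ (s : ℤˣ) (i j : ZMod N),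
    u s 0 i j = regInitial M L (ρ₀ s) (gridPt N i, gridPt N j)
  step : ∀ (s : ℤˣ) (n : ℕ), n < NT → ∀ i j : ZMod N,
    (u s (n + 1) i j - u s n i j) / timeStep T NT =
      max (discVelocity M N (a (((n : ℝ) + 1) * timeStep T NT)) s
          (fun k l => u 1 (n + 1) k l - u (-1) (n + 1) k l) i j) 0 *
        (discDerivX1 N (u s n) i j + L) -
      max (-(discVelocity M N (a (((n : ℝ) + 1) * timeStep T NT)) s
          (fun k l => u 1 (n + 1) k l - u (-1) (n + 1) k l) i j)) 0 *
        (discDerivX1 N (u s n) (i - 1) j + L)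

/-- Bilinear interpolation in space, on each cell `[x_i,x_{i+1}] × [x_j,x_{j+1}]`, of grid values
`v`. -/
noncomputable def interpSpace (N : ℕ) (v : ZMod N → ZMod N → ℝ) (x₁ x₂ : ℝ) : ℝ :=
  let i : ℤ := ⌊x₁ / spaceStep N⌋
  let j : ℤ := ⌊x₂ / spaceStep N⌋
  let p : ℝ := (x₁ - (i : ℝ) * spaceStep N) / spaceStep N
  let q : ℝ := (x₂ - (j : ℝ) * spaceStep N) / spaceStep N
  p * q * v ((i : ZMod N) + 1) ((j : ZMod N) + 1) + (1 - p) * q * v (i : ZMod N) ((j : ZMod N) + 1)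
    + p * (1 - q) * v ((i : ZMod N) + 1) (j : ZMod N)
    + (1 - p) * (1 - q) * v (i : ZMod N) (j : ZMod N)

/-- The `Q¹` reconstruction on `[0,T] × 𝕋²` of grid values `w n i j`, `0 ≤ n ≤ N_T`: for `t` in
`[t_n,t_{n+1}]` it is affine in `t` and bilinear in space. At `t = T` the value of `w` at `N_T + 1`
has the weight `0`. -/
noncomputable def reconstruct (T : ℝ) (N NT : ℕ) (w : ℕ → ZMod N → ZMod N → ℝ)
    (z : ℝ × ℝ × ℝ) : ℝ :=
  let n : ℕ := ⌊z.1 / timeStep T NT⌋₊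
  let τ : ℝ := (z.1 - (n : ℝ) * timeStep T NT) / timeStep T NT
  τ * interpSpace N (w (n + 1)) z.2.1 z.2.2 + (1 - τ) * interpSpace N (w n) z.2.1 z.2.2

/-! ### The space `W^{1,∞}((0,T) × 𝕋²)` and distributional solutions -/

/-- `(0,T)` times the unit cell. -/
def cylinder (T : ℝ) : Set (ℝ × ℝ × ℝ) := Ioo 0 T ×ˢ unitCell

/-- `f(t, x₁, x₂)` is `1`-periodic in `x₁` and in `x₂`. -/
def IsSpacePeriodic (f : ℝ × ℝ × ℝ → ℝ) : Prop :=
  ∀ t x₁ x₂ : ℝ, f (t, x₁ + 1, x₂) = f (t, x₁, x₂) ∧ f (t, x₁, x₂ + 1) = f (t, x₁, x₂)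

/-- The test functions `C_c^∞((0,T) × 𝕋²)`. -/
structure IsTestFunction (T : ℝ) (φ : ℝ × ℝ × ℝ → ℝ) : Prop where
  smooth : ContDiff ℝ ∞ φ
  periodic : IsSpacePeriodic φ
  support : ∃ δ > 0, ∀ z : ℝ × ℝ × ℝ, φ z ≠ 0 → δ ≤ z.1 ∧ z.1 ≤ T - δ

/-- `g` is the derivative of `f` in the direction `d` in the sense of distributions on
`(0,T) × 𝕋²`. -/
def HasWeakDeriv (T : ℝ) (f g : ℝ × ℝ × ℝ → ℝ) (d : ℝ × ℝ × ℝ) : Prop :=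
  ∀ φ : ℝ × ℝ × ℝ → ℝ, IsTestFunction T φ →
    ∫ z in cylinder T, f z * fderiv ℝ φ z d = -∫ z in cylinder T, g z * φ z

/-- `f ∈ L^∞((0,T) × 𝕋²)`, for a function that is determined by its values on the cylinder. -/
def MemLInfty (T : ℝ) (f : ℝ × ℝ × ℝ → ℝ) : Prop :=
  MemLp f ⊤ (volume.restrict (cylinder T))

/-- `f ∈ W^{1,∞}((0,T) × 𝕋²)`: the function and its three first order weak derivatives are in
`L^∞((0,T) × 𝕋²)`. -/
structure MemW1Infty (T : ℝ) (f : ℝ × ℝ × ℝ → ℝ) : Prop where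
  periodic : IsSpacePeriodic f
  bounded : MemLInfty T f
  deriv_t : ∃ g, MemLInfty T g ∧ HasWeakDeriv T f g (1, 0, 0)
  deriv_x1 : ∃ g, MemLInfty T g ∧ HasWeakDeriv T f g (0, 1, 0)
  deriv_x2 : ∃ g, MemLInfty T g ∧ HasWeakDeriv T f g (0, 0, 1)

/-- The velocity `(σ_M ∗ (ρ⁺(t,·) - ρ⁻(t,·)))(x) + a(t)`. -/
noncomputable def velocity (M : ℕ) (a : ℝ → ℝ) (ρ : ℤˣ → ℝ × ℝ × ℝ → ℝ) (z : ℝ × ℝ × ℝ) : ℝ :=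
  torusConv (sigmaKernel M) (fun y => ρ 1 (z.1, y) - ρ (-1) (z.1, y)) z.2 + a z.1

/-- `ρ⁺, ρ⁻` (functions with a bounded weak derivative in `x₁`, continuous up to `t = 0`) solve
`∂_t ρ^± = ∓ (σ_M ∗ (ρ⁺ - ρ⁻) + a) (∂_{x₁} ρ^± + L)` in the sense of distributions on
`(0,T) × 𝕋²`, with the initial values `ρ^±(0,·) = F_M² ∗ ρ₀^{±,per}`. -/
def IsDistributionalSolution (M : ℕ) (L T : ℝ) (a : ℝ → ℝ) (ρ₀ : ℤˣ → ℝ × ℝ → ℝ)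
    (ρ : ℤˣ → ℝ × ℝ × ℝ → ℝ) : Prop :=
  ∀ s : ℤˣ,
    (∃ θ : ℝ × ℝ × ℝ → ℝ, MemLInfty T θ ∧ HasWeakDeriv T (ρ s) θ (0, 1, 0) ∧
      HasWeakDeriv T (ρ s) (fun z => -(sgnVal s) * velocity M a ρ z * (θ z + L)) (1, 0, 0)) ∧
    ContinuousOn (ρ s) (Ico 0 T ×ˢ univ) ∧
    ∀ x : ℝ × ℝ, ρ s (0, x) = regInitial M L (ρ₀ s) x

/-! The proof is a compactness argument: bounds independent of the mesh give a limit by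
Arzelà–Ascoli, and the difference equation is then passed to the limit.

The basic quantity is the slope `θ = discDerivX1 + L`. It is nonnegative at time zero, because the
Fejér kernel is nonnegative with integral one and averages a datum nondecreasing in x₁
(`IsInitialDatum.regInitial_add_ge`). The slopes of a row satisfy `∑ Δx θ = L`, so nonnegativity
alone bounds each slope by `L / Δx` and the oscillation in x₁ by `L`. The kernel σ_M has no Fourier
mode with m₁ = 0, hence its grid sums in x₁ vanish (`sum_sigmaKernel_grid`, where M ≤ N enters) and
the velocity sees only this oscillation. The velocity bound is therefore the same at all times, and
one CFL condition suffices. Under it the implicit step is a contraction (`dist_stepMap_le`), and the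
new slopes are combinations of the old ones with nonnegative coefficients (`gridMono_step`), so
monotonicity propagates.

Lipschitz bounds follow. The coefficients of that combination add up to at most 1 + 2M²LΔt, since
the increments of the velocity in x₁ are controlled by the total variation of a row; a discrete
Gronwall argument bounds the slopes uniformly (`deriv_step_le`). Differences in x₂ grow linearly in
time (`abs_step_x2_le`), and differences in time are velocity times slope. Hence the Q¹
reconstructions are uniformly bounded and equi-Lipschitz.

For the limit, the piecewise constant functions `gridStep` satisfy the scheme exactly as an equation
between translates (`gridStep_scheme`) and have the same uniform limit. The velocities converge
pointwise. The quotients in x₁ converge only weakly, and `tendsto_integral_transport` moves them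
onto the weight λ₊φ or λ₋φ, which is Lipschitz in x₁. Forward and backward quotients have the same
limit, and λ₊ − λ₋ = λ recovers the transport equation. The limit is Lipschitz, so its line
derivatives exist almost everywhere and are its weak derivatives. -/

/-! ### Periodic functions on `ℝ²` -/

/-- `f` is `1`-periodic in each of its two variables. -/
def TorusPeriodic (f : ℝ × ℝ → ℝ) : Prop :=
  ∀ x₁ x₂ : ℝ, f (x₁ + 1, x₂) = f (x₁, x₂) ∧ f (x₁, x₂ + 1) = f (x₁, x₂)

theorem TorusPeriodic.add_int {f : ℝ × ℝ → ℝ} (hf : TorusPeriodic f) (x : ℝ × ℝ) (m n : ℤ) :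
    f (x + ((m : ℝ), (n : ℝ))) = f x := by
  have h1 : ∀ b, Function.Periodic (fun s => f (s, b)) 1 := fun b s => (hf s b).1
  have h2 : ∀ b, Function.Periodic (fun s => f (b, s)) 1 := fun b s => (hf b s).2
  have e1 := (h1 (x.2 + n)).int_mul m x.1
  have e2 := (h2 x.1).int_mul n x.2
  simp only [mul_one] at e1 e2
  exact e1.trans e2

theorem TorusPeriodic.fract {f : ℝ × ℝ → ℝ} (hf : TorusPeriodic f) (x : ℝ × ℝ) :
    f (Int.fract x.1, Int.fract x.2) = f x := by
  rw [← hf.add_int _ ⌊x.1⌋ ⌊x.2⌋]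
  simp

theorem TorusPeriodic.exists_bound {f : ℝ × ℝ → ℝ} (hf : TorusPeriodic f) (hc : Continuous f) :
    ∃ C, 0 ≤ C ∧ ∀ x, |f x| ≤ C := by
  obtain ⟨C, hC⟩ := (isCompact_Icc (a := (0 : ℝ)) (b := 1)).prod
    (isCompact_Icc (a := (0 : ℝ)) (b := 1)) |>.exists_bound_of_continuousOn hc.continuousOn
  have key : ∀ x, |f x| ≤ C := fun x => by
    rw [← hf.fract x]
    exact hC _ ⟨⟨Int.fract_nonneg _, (Int.fract_lt_one _).le⟩,
      ⟨Int.fract_nonneg _, (Int.fract_lt_one _).le⟩⟩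
  exact ⟨C, (abs_nonneg _).trans (key 0), key⟩

theorem TorusPeriodic.exists_lipschitz {f : ℝ × ℝ → ℝ} (hf : TorusPeriodic f)
    (hc : ContDiff ℝ 1 f) : ∃ C : ℝ, 0 ≤ C ∧ ∀ x y, |f x - f y| ≤ C * ‖x - y‖ := by
  obtain ⟨C, hC⟩ := (isCompact_Icc (a := (0 : ℝ)) (b := 1)).prod
    (isCompact_Icc (a := (0 : ℝ)) (b := 1)) |>.exists_bound_of_continuousOn
      (hc.continuous_fderiv one_ne_zero).continuousOn
  -- The derivative inherits the periods of `f`, so a bound on the unit square is global.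
  have hper : ∀ x : ℝ × ℝ, fderiv ℝ f (Int.fract x.1, Int.fract x.2) = fderiv ℝ f x := fun x => by
    have : (fun y => f (y + ((⌊x.1⌋ : ℝ), (⌊x.2⌋ : ℝ)))) = f := by
      ext y; exact hf.add_int _ _ _
    have h2 := fderiv_comp_add_right (𝕜 := ℝ) (f := f)
      (x := (Int.fract x.1, Int.fract x.2)) ((⌊x.1⌋ : ℝ), (⌊x.2⌋ : ℝ))
    rw [this] at h2
    simpa using h2
  have key : ∀ x, ‖fderiv ℝ f x‖ ≤ C := fun x => by
    rw [← hper x]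
    exact hC _ ⟨⟨Int.fract_nonneg _, (Int.fract_lt_one _).le⟩,
      ⟨Int.fract_nonneg _, (Int.fract_lt_one _).le⟩⟩
  refine ⟨C, (norm_nonneg _).trans (key 0), fun x y => ?_⟩
  exact convex_univ.norm_image_sub_le_of_norm_fderiv_le
    (fun z _ => (hc.differentiable one_ne_zero) z) (fun z _ => key z) (mem_univ y) (mem_univ x)

/-! ### The Fejér kernel -/

theorem sum_Icc_symm {α : Type*} [AddCommMonoid α] (g : ℤ → α) (l : ℕ) :
    ∑ j ∈ Finset.Icc (-(l : ℤ)) (l : ℤ), g j =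
      g 0 + ∑ k ∈ Finset.range l, (g ((k : ℤ) + 1) + g (-((k : ℤ) + 1))) := by
  induction l with
  | zero => simp
  | succ l ih =>
    have : Finset.Icc (-((l + 1 : ℕ) : ℤ)) ((l + 1 : ℕ) : ℤ) =
        insert ((l : ℤ) + 1) (insert (-((l : ℤ) + 1)) (Finset.Icc (-(l : ℤ)) (l : ℤ))) := by
      ext x
      simp only [Finset.mem_Icc, Finset.mem_insert]
      omega
    rw [this, Finset.sum_insert, Finset.sum_insert, ih, Finset.sum_range_succ]
    · abel
    · simp
    · simp only [Finset.mem_Icc, Finset.mem_insert]; omega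

theorem exp_two_pi_I_re (t : ℝ) :
    (Complex.exp (2 * Real.pi * Complex.I * (t : ℂ))).re = Real.cos (2 * Real.pi * t) := by
  rw [show (2 * Real.pi * Complex.I * (t : ℂ) : ℂ) = ((2 * Real.pi * t : ℝ) : ℂ) * Complex.I by
    push_cast; ring, Complex.exp_ofReal_mul_I_re]

theorem dirichletKernel_re (l : ℕ) (z : ℝ) :
    (dirichletKernel l z).re =
      1 + ∑ k ∈ Finset.range l, 2 * Real.cos (2 * Real.pi * (((k : ℝ) + 1) * z)) := by
  have h : ∀ j : ℤ, (Complex.exp (2 * Real.pi * Complex.I * (j : ℂ) * (z : ℂ))).re =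
      Real.cos (2 * Real.pi * ((j : ℝ) * z)) := fun j => by
    rw [← exp_two_pi_I_re]; push_cast; ring_nf
  unfold dirichletKernel
  rw [Complex.re_sum]
  simp_rw [h]
  rw [sum_Icc_symm (fun j : ℤ => Real.cos (2 * Real.pi * ((j : ℝ) * z)))]
  simp only [Int.cast_zero, zero_mul, mul_zero, Real.cos_zero]
  congr 1
  refine Finset.sum_congr rfl fun k _ => ?_
  push_cast
  rw [show 2 * Real.pi * (-((k : ℝ) + 1) * z) = -(2 * Real.pi * (((k : ℝ) + 1) * z)) by ring,
    Real.cos_neg]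
  ring

theorem fejerKernel_eq (M : ℕ) (z : ℝ) : fejerKernel M z = (1 / (M : ℝ)) *
    ∑ l ∈ Finset.range M,
      (1 + ∑ k ∈ Finset.range l, 2 * Real.cos (2 * Real.pi * (((k : ℝ) + 1) * z))) := by
  unfold fejerKernel
  rw [show (1 / (M : ℂ)) = ((1 / (M : ℝ) : ℝ) : ℂ) by push_cast; rfl, Complex.re_ofReal_mul,
    Complex.re_sum]
  simp_rw [dirichletKernel_re]

/-- The right side is |∑_{k<M} e^{2iπkz}|², in which the frequency j occurs M − |j| times, exactly
as in the sum of the Dirichlet kernels. This gives the sign of the Fejér kernel. -/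
theorem sum_dirichlet_eq_sq (M : ℕ) (z : ℝ) :
    ∑ l ∈ Finset.range M,
      (1 + ∑ k ∈ Finset.range l, 2 * Real.cos (2 * Real.pi * (((k : ℝ) + 1) * z))) =
    (∑ k ∈ Finset.range M, Real.cos (2 * Real.pi * ((k : ℝ) * z))) ^ 2 +
      (∑ k ∈ Finset.range M, Real.sin (2 * Real.pi * ((k : ℝ) * z))) ^ 2 := by
  induction M with
  | zero => simp
  | succ M ih =>
    rw [Finset.sum_range_succ, ih, Finset.sum_range_succ _ M, Finset.sum_range_succ _ M,
      ← Finset.sum_range_reflect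
        (fun k => 2 * Real.cos (2 * Real.pi * (((k : ℝ) + 1) * z)))]
    -- After reflection the frequency k + 1 becomes M − k, the cross term between the new
    -- exponential and the k-th one.
    have h : ∀ k ∈ Finset.range M,
        2 * Real.cos (2 * Real.pi * (((M - 1 - k : ℕ) + 1 : ℝ) * z)) =
        2 * (Real.cos (2 * Real.pi * ((k : ℝ) * z)) * Real.cos (2 * Real.pi * ((M : ℝ) * z)) +
          Real.sin (2 * Real.pi * ((k : ℝ) * z)) * Real.sin (2 * Real.pi * ((M : ℝ) * z))) := by
      intro k hk
      have hk' := Finset.mem_range.1 hk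
      have : ((M - 1 - k : ℕ) : ℝ) + 1 = M - k := by
        have : M - 1 - k + 1 + k = M := by omega
        have h2 : (((M - 1 - k + 1 + k : ℕ)) : ℝ) = M := by rw [this]
        push_cast at h2; linarith
      rw [this, ← Real.cos_sub, ← Real.cos_neg]
      ring_nf
    rw [Finset.sum_congr rfl h, ← Finset.mul_sum, Finset.sum_add_distrib, ← Finset.sum_mul,
      ← Finset.sum_mul]
    have := Real.sin_sq_add_cos_sq (2 * Real.pi * ((M : ℝ) * z))
    linear_combination -this

theorem fejerKernel_nonneg (M : ℕ) (z : ℝ) : 0 ≤ fejerKernel M z := by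
  rw [fejerKernel_eq, sum_dirichlet_eq_sq]
  positivity

theorem contDiff_fejerKernel (M : ℕ) {n : WithTop ℕ∞} : ContDiff ℝ n (fejerKernel M) := by
  have : fejerKernel M = fun z => _ := funext fun z => fejerKernel_eq M z
  rw [this]
  fun_prop

theorem fejerKernel_add_one (M : ℕ) (z : ℝ) : fejerKernel M (z + 1) = fejerKernel M z := by
  rw [fejerKernel_eq, fejerKernel_eq]
  congr 1
  refine Finset.sum_congr rfl fun l _ => ?_
  congr 1
  refine Finset.sum_congr rfl fun k _ => ?_
  rw [show 2 * Real.pi * (((k : ℝ) + 1) * (z + 1)) =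
    2 * Real.pi * (((k : ℝ) + 1) * z) + ((k + 1 : ℕ) : ℝ) * (2 * Real.pi) by push_cast; ring,
    Real.cos_add_nat_mul_two_pi]

theorem integral_cos_two_pi_nat (k : ℕ) :
    ∫ z in (0 : ℝ)..1, Real.cos (2 * Real.pi * (((k : ℝ) + 1) * z)) = 0 := by
  have h : (2 * Real.pi * ((k : ℝ) + 1)) ≠ 0 := by positivity
  simp_rw [← mul_assoc]
  rw [intervalIntegral.integral_comp_mul_left (fun x => Real.cos x) h, integral_cos]
  have : Real.sin (2 * Real.pi * ((k : ℝ) + 1) * 1) = 0 := by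
    rw [show 2 * Real.pi * ((k : ℝ) + 1) * 1 = ((2 * (k + 1) : ℕ) : ℝ) * Real.pi by
      push_cast; ring]
    exact Real.sin_nat_mul_pi _
  rw [this]
  simp

theorem integral_fejerKernel {M : ℕ} (hM : 1 ≤ M) : ∫ z in (0 : ℝ)..1, fejerKernel M z = 1 := by
  have : fejerKernel M = fun z => _ := funext fun z => fejerKernel_eq M z
  rw [this, intervalIntegral.integral_const_mul, intervalIntegral.integral_finsetSum]
  · have : ∀ l ∈ Finset.range M, ∫ z in (0 : ℝ)..1,
        (1 + ∑ k ∈ Finset.range l, 2 * Real.cos (2 * Real.pi * (((k : ℝ) + 1) * z))) = 1 := by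
      intro l _
      rw [intervalIntegral.integral_add, intervalIntegral.integral_finsetSum]
      · simp_rw [intervalIntegral.integral_const_mul, integral_cos_two_pi_nat]; simp
      · intro i _; exact Continuous.intervalIntegrable (by fun_prop) _ _
      · simp
      · exact Continuous.intervalIntegrable (by fun_prop) _ _
    rw [Finset.sum_congr rfl this]
    have : (M : ℝ) ≠ 0 := by positivity
    simp only [Finset.sum_const, Finset.card_range, nsmul_eq_mul, mul_one]
    field_simp
  · intro i _; exact Continuous.intervalIntegrable (by fun_prop) _ _

theorem fejerKernel2_nonneg (M : ℕ) (x : ℝ × ℝ) : 0 ≤ fejerKernel2 M x :=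
  mul_nonneg (fejerKernel_nonneg _ _) (fejerKernel_nonneg _ _)

theorem contDiff_fejerKernel2 (M : ℕ) {n : WithTop ℕ∞} : ContDiff ℝ n (fejerKernel2 M) :=
  ((contDiff_fejerKernel M).comp contDiff_fst).mul ((contDiff_fejerKernel M).comp contDiff_snd)

theorem torusPeriodic_fejerKernel2 (M : ℕ) : TorusPeriodic (fejerKernel2 M) := fun x₁ x₂ => by
  simp [fejerKernel2, fejerKernel_add_one]

theorem integral_fejerKernel2 {M : ℕ} (hM : 1 ≤ M) : ∫ x in unitCell, fejerKernel2 M x = 1 := by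
  unfold unitCell fejerKernel2
  rw [Measure.volume_eq_prod, setIntegral_prod_mul (fejerKernel M) (fejerKernel M)]
  rw [integral_Ico_eq_integral_Ioc, ← intervalIntegral.integral_of_le zero_le_one,
    integral_fejerKernel hM, one_mul]

/-! ### The kernel `σ_M` -/

theorem sigmaKernel_eq (M : ℕ) (x : ℝ × ℝ) : sigmaKernel M x = (1 / (M : ℝ) ^ 2) *
    ∑ n₁ ∈ Finset.range M, ∑ n₂ ∈ Finset.range M,
    ∑ m₁ ∈ Finset.Icc (-(n₁ : ℤ)) (n₁ : ℤ), ∑ m₂ ∈ Finset.Icc (-(n₂ : ℤ)) (n₂ : ℤ),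
      kernelCoeff m₁ m₂ * Real.cos (2 * Real.pi * ((m₁ : ℝ) * x.1 + (m₂ : ℝ) * x.2)) := by
  unfold sigmaKernel
  rw [show (1 / (M : ℂ) ^ 2) = ((1 / (M : ℝ) ^ 2 : ℝ) : ℂ) by push_cast; rfl,
    Complex.re_ofReal_mul]
  simp_rw [Complex.re_sum, Complex.re_ofReal_mul]
  congr 1
  refine Finset.sum_congr rfl fun _ _ => Finset.sum_congr rfl fun _ _ =>
    Finset.sum_congr rfl fun m₁ _ => Finset.sum_congr rfl fun m₂ _ => ?_
  rw [← exp_two_pi_I_re]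
  push_cast
  rfl

theorem abs_kernelCoeff_le (m₁ m₂ : ℤ) : |kernelCoeff m₁ m₂| ≤ 1 := by
  unfold kernelCoeff
  split_ifs
  · simp
  · rw [abs_of_nonneg (by positivity)]
    refine div_le_one_of_le₀ ?_ (by positivity)
    nlinarith [sq_nonneg ((m₁ : ℝ) ^ 2), sq_nonneg ((m₂ : ℝ) ^ 2),
      mul_nonneg (sq_nonneg (m₁ : ℝ)) (sq_nonneg (m₂ : ℝ))]

/-- Apart from the bound by one, this is the only property of the coefficients that the proof uses:
σ_M contains no mode that is constant in x₁. -/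
theorem kernelCoeff_zero_left (m : ℤ) : kernelCoeff 0 m = 0 := by
  simp [kernelCoeff]

theorem sum_two_mul_add_one (M : ℕ) : ∑ n ∈ Finset.range M, (2 * (n : ℝ) + 1) = (M : ℝ) ^ 2 := by
  induction M with
  | zero => simp
  | succ M ih => rw [Finset.sum_range_succ, ih]; push_cast; ring

/-- Each partial sum has (2n₁+1)(2n₂+1) modes of modulus at most one. Sums of odd numbers are
squares, so the total is M⁴, and the normalization leaves M². -/
theorem abs_sigmaKernel_le {M : ℕ} (hM : 1 ≤ M) (x : ℝ × ℝ) : |sigmaKernel M x| ≤ (M : ℝ) ^ 2 := by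
  have hM' : (0 : ℝ) < M := by positivity
  rw [sigmaKernel_eq, abs_mul, abs_of_nonneg (by positivity : (0 : ℝ) ≤ 1 / (M : ℝ) ^ 2)]
  have hcard : ∀ n : ℕ, ((Finset.Icc (-(n : ℤ)) (n : ℤ)).card : ℝ) = 2 * (n : ℝ) + 1 := fun n => by
    rw [Int.card_Icc, show ((n : ℤ) + 1 - -(n : ℤ)).toNat = 2 * n + 1 by omega]
    push_cast; ring
  have hsum : |∑ n₁ ∈ Finset.range M, ∑ n₂ ∈ Finset.range M,
      ∑ m₁ ∈ Finset.Icc (-(n₁ : ℤ)) (n₁ : ℤ), ∑ m₂ ∈ Finset.Icc (-(n₂ : ℤ)) (n₂ : ℤ),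
        kernelCoeff m₁ m₂ * Real.cos (2 * Real.pi * ((m₁ : ℝ) * x.1 + (m₂ : ℝ) * x.2))| ≤
      ∑ n₁ ∈ Finset.range M, ∑ n₂ ∈ Finset.range M, (2 * (n₁ : ℝ) + 1) * (2 * (n₂ : ℝ) + 1) := by
    refine (Finset.abs_sum_le_sum_abs _ _).trans (Finset.sum_le_sum fun n₁ _ => ?_)
    refine (Finset.abs_sum_le_sum_abs _ _).trans (Finset.sum_le_sum fun n₂ _ => ?_)
    rw [← hcard n₁, ← hcard n₂, ← nsmul_eq_mul]
    refine (Finset.abs_sum_le_sum_abs _ _).trans (Finset.sum_le_card_nsmul _ _ _ fun m₁ _ => ?_)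
    rw [← mul_one ((Finset.card _ : ℕ) : ℝ), ← nsmul_eq_mul]
    refine (Finset.abs_sum_le_sum_abs _ _).trans (Finset.sum_le_card_nsmul _ _ _ fun m₂ _ => ?_)
    rw [abs_mul]
    exact mul_le_one₀ (abs_kernelCoeff_le _ _) (abs_nonneg _) (Real.abs_cos_le_one _)
  simp_rw [← Finset.mul_sum, ← Finset.sum_mul, sum_two_mul_add_one] at hsum
  refine (mul_le_mul_of_nonneg_left hsum (by positivity)).trans (le_of_eq ?_)
  field_simp

theorem contDiff_sigmaKernel (M : ℕ) {n : WithTop ℕ∞} : ContDiff ℝ n (sigmaKernel M) := by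
  have : sigmaKernel M = fun z => _ := funext fun z => sigmaKernel_eq M z
  rw [this]
  fun_prop

theorem torusPeriodic_sigmaKernel (M : ℕ) : TorusPeriodic (sigmaKernel M) := fun x₁ x₂ => by
  simp only [sigmaKernel_eq]
  constructor
  all_goals
    congr 1
    refine Finset.sum_congr rfl fun _ _ => Finset.sum_congr rfl fun _ _ =>
      Finset.sum_congr rfl fun m₁ _ => Finset.sum_congr rfl fun m₂ _ => ?_
    congr 1
  · rw [show 2 * Real.pi * ((m₁ : ℝ) * (x₁ + 1) + m₂ * x₂) =
      2 * Real.pi * ((m₁ : ℝ) * x₁ + m₂ * x₂) + (m₁ : ℝ) * (2 * Real.pi) by ring,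
      Real.cos_add_int_mul_two_pi]
  · rw [show 2 * Real.pi * ((m₁ : ℝ) * x₁ + m₂ * (x₂ + 1)) =
      2 * Real.pi * ((m₁ : ℝ) * x₁ + m₂ * x₂) + (m₂ : ℝ) * (2 * Real.pi) by ring,
      Real.cos_add_int_mul_two_pi]

/-! ### Sums over the grid -/

theorem spaceStep_pos (N : ℕ) [NeZero N] : 0 < spaceStep N := by
  have : 0 < N := Nat.pos_of_ne_zero (NeZero.ne N)
  unfold spaceStep; positivity

theorem natCast_mul_spaceStep (N : ℕ) [NeZero N] : (N : ℝ) * spaceStep N = 1 := by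
  have : (N : ℝ) ≠ 0 := Nat.cast_ne_zero.2 (NeZero.ne N)
  unfold spaceStep; field_simp

theorem sum_zmod_val {N : ℕ} [NeZero N] {α : Type*} [AddCommMonoid α] (g : ℕ → α) :
    ∑ i : ZMod N, g i.val = ∑ k ∈ Finset.range N, g k := by
  refine Finset.sum_bij' (fun i _ => i.val) (fun k _ => (k : ZMod N)) ?_ ?_ ?_ ?_ ?_
  · intro i _; simpa using ZMod.val_lt i
  · intro k _; simp
  · intro i _; simp
  · intro k hk; exact ZMod.val_natCast_of_lt (Finset.mem_range.1 hk)
  · intro i _; rfl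

/-- Geometric sum of the powers of an N-th root of unity; 0 < |m| < N ensures that the root is not
1. The phase `b` will carry the second variable. -/
theorem sum_cos_grid {N : ℕ} [NeZero N] {m : ℤ} (hm : m ≠ 0) (hmN : |m| < N) (b : ℝ) :
    ∑ i : ZMod N, Real.cos (2 * Real.pi * ((m : ℝ) * gridPt N i + b)) = 0 := by
  have hN : (N : ℂ) ≠ 0 := Nat.cast_ne_zero.2 (NeZero.ne N)
  set ζ : ℂ := Complex.exp (2 * Real.pi * Complex.I * (m / N)) with hζ
  have hpow : ζ ^ N = 1 := by
    rw [hζ, ← Complex.exp_nat_mul, Complex.exp_eq_one_iff]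
    exact ⟨m, by field_simp⟩
  have hne : ζ ≠ 1 := by
    intro h
    rw [hζ, Complex.exp_eq_one_iff] at h
    obtain ⟨n, hn⟩ := h
    have h2 : (2 * Real.pi * Complex.I : ℂ) ≠ 0 := Complex.two_pi_I_ne_zero
    have h3 : (m : ℂ) = n * N := by
      have : (2 * Real.pi * Complex.I : ℂ) * (m / N) = (2 * Real.pi * Complex.I) * n := by
        rw [hn]; ring
      have := mul_left_cancel₀ h2 this
      field_simp at this
      rw [this, mul_comm]
    have h4 : m = n * N := by exact_mod_cast h3
    have hn0 : n ≠ 0 := by rintro rfl; simp at h4; exact hm h4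
    rw [h4, abs_mul, Nat.abs_cast] at hmN
    have : 1 ≤ |n| := Int.one_le_abs hn0
    nlinarith [Int.natCast_nonneg N]
  have hgeom : ∑ k ∈ Finset.range N, ζ ^ k = 0 := by
    have := mul_neg_geom_sum ζ N
    rw [hpow, sub_self] at this
    rcases mul_eq_zero.1 this with h | h
    · exact absurd (sub_eq_zero.1 h).symm hne
    · exact h
  have hterm : ∀ i : ZMod N, Real.cos (2 * Real.pi * ((m : ℝ) * gridPt N i + b)) =
      (Complex.exp (2 * Real.pi * Complex.I * (b : ℂ)) * ζ ^ i.val).re := fun i => by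
    rw [← exp_two_pi_I_re, hζ, ← Complex.exp_nat_mul, ← Complex.exp_add]
    congr 2
    unfold gridPt spaceStep
    push_cast
    field_simp
    ring
  simp_rw [hterm]
  rw [← Complex.re_sum, ← Finset.mul_sum, sum_zmod_val (fun k => ζ ^ k), hgeom]
  simp

/-- The modes of σ_M have |m₁| ≤ M − 1 < N, so none with m₁ ≠ 0 is aliased to a constant on the
grid, and those with m₁ = 0 have zero coefficient. -/
theorem sum_sigmaKernel_grid {M N : ℕ} [NeZero N] (hMN : M ≤ N) (y : ℝ) :
    ∑ i : ZMod N, sigmaKernel M (gridPt N i, y) = 0 := by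
  simp_rw [sigmaKernel_eq]
  rw [← Finset.mul_sum]
  refine mul_eq_zero_of_right _ ?_
  rw [Finset.sum_comm]
  refine Finset.sum_eq_zero fun n₁ hn₁ => ?_
  rw [Finset.sum_comm]
  refine Finset.sum_eq_zero fun n₂ _ => ?_
  rw [Finset.sum_comm]
  refine Finset.sum_eq_zero fun m₁ hm₁ => ?_
  rw [Finset.sum_comm]
  refine Finset.sum_eq_zero fun m₂ _ => ?_
  rw [← Finset.mul_sum]
  by_cases h : m₁ = 0
  · rw [h, kernelCoeff_zero_left, zero_mul]
  · rw [sum_cos_grid h, mul_zero]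
    have := Finset.mem_range.1 hn₁
    have := Finset.mem_Icc.1 hm₁
    rw [abs_lt]; omega

theorem periodic_gridPt_intCast {N : ℕ} [NeZero N] {α : Type*} {f : ℝ → α}
    (hf : Function.Periodic f 1) (k : ℤ) : f (gridPt N (k : ZMod N)) = f (k * spaceStep N) := by
  have h1 : (((k : ZMod N).val : ℕ) : ℤ) = k % N := ZMod.val_intCast k
  have h2 : (k : ℝ) = ((k : ZMod N).val : ℝ) + N * ((k / N : ℤ) : ℝ) := by
    have h3 : k = ((k : ZMod N).val : ℤ) + N * (k / N) := by rw [h1]; exact (Int.emod_add_mul_ediv k N).symm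
    exact_mod_cast h3
  rw [h2, gridPt, add_mul, mul_right_comm, natCast_mul_spaceStep, one_mul]
  have := hf.int_mul (k / N) (((k : ZMod N).val : ℝ) * spaceStep N)
  rw [mul_one] at this
  exact this.symm

/-! ### Translation invariance of integrals of periodic functions -/

instance isAddHaarMeasure_volume_prod3 :
    (volume : Measure (ℝ × ℝ × ℝ)).IsAddHaarMeasure := by
  rw [Measure.volume_eq_prod]; infer_instance

/-- The lattice `{0} × ℤ × ℤ` in `ℝ × ℝ × ℝ`. -/
def spaceLattice : AddSubgroup (ℝ × ℝ × ℝ) where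
  carrier := range fun k : ℤ × ℤ => ((0 : ℝ), (k.1 : ℝ), (k.2 : ℝ))
  zero_mem' := ⟨0, by simp⟩
  add_mem' := by
    rintro _ _ ⟨a, rfl⟩ ⟨b, rfl⟩
    exact ⟨a + b, by simp⟩
  neg_mem' := by
    rintro _ ⟨a, rfl⟩
    exact ⟨-a, by simp⟩

instance : Countable spaceLattice :=
  (countable_range fun k : ℤ × ℤ => ((0 : ℝ), (k.1 : ℝ), (k.2 : ℝ))).to_subtype

theorem mem_unitCell {x : ℝ × ℝ} : x ∈ unitCell ↔ ⌊x.1⌋ = 0 ∧ ⌊x.2⌋ = 0 := by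
  simp only [unitCell, mem_prod, mem_Ico, Int.floor_eq_zero_iff]

theorem measurableSet_unitCell : MeasurableSet unitCell :=
  measurableSet_Ico.prod measurableSet_Ico

/-- All shifted strips are fundamental domains of the same lattice, so the integral of a periodic
function does not depend on the shift, with no integrability needed. Time is not quotiented: the
strip contains the whole time axis, which lets `d` have a time component. -/
theorem isAddFundamentalDomain_strip (d : ℝ × ℝ × ℝ) :
    IsAddFundamentalDomain spaceLattice {z : ℝ × ℝ × ℝ | (z - d).2 ∈ unitCell} volume := by
  refine IsAddFundamentalDomain.mk' ?_ fun z => ?_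
  · exact (measurableSet_unitCell.preimage (by fun_prop)).nullMeasurableSet
  · refine ⟨⟨(0, ((-⌊(z - d).2.1⌋ : ℤ) : ℝ), ((-⌊(z - d).2.2⌋ : ℤ) : ℝ)), ⟨(_, _), rfl⟩⟩, ?_, ?_⟩
    · simp only [mem_ofPred_eq, AddSubgroup.vadd_def, vadd_eq_add, mem_unitCell]
      simp only [Prod.snd_sub, Prod.snd_add, Prod.fst_sub, Prod.fst_add]
      constructor <;> rw [add_sub_assoc, Int.floor_intCast_add] <;> simp
    · rintro ⟨_, ⟨m, n⟩, rfl⟩ h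
      simp only [mem_ofPred_eq, AddSubgroup.vadd_def, vadd_eq_add, mem_unitCell,
        Prod.snd_sub, Prod.snd_add, Prod.fst_sub, Prod.fst_add] at h
      rw [add_sub_assoc, Int.floor_intCast_add, add_sub_assoc, Int.floor_intCast_add] at h
      have hm : m = -⌊(z - d).2.1⌋ := by simp only [Prod.snd_sub, Prod.fst_sub]; omega
      have hn : n = -⌊(z - d).2.2⌋ := by simp only [Prod.snd_sub]; omega
      subst hm hn
      rfl

theorem setIntegral_strip_add {G : ℝ × ℝ × ℝ → ℝ} (hG : IsSpacePeriodic G) (d : ℝ × ℝ × ℝ) :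
    ∫ z in univ ×ˢ unitCell, G (z + d) = ∫ z in univ ×ˢ unitCell, G z := by
  have hS : ∀ d, (univ ×ˢ unitCell : Set (ℝ × ℝ × ℝ)) =
      (fun z => z + d) ⁻¹' {z : ℝ × ℝ × ℝ | (z - d).2 ∈ unitCell} := fun d => by
    ext z; simp
  have hmp : MeasurePreserving (fun z : ℝ × ℝ × ℝ => z + d) volume volume :=
    measurePreserving_add_right volume d
  rw [hS d, hmp.setIntegral_preimage_emb (measurableEmbedding_addRight d) G]
  have h0 : (fun z => z + d) ⁻¹' {z : ℝ × ℝ × ℝ | (z - d).2 ∈ unitCell} =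
      {z : ℝ × ℝ × ℝ | (z - 0).2 ∈ unitCell} := by
    ext z; simp
  rw [h0]
  refine (isAddFundamentalDomain_strip d).setIntegral_eq (isAddFundamentalDomain_strip 0) ?_
  rintro ⟨_, ⟨m, n⟩, rfl⟩ ⟨t, x⟩
  have hp : TorusPeriodic fun x => G (t, x) := fun x₁ x₂ => hG t x₁ x₂
  have := hp.add_int x m n
  simp only [AddSubgroup.vadd_def, vadd_eq_add, Prod.mk_add_mk, zero_add]
  rw [add_comm]
  exact this

theorem setIntegral_cylinder_eq_strip {T δ : ℝ} (hδ : 0 < δ) {G : ℝ × ℝ × ℝ → ℝ}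
    (hG : ∀ z, G z ≠ 0 → δ ≤ z.1 ∧ z.1 ≤ T - δ) :
    ∫ z in cylinder T, G z = ∫ z in univ ×ˢ unitCell, G z := by
  symm
  refine setIntegral_eq_of_subset_of_forall_sdiff_eq_zero
    (MeasurableSet.univ.prod measurableSet_unitCell)
    (prod_mono (subset_univ _) subset_rfl) fun z hz => ?_
  by_contra h
  obtain ⟨h1, h2⟩ := hG z h
  exact hz.2 ⟨⟨by linarith, by linarith⟩, hz.1.2⟩

/-- The integral over the cylinder of a periodic function that is supported away from the times
`0` and `T` is invariant under small translations. -/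
theorem setIntegral_cylinder_add {T δ : ℝ} {G : ℝ × ℝ × ℝ → ℝ} (hG : IsSpacePeriodic G)
    (hsupp : ∀ z, G z ≠ 0 → δ ≤ z.1 ∧ z.1 ≤ T - δ) {d : ℝ × ℝ × ℝ} (hd : |d.1| < δ) :
    ∫ z in cylinder T, G (z + d) = ∫ z in cylinder T, G z := by
  have hd' := abs_lt.1 hd
  have h0 := abs_nonneg d.1
  rw [setIntegral_cylinder_eq_strip (lt_of_le_of_lt h0 hd) hsupp,
    setIntegral_cylinder_eq_strip (δ := δ - |d.1|) (by linarith), setIntegral_strip_add hG]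
  intro z hz
  obtain ⟨h1, h2⟩ := hsupp _ hz
  simp only [Prod.fst_add] at h1 h2
  have := neg_abs_le d.1
  have := le_abs_self d.1
  exact ⟨by linarith, by linarith⟩

theorem setIntegral_unitCell_add {g : ℝ × ℝ → ℝ} (hg : TorusPeriodic g) (c : ℝ × ℝ) :
    ∫ x in unitCell, g (x + c) = ∫ x in unitCell, g x := by
  -- A time factor of integral one reduces the torus to the strip.
  set χ : ℝ → ℝ := (Ico (0 : ℝ) 1).indicator fun _ => 1
  have hχ : ∫ t in univ, χ t = 1 := by
    rw [setIntegral_univ, integral_indicator measurableSet_Ico]; simp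
  have key : ∀ g : ℝ × ℝ → ℝ, ∫ z in univ ×ˢ unitCell, χ z.1 * g z.2 = ∫ x in unitCell, g x := by
    intro g
    rw [Measure.volume_eq_prod, setIntegral_prod_mul χ g, hχ, one_mul]
  have h := setIntegral_strip_add (G := fun z => χ z.1 * g z.2)
    (fun t x₁ x₂ => by simp [(hg x₁ x₂).1, (hg x₁ x₂).2]) (0, c)
  rw [← key g, ← h, ← key fun x => g (x + c)]
  simp

/-! ### Functions with nonnegative weak derivative in `x₁` -/

/-- The periods of `f` up to null sets. -/
def aePeriods (f : ℝ × ℝ → ℝ) : AddSubgroup (ℝ × ℝ) where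
  carrier := {c | ∀ᵐ x, f (x + c) = f x}
  zero_mem' := by simp
  add_mem' := by
    intro a b ha hb
    filter_upwards [ha, (quasiMeasurePreserving_add_right volume a).ae hb] with x h1 h2
    rw [← add_assoc, h2, h1]
  neg_mem' := by
    intro a ha
    filter_upwards [(quasiMeasurePreserving_add_right volume (-a)).ae ha] with x h1
    rw [← h1, neg_add_cancel_right]

/-- Mollifications of `f` are smooth with nonnegative x₁-derivative, hence monotone along x₁, and
they converge to `f` almost everywhere. -/
theorem ae_le_add_of_hasWeakDerivX1 {f g : ℝ × ℝ → ℝ} (hf : LocallyIntegrable f)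
    (hfg : HasWeakDerivX1 f g) (hg : ∀ᵐ x, 0 ≤ g x) {s : ℝ} (hs : 0 ≤ s) :
    ∀ᵐ x, f x ≤ f (x + (s, 0)) := by
  let φ : ℕ → ContDiffBump (0 : ℝ × ℝ) := fun n =>
    ⟨1 / ((n : ℝ) + 1), 2 / ((n : ℝ) + 1), by positivity, by gcongr; norm_num⟩
  have hφ : Tendsto (fun n => (φ n).rOut) atTop (𝓝 0) :=
    tendsto_const_div_atTop_nhds_zero_nat 2 |>.comp (tendsto_add_atTop_nat 1) |>.congr
      fun n => by simp [φ]
  -- The outer radius is twice the inner one; this bounded ratio is what convergence at almost every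
  -- point requires.
  have hlim := ContDiffBump.ae_convolution_tendsto_right_of_locallyIntegrable (μ := volume)
    (K := 2) hφ (Eventually.of_forall fun n => by simp only [φ]; apply le_of_eq; ring) hf
  have hmono : ∀ n x, (convolution ((φ n).normed volume) f (ContinuousLinearMap.lsmul ℝ ℝ)
      volume) x ≤ (convolution ((φ n).normed volume) f (ContinuousLinearMap.lsmul ℝ ℝ) volume)
        (x + (s, 0)) := by
    intro n x
    set b := (φ n).normed volume with hb
    have hbs : ContDiff ℝ ∞ b := (φ n).contDiff_normed
    have hbc : HasCompactSupport b := (φ n).hasCompactSupport_normed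
    have hswap : convolution b f (ContinuousLinearMap.lsmul ℝ ℝ) volume =
        convolution f b (ContinuousLinearMap.lsmul ℝ ℝ).flip volume := convolution_flip _ |>.symm
    rw [hswap]
    set C := convolution f b (ContinuousLinearMap.lsmul ℝ ℝ).flip volume with hC
    have hb1 : ContDiff ℝ 1 b := hbs.of_le (by simp)
    have hder : ∀ y, HasFDerivAt C (convolution f (fderiv ℝ b)
        ((ContinuousLinearMap.lsmul ℝ ℝ).flip.precompR (ℝ × ℝ)) volume y) y := fun y =>
      hbc.hasFDerivAt_convolution_right _ hf hb1 y
    have hpos : ∀ y, 0 ≤ fderiv ℝ C y (1, 0) := by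
      intro y
      rw [(hder y).fderiv, convolution_precompR_apply _ hf (hbc.fderiv ℝ)
        (hb1.continuous_fderiv one_ne_zero), convolution_def]
      have h1 : ∀ t, fderiv ℝ (fun t => b (y - t)) t = -fderiv ℝ b (y - t) := fun t => by
        have h3 : HasFDerivAt (fun t => b (y - t)) ((fderiv ℝ b (y - t)).comp
            (-ContinuousLinearMap.id ℝ (ℝ × ℝ))) t :=
          (hb1.differentiable one_ne_zero (y - t)).hasFDerivAt.comp t
            ((hasFDerivAt_id t).const_sub y)
        rw [h3.fderiv]; ext <;> simp
      -- Tested with `t ↦ b (y - t)`, whose derivative brings a minus sign, the weak formulation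
      -- turns the derivative of the mollification into ∫ g b(y − ·).
      have h2 := hfg (fun t => b (y - t)) (hbs.comp (contDiff_const.sub contDiff_id))
        (hbc.comp_homeomorph (Homeomorph.subLeft y))
      simp only [h1, _root_.neg_apply, mul_neg, integral_neg, neg_inj] at h2
      simp only [ContinuousLinearMap.flip_apply, ContinuousLinearMap.lsmul_apply, smul_eq_mul]
      simp_rw [mul_comm (fderiv ℝ b _ _)]
      rw [h2]
      refine integral_nonneg_of_ae ?_
      filter_upwards [hg] with t ht
      exact mul_nonneg ht ((φ n).nonneg_normed _)
    have hline : ∀ r : ℝ, HasDerivAt (fun r : ℝ => C (x + (r, 0)))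
        (fderiv ℝ C (x + (r, 0)) (1, 0)) r := fun r => by
      have h1 : HasDerivAt (fun r : ℝ => x + (r, (0 : ℝ))) ((1 : ℝ), (0 : ℝ)) r :=
        ((hasDerivAt_id r).prodMk (hasDerivAt_const r 0)).const_add x
      exact (hder _).differentiableAt.hasFDerivAt.comp_hasDerivAt r h1
    have hm : Monotone fun r : ℝ => C (x + (r, 0)) :=
      monotone_of_deriv_nonneg (fun r => (hline r).differentiableAt)
        fun r => by rw [(hline r).deriv]; exact hpos _
    have : C (x + (0, 0)) ≤ C (x + (s, 0)) := hm hs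
    rwa [show x + ((0 : ℝ), (0 : ℝ)) = x by ext <;> simp] at this
  filter_upwards [hlim, (quasiMeasurePreserving_add_right volume ((s, 0) : ℝ × ℝ)).ae hlim]
    with x h1 h2
  exact le_of_tendsto_of_tendsto' h1 h2 fun n => hmono n x

/-! ### Regularized initial data -/

section RegInitial

variable {L : ℝ} {ρ₀ : ℝ × ℝ → ℝ}

theorem IsInitialDatum.locallyIntegrable (h : IsInitialDatum L ρ₀) : LocallyIntegrable ρ₀ := by
  rw [locallyIntegrable_iff]
  intro K hK
  have : IsFiniteMeasure (volume.restrict K) := ⟨by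
    simpa using hK.measure_lt_top⟩
  exact (h.memL2loc K hK).integrable (by norm_num)

theorem IsInitialDatum.locallyIntegrable_perPart (h : IsInitialDatum L ρ₀) :
    LocallyIntegrable (perPart L ρ₀) := by
  refine h.locallyIntegrable.sub (Continuous.locallyIntegrable (by fun_prop))

/-- The almost everywhere periods form a group, so the two generators suffice; the increment `L` is
cancelled by the linear part. -/
theorem IsInitialDatum.ae_perPart_add (h : IsInitialDatum L ρ₀) :
    ∀ᵐ x, ∀ m n : ℤ, perPart L ρ₀ (x + ((m : ℝ), (n : ℝ))) = perPart L ρ₀ x := by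
  rw [ae_all_iff]; intro m
  rw [ae_all_iff]; intro n
  have h1 : ((1 : ℝ), (0 : ℝ)) ∈ aePeriods (perPart L ρ₀) := by
    change ∀ᵐ x, _
    filter_upwards [h.shift_x1] with x hx
    simp only [perPart, Prod.fst_add]
    rw [show x + ((1 : ℝ), (0 : ℝ)) = (x.1 + 1, x.2) by ext <;> simp, hx]
    ring
  have h2 : ((0 : ℝ), (1 : ℝ)) ∈ aePeriods (perPart L ρ₀) := by
    change ∀ᵐ x, _
    filter_upwards [h.shift_x2] with x hx
    simp only [perPart, Prod.fst_add]
    rw [show x + ((0 : ℝ), (1 : ℝ)) = (x.1, x.2 + 1) by ext <;> simp, hx]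
    ring
  have := add_mem (zsmul_mem h1 m) (zsmul_mem h2 n)
  simpa using! this

/-- The periodic representative of the periodic part of `ρ₀`. -/
noncomputable def perRep (L : ℝ) (ρ₀ : ℝ × ℝ → ℝ) (x : ℝ × ℝ) : ℝ :=
  perPart L ρ₀ (Int.fract x.1, Int.fract x.2)

theorem torusPeriodic_perRep : TorusPeriodic (perRep L ρ₀) := fun x₁ x₂ => by
  simp [perRep]

theorem regInitial_eq (M : ℕ) (x : ℝ × ℝ) : regInitial M L ρ₀ x =
    ∫ y in unitCell, fejerKernel2 M (x - y) * perRep L ρ₀ y := by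
  refine setIntegral_congr_fun measurableSet_unitCell fun y hy => ?_
  have h1 : Int.fract y.1 = y.1 := Int.fract_eq_self.2 ⟨hy.1.1, hy.1.2⟩
  have h2 : Int.fract y.2 = y.2 := Int.fract_eq_self.2 ⟨hy.2.1, hy.2.2⟩
  simp only [perRep, h1, h2]

theorem IsInitialDatum.perRep_ae_eq (h : IsInitialDatum L ρ₀) :
    perRep L ρ₀ =ᵐ[volume] perPart L ρ₀ := by
  filter_upwards [h.ae_perPart_add] with x hx
  rw [← hx (-⌊x.1⌋) (-⌊x.2⌋), perRep]
  congr 1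
  ext <;> simp [Int.fract, sub_eq_add_neg]

theorem integrableOn_unitCell_of_locallyIntegrable {f : ℝ × ℝ → ℝ} (hf : LocallyIntegrable f) :
    IntegrableOn f unitCell := by
  refine (hf.integrableOn_isCompact (isCompact_Icc.prod isCompact_Icc :
    IsCompact (Icc (0 : ℝ) 1 ×ˢ Icc (0 : ℝ) 1))).mono_set ?_
  exact prod_mono Ico_subset_Icc_self Ico_subset_Icc_self

theorem IsInitialDatum.integrableOn_perRep_add (h : IsInitialDatum L ρ₀) (c : ℝ × ℝ) :
    IntegrableOn (fun y => perRep L ρ₀ (y + c)) unitCell := by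
  have h1 : LocallyIntegrable fun y => perPart L ρ₀ (y + c) := by
    rw [locallyIntegrable_iff]
    intro K hK
    have := h.locallyIntegrable_perPart.integrableOn_isCompact
      (hK.image (by fun_prop : Continuous fun y => y + c))
    have h3 := ((measurePreserving_add_right volume c).integrableOn_comp_preimage
      (measurableEmbedding_addRight c)).2 this
    rwa [preimage_image_eq _ (add_left_injective c)] at h3
  refine (integrableOn_unitCell_of_locallyIntegrable h1).congr (ae_restrict_of_ae ?_)
  filter_upwards [(quasiMeasurePreserving_add_right volume c).ae h.perRep_ae_eq] with y hy
  exact hy.symm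

theorem IsInitialDatum.integrableOn_perRep (h : IsInitialDatum L ρ₀) :
    IntegrableOn (perRep L ρ₀) unitCell := by
  simpa using h.integrableOn_perRep_add 0

theorem integrableOn_kernel_mul {k f : ℝ × ℝ → ℝ} (hk : TorusPeriodic k) (hkc : Continuous k)
    (hf : IntegrableOn f unitCell) (x : ℝ × ℝ) :
    IntegrableOn (fun y => k (x - y) * f y) unitCell := by
  obtain ⟨C, -, hC⟩ := hk.exists_bound hkc
  exact hf.bdd_mul (c := C) (Continuous.aestronglyMeasurable (by fun_prop))
    (Eventually.of_forall fun y => hC _)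

theorem torusPeriodic_regInitial (M : ℕ) : TorusPeriodic (regInitial M L ρ₀) := fun x₁ x₂ => by
  have h := torusPeriodic_fejerKernel2 M
  have e : ∀ a b : ℝ, (∀ y, fejerKernel2 M ((a, b) - y) = fejerKernel2 M ((x₁, x₂) - y)) →
      regInitial M L ρ₀ (a, b) = regInitial M L ρ₀ (x₁, x₂) := fun a b hab => by
    simp only [regInitial, torusConv, hab]
  refine ⟨e _ _ fun y => ?_, e _ _ fun y => ?_⟩
  · refine Eq.trans ?_ (h (x₁ - y.1) (x₂ - y.2)).1
    congr 1; ext <;> simp; ring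
  · refine Eq.trans ?_ (h (x₁ - y.1) (x₂ - y.2)).2
    congr 1; ext <;> simp; ring

theorem IsInitialDatum.exists_lipschitz_regInitial (h : IsInitialDatum L ρ₀) (M : ℕ) :
    ∃ C : ℝ, 0 ≤ C ∧ ∀ x y, |regInitial M L ρ₀ x - regInitial M L ρ₀ y| ≤ C * ‖x - y‖ := by
  obtain ⟨C, hC0, hC⟩ := (torusPeriodic_fejerKernel2 M).exists_lipschitz (contDiff_fejerKernel2 M)
  have hcont := (contDiff_fejerKernel2 M (n := 1)).continuous
  refine ⟨C * ∫ y in unitCell, |perRep L ρ₀ y|,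
    mul_nonneg hC0 (integral_nonneg fun _ => abs_nonneg _), fun x x' => ?_⟩
  rw [regInitial_eq, regInitial_eq, ← integral_sub
    (integrableOn_kernel_mul (torusPeriodic_fejerKernel2 M) hcont h.integrableOn_perRep x)
    (integrableOn_kernel_mul (torusPeriodic_fejerKernel2 M) hcont h.integrableOn_perRep x')]
  calc _ ≤ ∫ y in unitCell, C * ‖x - x'‖ * |perRep L ρ₀ y| := by
        rw [← Real.norm_eq_abs]
        refine norm_integral_le_of_norm_le (Integrable.const_mul h.integrableOn_perRep.abs _)
          (Eventually.of_forall fun y => ?_)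
        rw [← sub_mul, Real.norm_eq_abs, abs_mul]
        refine mul_le_mul_of_nonneg_right ?_ (abs_nonneg _)
        simpa using hC (x - y) (x' - y)
    _ = _ := by rw [integral_const_mul]; ring

/-- By periodicity the shift moves from the kernel to the datum, and the constant `L * s` enters the
integral because the kernel has integral one. What is averaged is then the increment of ρ₀ itself
over a shift in x₁, which is nonnegative. -/
theorem IsInitialDatum.regInitial_add_ge (h : IsInitialDatum L ρ₀) {M : ℕ} (hM : 1 ≤ M)
    {s : ℝ} (hs : 0 ≤ s) (x : ℝ × ℝ) :
    0 ≤ regInitial M L ρ₀ (x + (s, 0)) - regInitial M L ρ₀ x + L * s := by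
  have hcont := (contDiff_fejerKernel2 M (n := 1)).continuous
  have hper := torusPeriodic_fejerKernel2 M
  have hshift : regInitial M L ρ₀ (x + (s, 0)) =
      ∫ y in unitCell, fejerKernel2 M (x - y) * perRep L ρ₀ (y + (s, 0)) := by
    have hG : TorusPeriodic fun y => fejerKernel2 M (x + (s, 0) - y) * perRep L ρ₀ y :=
      fun y₁ y₂ => by
        have e1 := hper.add_int (x + (s, 0) - (y₁, y₂)) (-1) 0
        have e2 := hper.add_int (x + (s, 0) - (y₁, y₂)) 0 (-1)
        simp only [(torusPeriodic_perRep y₁ y₂).1, (torusPeriodic_perRep y₁ y₂).2]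
        rw [← e1]
        constructor
        · congr 2; ext <;> simp; ring
        · rw [e1, ← e2]; congr 2; ext <;> simp; ring
    rw [regInitial_eq, ← setIntegral_unitCell_add hG (s, 0)]
    simp
  have hone : L * s = ∫ y in unitCell, fejerKernel2 M (x - y) * (L * s) := by
    have hp : TorusPeriodic fun y => fejerKernel2 M y := hper
    have hneg : ∫ y in unitCell, fejerKernel2 M (x - y) = ∫ y in unitCell, fejerKernel2 M y := by
      have hev : ∀ y : ℝ × ℝ, fejerKernel2 M (-y) = fejerKernel2 M y := fun y => by
        simp [fejerKernel2, fejerKernel_eq]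
      rw [← setIntegral_unitCell_add hp (-x)]
      congr 1; ext y; rw [← hev]; congr 1; abel
    rw [integral_mul_const, hneg, integral_fejerKernel2 hM, one_mul]
  have i1 := integrableOn_kernel_mul hper hcont (h.integrableOn_perRep_add (s, 0)) x
  have i2 := integrableOn_kernel_mul hper hcont h.integrableOn_perRep x
  have i3 := integrableOn_kernel_mul hper hcont (f := fun _ => L * s)
    (integrableOn_unitCell_of_locallyIntegrable (locallyIntegrable_const _)) x
  rw [hshift, regInitial_eq, hone, ← integral_sub i1 i2, ← integral_add (by exact i1.sub i2) i3]
  obtain ⟨g, -, hg, hg0, -⟩ := h.deriv_x1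
  refine integral_nonneg_of_ae (ae_restrict_of_ae ?_)
  filter_upwards [ae_le_add_of_hasWeakDerivX1 h.locallyIntegrable hg hg0 hs, h.perRep_ae_eq,
    (quasiMeasurePreserving_add_right volume ((s, 0) : ℝ × ℝ)).ae h.perRep_ae_eq] with y h1 h2 h3
  simp only [Pi.zero_apply]
  rw [h2, h3, ← mul_sub, ← mul_add]
  refine mul_nonneg (fejerKernel2_nonneg _ _) ?_
  simp only [perPart, Prod.fst_add]
  linarith

end RegInitial

/-! ### The upwind flux -/

/-- The upwind flux `λ₊ A - λ₋ B`. -/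
noncomputable def upwindFlux (lam A B : ℝ) : ℝ := max lam 0 * A - max (-lam) 0 * B

theorem max_zero_sub_max_neg_zero (x : ℝ) : max x 0 - max (-x) 0 = x := by
  rcases le_total 0 x with h | h
  · rw [max_eq_left h, max_eq_right (by linarith)]; ring
  · rw [max_eq_right h, max_eq_left (by linarith)]; ring

theorem max_zero_add_max_neg_zero (x : ℝ) : max x 0 + max (-x) 0 = |x| := by
  rcases le_total 0 x with h | h
  · rw [max_eq_left h, max_eq_right (by linarith), abs_of_nonneg h]; ring
  · rw [max_eq_right h, max_eq_left (by linarith), abs_of_nonpos h]; ring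

/-- For y ≤ x the increments of λ₊ and of −λ₋ are both nonnegative and add up to x − y, so the
Lipschitz constant is `K` and not `2 * K`. -/
theorem abs_upwindFlux_sub_le {A B K : ℝ} (hA : 0 ≤ A) (hB : 0 ≤ B) (hAK : A ≤ K) (hBK : B ≤ K)
    (x y : ℝ) : |upwindFlux x A B - upwindFlux y A B| ≤ |x - y| * K := by
  have key : ∀ x y : ℝ, y ≤ x → |upwindFlux x A B - upwindFlux y A B| ≤ |x - y| * K := by
    intro x y h
    have h1 : max y 0 ≤ max x 0 := max_le_max_right 0 h
    have h2 : max (-x) 0 ≤ max (-y) 0 := max_le_max_right 0 (by linarith)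
    have h3 := max_zero_sub_max_neg_zero x
    have h4 := max_zero_sub_max_neg_zero y
    have e : upwindFlux x A B - upwindFlux y A B =
        (max x 0 - max y 0) * A + (max (-y) 0 - max (-x) 0) * B := by
      unfold upwindFlux; ring
    rw [e, abs_of_nonneg (by linarith : 0 ≤ x - y), abs_of_nonneg (add_nonneg
      (mul_nonneg (by linarith) hA) (mul_nonneg (by linarith) hB))]
    calc _ ≤ (max x 0 - max y 0) * K + (max (-y) 0 - max (-x) 0) * K :=
          add_le_add (mul_le_mul_of_nonneg_left hAK (by linarith))
            (mul_le_mul_of_nonneg_left hBK (by linarith))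
      _ = (x - y) * K := by rw [← add_mul]; congr 1; linarith
  rcases le_total y x with h | h
  · exact key x y h
  · rw [abs_sub_comm, abs_sub_comm x]; exact key y x h

theorem abs_upwindFlux_le {A B K : ℝ} (hA : 0 ≤ A) (hB : 0 ≤ B) (hAK : A ≤ K) (hBK : B ≤ K)
    (x : ℝ) : |upwindFlux x A B| ≤ |x| * K := by
  have := abs_upwindFlux_sub_le hA hB hAK hBK x 0
  simpa [upwindFlux] using this

/-! ### Discrete convolutions -/

section GridConv

variable {N : ℕ} [NeZero N]

/-- The convolution of two functions on the grid. -/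
noncomputable def gridConv (S w : ZMod N → ZMod N → ℝ) (i j : ZMod N) : ℝ :=
  ∑ l : ZMod N, ∑ r : ZMod N, spaceStep N ^ 2 * S l r * w (i - l) (j - r)

theorem sum_sum_spaceStep_sq (C : ℝ) :
    ∑ _l : ZMod N, ∑ _r : ZMod N, spaceStep N ^ 2 * C = C := by
  have h := natCast_mul_spaceStep N
  simp only [Finset.sum_const, Finset.card_univ, ZMod.card, nsmul_eq_mul]
  linear_combination (N * spaceStep N + 1) * C * h

theorem gridConv_sub (S w w' : ZMod N → ZMod N → ℝ) (i j : ZMod N) :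
    gridConv S (fun k q => w k q - w' k q) i j = gridConv S w i j - gridConv S w' i j := by
  simp only [gridConv, mul_sub, Finset.sum_sub_distrib]

theorem abs_gridConv_le {S w : ZMod N → ZMod N → ℝ} {B W : ℝ} (hS : ∀ l r, |S l r| ≤ B)
    (hw : ∀ k q, |w k q| ≤ W) (i j : ZMod N) : |gridConv S w i j| ≤ B * W := by
  have hB : 0 ≤ B := (abs_nonneg _).trans (hS 0 0)
  rw [← sum_sum_spaceStep_sq (N := N) (B * W)]
  refine (Finset.abs_sum_le_sum_abs _ _).trans (Finset.sum_le_sum fun l _ => ?_)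
  refine (Finset.abs_sum_le_sum_abs _ _).trans (Finset.sum_le_sum fun r _ => ?_)
  rw [abs_mul, abs_mul, abs_of_nonneg (sq_nonneg _), mul_assoc]
  exact mul_le_mul_of_nonneg_left (mul_le_mul (hS _ _) (hw _ _) (abs_nonneg _) hB) (sq_nonneg _)

/-- The L¹ to L^∞ bound. It serves for differences in x₁, whose sum over a row is controlled by
total variation while their size is not yet. -/
theorem abs_gridConv_le_sum {S w : ZMod N → ZMod N → ℝ} {B : ℝ} (hS : ∀ l r, |S l r| ≤ B)
    (i j : ZMod N) :
    |gridConv S w i j| ≤ B * spaceStep N ^ 2 * ∑ q : ZMod N, ∑ k : ZMod N, |w k q| := by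
  have h1 : |gridConv S w i j| ≤
      ∑ l : ZMod N, ∑ r : ZMod N, B * spaceStep N ^ 2 * |w (i - l) (j - r)| := by
    refine (Finset.abs_sum_le_sum_abs _ _).trans (Finset.sum_le_sum fun l _ => ?_)
    refine (Finset.abs_sum_le_sum_abs _ _).trans (Finset.sum_le_sum fun r _ => ?_)
    rw [abs_mul, abs_mul, abs_of_nonneg (sq_nonneg _), mul_comm B]
    exact mul_le_mul_of_nonneg_right (mul_le_mul_of_nonneg_left (hS _ _) (sq_nonneg _))
      (abs_nonneg _)
  refine h1.trans (le_of_eq ?_)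
  simp_rw [← Finset.mul_sum]
  congr 1
  rw [Finset.sum_comm]
  rw [← Equiv.sum_comp (Equiv.subLeft j) (fun q => ∑ k, |w k q|)]
  refine Finset.sum_congr rfl fun r _ => ?_
  exact Equiv.sum_comp (Equiv.subLeft i) (fun k => |w k (j - r)|)

/-- A kernel with vanishing sums in the first index annihilates functions of the second variable
alone, so row averages of `w` play no role. -/
theorem gridConv_eq_of_sum_eq_zero {S : ZMod N → ZMod N → ℝ} (hS : ∀ r, ∑ l, S l r = 0)
    (w : ZMod N → ZMod N → ℝ) (i j : ZMod N) :
    gridConv S w i j = gridConv S (fun k q => w k q - w 0 q) i j := by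
  rw [gridConv_sub]
  have : gridConv S (fun _ q => w 0 q) i j = 0 := by
    unfold gridConv
    rw [Finset.sum_comm]
    refine Finset.sum_eq_zero fun r _ => ?_
    rw [← Finset.sum_mul, ← Finset.mul_sum, hS]; simp
  rw [this, sub_zero]

theorem abs_gridConv_le_of_osc {S w : ZMod N → ZMod N → ℝ} {B W : ℝ} (hS : ∀ l r, |S l r| ≤ B)
    (hS0 : ∀ r, ∑ l, S l r = 0) (hw : ∀ k q, |w k q - w 0 q| ≤ W) (i j : ZMod N) :
    |gridConv S w i j| ≤ B * W := by
  rw [gridConv_eq_of_sum_eq_zero hS0]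
  exact abs_gridConv_le hS hw i j

theorem gridConv_add_one_left (S w : ZMod N → ZMod N → ℝ) (i j : ZMod N) :
    gridConv S w (i + 1) j - gridConv S w i j =
      gridConv S (fun k q => w (k + 1) q - w k q) i j := by
  rw [gridConv_sub]
  congr 1
  simp only [gridConv, sub_add_eq_add_sub]

/-- In x₂ the difference is put on the kernel, since monotonicity gives no information on `w` in
that direction. -/
theorem gridConv_add_one_right (S w : ZMod N → ZMod N → ℝ) (i j : ZMod N) :
    gridConv S w i (j + 1) - gridConv S w i j =
      gridConv (fun l r => S l (r + 1) - S l r) w i j := by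
  simp only [gridConv, mul_sub, sub_mul, Finset.sum_sub_distrib]
  congr 1
  refine Finset.sum_congr rfl fun l _ => ?_
  rw [← Equiv.sum_comp (Equiv.addRight (1 : ZMod N))]
  refine Finset.sum_congr rfl fun r _ => ?_
  simp only [Equiv.coe_addRight, add_sub_add_right_eq_sub]

end GridConv

/-! ### Monotone grid functions -/

section GridMono

variable {N : ℕ} [NeZero N] {L : ℝ} {v : ZMod N → ZMod N → ℝ}

/-- The grid function `v + L x₁` is nondecreasing in `x₁`. -/
def GridMono (N : ℕ) (L : ℝ) (v : ZMod N → ZMod N → ℝ) : Prop :=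
  ∀ i j, 0 ≤ discDerivX1 N v i j + L

theorem spaceStep_mul_discDerivX1 (v : ZMod N → ZMod N → ℝ) (i j : ZMod N) :
    spaceStep N * discDerivX1 N v i j = v (i + 1) j - v i j :=
  mul_div_cancel₀ _ (spaceStep_pos N).ne'

/-- The increments of `v` telescope around the circle. -/
theorem sum_spaceStep_mul_deriv (L : ℝ) (v : ZMod N → ZMod N → ℝ) (j : ZMod N) :
    ∑ i, spaceStep N * (discDerivX1 N v i j + L) = L := by
  simp only [mul_add, spaceStep_mul_discDerivX1, Finset.sum_add_distrib, Finset.sum_sub_distrib]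
  have h := Equiv.sum_comp (Equiv.addRight (1 : ZMod N)) (fun i => v i j)
  simp only [Equiv.coe_addRight] at h
  rw [h, sub_self, zero_add]
  simp only [Finset.sum_const, Finset.card_univ, ZMod.card, nsmul_eq_mul]
  rw [← mul_assoc, natCast_mul_spaceStep, one_mul]

theorem GridMono.deriv_le (h : GridMono N L v) (i j : ZMod N) :
    discDerivX1 N v i j + L ≤ L / spaceStep N := by
  rw [le_div_iff₀ (spaceStep_pos N), mul_comm]
  refine le_of_le_of_eq ?_ (sum_spaceStep_mul_deriv L v j)
  exact Finset.single_le_sum (f := fun i => spaceStep N * (discDerivX1 N v i j + L))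
    (fun i _ => mul_nonneg (spaceStep_pos N).le (h i j)) (Finset.mem_univ i)

theorem GridMono.sub_ge (h : GridMono N L v) (k j : ZMod N) (n : ℕ) :
    -(n * (L * spaceStep N)) ≤ v (k + n) j - v k j := by
  induction n with
  | zero => simp
  | succ n ih =>
    have h1 := mul_nonneg (spaceStep_pos N).le (h (k + n) j)
    rw [mul_add, spaceStep_mul_discDerivX1] at h1
    push_cast
    rw [← add_assoc]
    linarith

/-- Each step to the right loses at most LΔx. Going from 0 to k bounds the difference from below;
going on from k around the circle back to 0 bounds it from above. -/
theorem GridMono.abs_sub_le (hL : 0 ≤ L) (h : GridMono N L v) (k j : ZMod N) :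
    |v k j - v 0 j| ≤ L := by
  have hlt := ZMod.val_lt k
  have key : ∀ n : ℕ, n ≤ N → n * (L * spaceStep N) ≤ L := fun n hn => by
    have h1 : (n : ℝ) * spaceStep N ≤ 1 := by
      rw [← natCast_mul_spaceStep N]
      exact mul_le_mul_of_nonneg_right (by exact_mod_cast hn) (spaceStep_pos N).le
    nlinarith
  have h1 := h.sub_ge 0 j k.val
  have h2 := h.sub_ge k j (N - k.val)
  have h3 : k + ((N - k.val : ℕ) : ZMod N) = 0 := by
    rw [Nat.cast_sub hlt.le]; simp
  rw [h3] at h2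
  rw [zero_add, ZMod.natCast_zmod_val] at h1
  have := key k.val hlt.le
  have := key (N - k.val) (Nat.sub_le _ _)
  rw [abs_le]
  constructor <;> linarith

end GridMono

/-! ### One step of the scheme -/

section Step

variable {M N : ℕ} {L A α dt : ℝ}

/-- The values of `σ_M` on the grid. -/
noncomputable def gridSigma (M N : ℕ) (l r : ZMod N) : ℝ := sigmaKernel M (gridPt N l, gridPt N r)

theorem abs_gridSigma_le (hM : 1 ≤ M) (l r : ZMod N) : |gridSigma M N l r| ≤ (M : ℝ) ^ 2 :=
  abs_sigmaKernel_le hM _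

variable [NeZero N]

theorem discVelocity_eq (α : ℝ) (s : ℤˣ) (w : ZMod N → ZMod N → ℝ) (i j : ZMod N) :
    discVelocity M N α s w i j = -(sgnVal s) * (α + gridConv (gridSigma M N) w i j) := rfl

theorem abs_sgnVal (s : ℤˣ) : |sgnVal s| = 1 := by
  rcases Int.units_eq_one_or s with rfl | rfl <;> simp [sgnVal]

/-- The velocity that the pair `v` of grid functions generates. -/
noncomputable def pairVelocity (M : ℕ) (α : ℝ) (v : ℤˣ → ZMod N → ZMod N → ℝ) (s : ℤˣ)
    (i j : ZMod N) : ℝ :=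
  discVelocity M N α s (fun k l => v 1 k l - v (-1) k l) i j

/-- The map whose fixed points are the values after one step from `v`. -/
noncomputable def stepMap (M : ℕ) (L dt α : ℝ) (v x : ℤˣ → ZMod N → ZMod N → ℝ) :
    ℤˣ → ZMod N → ZMod N → ℝ := fun s i j =>
  v s i j + dt * upwindFlux (pairVelocity M α x s i j) (discDerivX1 N (v s) i j + L)
    (discDerivX1 N (v s) (i - 1) j + L)

theorem abs_pairVelocity_sub (x y : ℤˣ → ZMod N → ZMod N → ℝ) (s : ℤˣ) (i j : ZMod N) :
    |pairVelocity M α x s i j - pairVelocity M α y s i j| =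
      |gridConv (gridSigma M N) (fun k l => (x 1 k l - x (-1) k l) - (y 1 k l - y (-1) k l)) i j| := by
  simp only [pairVelocity, discVelocity_eq]
  rw [← mul_sub, abs_mul, abs_neg, abs_sgnVal, one_mul, add_sub_add_left_eq_sub,
    ← gridConv_sub (gridSigma M N) (fun k l => x 1 k l - x (-1) k l)]

/-- The consequences of the first CFL condition, with `A` a bound of the forcing. -/
structure StepCond (M N : ℕ) (L A dt : ℝ) : Prop where
  one_le : 1 ≤ M
  le : M ≤ N
  L_nonneg : 0 ≤ L
  dt_nonneg : 0 ≤ dt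
  velocity_le : dt / spaceStep N * (4 * (M : ℝ) ^ 2 * L + A) ≤ 1 / 4
  contract : dt / spaceStep N * (18 * (M : ℝ) ^ 2 * L) ≤ 1

/-- The unknown enters only through the velocity. The difference of the two signs costs 2, the
kernel M² and the known slopes L/Δx, so the factor is 2M²LΔt/Δx ≤ 1/9. No invariant ball is needed.
-/
theorem dist_stepMap_le (hc : StepCond M N L A dt) {v : ℤˣ → ZMod N → ZMod N → ℝ}
    (hv : ∀ s, GridMono N L (v s)) (x y : ℤˣ → ZMod N → ZMod N → ℝ) :
    dist (stepMap M L dt α v x) (stepMap M L dt α v y) ≤ 1 / 9 * dist x y := by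
  have h0 : (0 : ℝ) ≤ 1 / 9 * dist x y := by positivity
  refine (dist_pi_le_iff h0).2 fun s => (dist_pi_le_iff h0).2 fun i =>
    (dist_pi_le_iff h0).2 fun j => ?_
  rw [Real.dist_eq]
  have hd : ∀ s k l, |x s k l - y s k l| ≤ dist x y := fun s k l => by
    rw [← Real.dist_eq]
    exact (dist_le_pi_dist (x s k) (y s k) l).trans ((dist_le_pi_dist (x s) (y s) k).trans
      (dist_le_pi_dist x y s))
  have h1 : |gridConv (gridSigma M N)
      (fun k l => (x 1 k l - x (-1) k l) - (y 1 k l - y (-1) k l)) i j| ≤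
      (M : ℝ) ^ 2 * (2 * dist x y) := by
    refine abs_gridConv_le (abs_gridSigma_le hc.one_le) (fun k l => ?_) i j
    rw [show (x 1 k l - x (-1) k l) - (y 1 k l - y (-1) k l) =
      (x 1 k l - y 1 k l) - (x (-1) k l - y (-1) k l) by ring]
    refine (abs_sub _ _).trans ?_
    linarith [hd 1 k l, hd (-1) k l]
  rw [← abs_pairVelocity_sub (α := α) x y s i j] at h1
  have h2 := abs_upwindFlux_sub_le (hv s i j) (hv s (i - 1) j) ((hv s).deriv_le i j)
    ((hv s).deriv_le (i - 1) j) (pairVelocity M α x s i j) (pairVelocity M α y s i j)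
  have e : stepMap M L dt α v x s i j - stepMap M L dt α v y s i j =
      dt * (upwindFlux (pairVelocity M α x s i j) (discDerivX1 N (v s) i j + L)
        (discDerivX1 N (v s) (i - 1) j + L) -
      upwindFlux (pairVelocity M α y s i j) (discDerivX1 N (v s) i j + L)
        (discDerivX1 N (v s) (i - 1) j + L)) := by
    unfold stepMap; ring
  rw [e, abs_mul, abs_of_nonneg hc.dt_nonneg]
  have hLh : 0 ≤ L / spaceStep N := div_nonneg hc.L_nonneg (spaceStep_pos N).le
  calc _ ≤ dt * ((M : ℝ) ^ 2 * (2 * dist x y) * (L / spaceStep N)) :=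
        mul_le_mul_of_nonneg_left (h2.trans (mul_le_mul_of_nonneg_right h1 hLh)) hc.dt_nonneg
    _ = 1 / 9 * (dt / spaceStep N * (18 * (M : ℝ) ^ 2 * L)) * dist x y := by ring
    _ ≤ 1 / 9 * dist x y := by
        refine mul_le_mul_of_nonneg_right ?_ dist_nonneg
        linarith [hc.contract]

theorem existsUnique_fixedPoint_stepMap (hc : StepCond M N L A dt)
    {v : ℤˣ → ZMod N → ZMod N → ℝ} (hv : ∀ s, GridMono N L (v s)) :
    ∃! x, stepMap M L dt α v x = x := by
  have hK : ContractingWith (1 / 9) (stepMap M L dt α v) := by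
    refine ⟨by rw [← NNReal.coe_lt_coe]; norm_num, LipschitzWith.of_dist_le_mul fun x y => ?_⟩
    simpa using dist_stepMap_le hc hv x y
  exact ⟨hK.fixedPoint, hK.fixedPoint_isFixedPt, fun y hy => hK.fixedPoint_unique hy⟩

variable {v v' : ℤˣ → ZMod N → ZMod N → ℝ}

theorem abs_gridConv_pair_le (hM : 1 ≤ M) (hMN : M ≤ N) (hL : 0 ≤ L)
    (hv : ∀ s, GridMono N L (v s)) (i j : ZMod N) :
    |gridConv (gridSigma M N) (fun k l => v 1 k l - v (-1) k l) i j| ≤ 2 * (M : ℝ) ^ 2 * L := by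
  refine (abs_gridConv_le_of_osc (W := 2 * L) (abs_gridSigma_le hM)
    (fun r => sum_sigmaKernel_grid hMN _) (fun k l => ?_) i j).trans (le_of_eq (by ring))
  rw [show v 1 k l - v (-1) k l - (v 1 0 l - v (-1) 0 l) =
    (v 1 k l - v 1 0 l) - (v (-1) k l - v (-1) 0 l) by ring]
  refine (abs_sub _ _).trans ?_
  linarith [(hv 1).abs_sub_le hL k l, (hv (-1)).abs_sub_le hL k l]

/-- The new velocity depends on new values that are not yet known to be monotone. Their distance to
the old values is at most (Δt/Δx)L(A + V), with V the maximum of the new convolution, so V is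
bounded by the old convolution plus a multiple of A + V that the CFL condition makes small enough to
absorb. -/
theorem abs_pairVelocity_le_of_step (hc : StepCond M N L A dt) (hv : ∀ s, GridMono N L (v s))
    (hα : |α| ≤ A) (hstep : stepMap M L dt α v v' = v') (s : ℤˣ) (i j : ZMod N) :
    |pairVelocity M α v' s i j| ≤ A + 4 * (M : ℝ) ^ 2 * L := by
  have hA : 0 ≤ A := (abs_nonneg _).trans hα
  set V : ZMod N × ZMod N → ℝ := fun p =>
    |gridConv (gridSigma M N) (fun k l => v' 1 k l - v' (-1) k l) p.1 p.2| with hV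
  obtain ⟨p, hp⟩ := Finite.exists_max V
  have hvel : ∀ s i j, |pairVelocity M α v' s i j| ≤ A + V (i, j) := fun s i j => by
    rw [pairVelocity, discVelocity_eq, abs_mul, abs_neg, abs_sgnVal, one_mul]
    exact (abs_add_le _ _).trans (add_le_add hα le_rfl)
  have hdiff : ∀ s i j, |v' s i j - v s i j| ≤ dt / spaceStep N * L * (A + V p) := by
    intro s i j
    have e : v' s i j - v s i j = dt * upwindFlux (pairVelocity M α v' s i j)
        (discDerivX1 N (v s) i j + L) (discDerivX1 N (v s) (i - 1) j + L) := by
      have := congrFun (congrFun (congrFun hstep s) i) j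
      rw [← this]
      unfold stepMap
      ring
    rw [e, abs_mul, abs_of_nonneg hc.dt_nonneg]
    have h1 := abs_upwindFlux_le (hv s i j) (hv s (i - 1) j) ((hv s).deriv_le i j)
      ((hv s).deriv_le (i - 1) j) (pairVelocity M α v' s i j)
    have h2 := (hvel s i j).trans (add_le_add_right (hp (i, j)) A)
    have hLh : 0 ≤ L / spaceStep N := div_nonneg hc.L_nonneg (spaceStep_pos N).le
    refine (mul_le_mul_of_nonneg_left (h1.trans (mul_le_mul_of_nonneg_right h2 hLh))
      hc.dt_nonneg).trans (le_of_eq ?_)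
    ring
  have h3 : V p ≤ 2 * (M : ℝ) ^ 2 * L +
      (M : ℝ) ^ 2 * (2 * (dt / spaceStep N * L * (A + V p))) := by
    have e : gridConv (gridSigma M N) (fun k l => v' 1 k l - v' (-1) k l) p.1 p.2 =
        gridConv (gridSigma M N) (fun k l => v 1 k l - v (-1) k l) p.1 p.2 +
        gridConv (gridSigma M N) (fun k l => (v' 1 k l - v' (-1) k l) -
          (v 1 k l - v (-1) k l)) p.1 p.2 := by
      rw [gridConv_sub _ (fun k l => v' 1 k l - v' (-1) k l)]; ring
    have e' : V p = |gridConv (gridSigma M N) (fun k l => v 1 k l - v (-1) k l) p.1 p.2 +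
        gridConv (gridSigma M N) (fun k l => (v' 1 k l - v' (-1) k l) -
          (v 1 k l - v (-1) k l)) p.1 p.2| := by rw [← e]
    refine e'.le.trans ?_
    refine (abs_add_le _ _).trans (add_le_add
      (abs_gridConv_pair_le hc.one_le hc.le hc.L_nonneg hv _ _)
      (abs_gridConv_le (abs_gridSigma_le hc.one_le) (fun k l => ?_) _ _))
    rw [show (v' 1 k l - v' (-1) k l) - (v 1 k l - v (-1) k l) =
      (v' 1 k l - v 1 k l) - (v' (-1) k l - v (-1) k l) by ring]
    refine (abs_sub _ _).trans ?_
    have h1 := hdiff 1 k l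
    have h2 := hdiff (-1) k l
    rw [two_mul]
    exact add_le_add h1 h2
  have hVp : 0 ≤ V p := abs_nonneg _
  set c := dt / spaceStep N
  have hc0 : 0 ≤ c := div_nonneg hc.dt_nonneg (spaceStep_pos N).le
  have hML : 0 ≤ (M : ℝ) ^ 2 * L := mul_nonneg (sq_nonneg _) hc.L_nonneg
  -- The three estimates give 8V/9 ≤ 5M²L/2, hence V ≤ 4M²L with room to spare.
  have h4 : c * A ≤ 1 / 4 := by nlinarith [hc.velocity_le, mul_nonneg hc0 hML]
  have h5 : (M : ℝ) ^ 2 * (2 * (c * L * A)) ≤ (M : ℝ) ^ 2 * L / 2 := by nlinarith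
  have h6 : (M : ℝ) ^ 2 * (2 * (c * L * V p)) ≤ V p / 9 := by nlinarith [hc.contract]
  have h7 : V p ≤ 4 * (M : ℝ) ^ 2 * L := by nlinarith
  exact (hvel s i j).trans (add_le_add_right ((hp (i, j)).trans h7) A)

end Step

/-! ### Estimates on one step of the scheme -/

section StepEstimates

variable {M N : ℕ} [NeZero N] {L A α dt : ℝ} {v v' : ℤˣ → ZMod N → ZMod N → ℝ}

theorem step_apply (hstep : stepMap M L dt α v v' = v') (s : ℤˣ) (i j : ZMod N) :
    v' s i j = v s i j + dt * upwindFlux (pairVelocity M α v' s i j)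
      (discDerivX1 N (v s) i j + L) (discDerivX1 N (v s) (i - 1) j + L) :=
  (congrFun (congrFun (congrFun hstep s) i) j).symm

/-- The backward slope at i + 1 is the forward slope at i, so the slopes obey a closed conservative
scheme. -/
theorem deriv_step (hstep : stepMap M L dt α v v' = v') (s : ℤˣ) (i j : ZMod N) :
    discDerivX1 N (v' s) i j + L = (discDerivX1 N (v s) i j + L) + dt / spaceStep N *
      (upwindFlux (pairVelocity M α v' s (i + 1) j) (discDerivX1 N (v s) (i + 1) j + L)
        (discDerivX1 N (v s) i j + L) -
      upwindFlux (pairVelocity M α v' s i j) (discDerivX1 N (v s) i j + L)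
        (discDerivX1 N (v s) (i - 1) j + L)) := by
  have h1 := step_apply hstep s (i + 1) j
  have h2 := step_apply hstep s i j
  rw [add_sub_cancel_right] at h1
  conv_lhs => rw [discDerivX1, h1, h2]
  conv_rhs => enter [1, 1]; rw [discDerivX1]
  ring

theorem StepCond.ratio_nonneg (hc : StepCond M N L A dt) : 0 ≤ dt / spaceStep N :=
  div_nonneg hc.dt_nonneg (spaceStep_pos N).le

theorem StepCond.ratio_mul_abs_le (hc : StepCond M N L A dt) (hv : ∀ s, GridMono N L (v s))
    (hα : |α| ≤ A) (hstep : stepMap M L dt α v v' = v') (s : ℤˣ) (i j : ZMod N) :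
    dt / spaceStep N * |pairVelocity M α v' s i j| ≤ 1 / 4 := by
  have h1 := abs_pairVelocity_le_of_step hc hv hα hstep s i j
  have := mul_le_mul_of_nonneg_left h1 hc.ratio_nonneg
  linarith [hc.velocity_le]

/-- The new slope combines the old slopes at i, i + 1 and i − 1. Only the coefficient at i could be
negative, and it is at least 1/2 because c|λ| ≤ 1/4 at both i and i + 1. -/
theorem gridMono_step (hc : StepCond M N L A dt) (hv : ∀ s, GridMono N L (v s))
    (hα : |α| ≤ A) (hstep : stepMap M L dt α v v' = v') (s : ℤˣ) : GridMono N L (v' s) := by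
  intro i j
  have h1 := hc.ratio_mul_abs_le hv hα hstep s i j
  have h2 := hc.ratio_mul_abs_le hv hα hstep s (i + 1) j
  rw [deriv_step hstep]
  have a1 := hv s i j
  have a2 := hv s (i + 1) j
  have a0 := hv s (i - 1) j
  have hc0 := hc.ratio_nonneg
  rw [← max_zero_add_max_neg_zero] at h1 h2
  unfold upwindFlux
  set c := dt / spaceStep N
  have p1 := le_max_right (pairVelocity M α v' s i j) 0
  have p2 := le_max_right (-pairVelocity M α v' s i j) 0
  have p3 := le_max_right (pairVelocity M α v' s (i + 1) j) 0
  have p4 := le_max_right (-pairVelocity M α v' s (i + 1) j) 0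
  set x1 := max (pairVelocity M α v' s i j) 0
  set x2 := max (-pairVelocity M α v' s i j) 0
  set x3 := max (pairVelocity M α v' s (i + 1) j) 0
  set x4 := max (-pairVelocity M α v' s (i + 1) j) 0
  set t1 := discDerivX1 N (v s) i j + L
  set t2 := discDerivX1 N (v s) (i + 1) j + L
  set t0 := discDerivX1 N (v s) (i - 1) j + L
  have e : t1 + c * (x3 * t2 - x4 * t1 - (x1 * t1 - x2 * t0)) =
      t1 * (1 - c * x4 - c * x1) + c * (x3 * t2) + c * (x2 * t0) := by ring
  rw [e]
  have f1 : 0 ≤ 1 - c * x4 - c * x1 := by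
    nlinarith [mul_nonneg hc0 p3, mul_nonneg hc0 p2]
  positivity

theorem pairVelocity_sub (x : ℤˣ → ZMod N → ZMod N → ℝ) (s : ℤˣ) (i j i' j' : ZMod N) :
    |pairVelocity M α x s i j - pairVelocity M α x s i' j'| =
      |gridConv (gridSigma M N) (fun k l => x 1 k l - x (-1) k l) i j -
        gridConv (gridSigma M N) (fun k l => x 1 k l - x (-1) k l) i' j'| := by
  simp only [pairVelocity, discVelocity_eq]
  rw [← mul_sub, abs_mul, abs_neg, abs_sgnVal, one_mul, add_sub_add_left_eq_sub]

/-- An increment of ρ⁺ − ρ⁻ is Δx times a difference of nonnegative slopes, as the two constants `L`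
cancel. A row thus has variation at most 2L, and N rows with weight Δx² leave one factor Δx. -/
theorem abs_pairVelocity_sub_x1_le (hM : 1 ≤ M) {x : ℤˣ → ZMod N → ZMod N → ℝ}
    (hx : ∀ s, GridMono N L (x s)) (s : ℤˣ) (i j : ZMod N) :
    |pairVelocity M α x s (i + 1) j - pairVelocity M α x s i j| ≤
      2 * (M : ℝ) ^ 2 * L * spaceStep N := by
  rw [pairVelocity_sub, gridConv_add_one_left]
  refine (abs_gridConv_le_sum (abs_gridSigma_le hM) i j).trans ?_
  have hh := spaceStep_pos N
  have h1 : ∀ q, ∑ k : ZMod N,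
      |x 1 (k + 1) q - x (-1) (k + 1) q - (x 1 k q - x (-1) k q)| ≤ 2 * L := fun q => by
    have hsum : 2 * L = ∑ k, (spaceStep N * (discDerivX1 N (x 1) k q + L) +
        spaceStep N * (discDerivX1 N (x (-1)) k q + L)) := by
      rw [Finset.sum_add_distrib, sum_spaceStep_mul_deriv, sum_spaceStep_mul_deriv, two_mul]
    rw [hsum]
    refine Finset.sum_le_sum fun k _ => ?_
    have e1 := spaceStep_mul_discDerivX1 (x 1) k q
    have e2 := spaceStep_mul_discDerivX1 (x (-1)) k q
    have p1 := mul_nonneg hh.le (hx 1 k q)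
    have p2 := mul_nonneg hh.le (hx (-1) k q)
    rw [mul_add, e1] at p1 ⊢
    rw [mul_add, e2] at p2 ⊢
    rw [abs_le]
    constructor <;> linarith
  have h2 : ∑ q : ZMod N, ∑ k : ZMod N,
      |x 1 (k + 1) q - x (-1) (k + 1) q - (x 1 k q - x (-1) k q)| ≤ N * (2 * L) := by
    refine (Finset.sum_le_card_nsmul _ _ _ fun q _ => h1 q).trans (le_of_eq ?_)
    simp [ZMod.card]
  refine (mul_le_mul_of_nonneg_left h2 (by positivity)).trans (le_of_eq ?_)
  linear_combination 2 * (M : ℝ) ^ 2 * L * spaceStep N * natCast_mul_spaceStep N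

/-- The nonnegative coefficients of the three old slopes add up to 1 + c(λ_{i+1} − λ_i), and the
velocity increment is of order Δx. Monotonicity of the new values is used, because the velocity is
implicit. -/
theorem deriv_step_le (hc : StepCond M N L A dt) (hv : ∀ s, GridMono N L (v s))
    (hα : |α| ≤ A) (hstep : stepMap M L dt α v v' = v') {K : ℝ}
    (hK : ∀ s i j, discDerivX1 N (v s) i j + L ≤ K) (s : ℤˣ) (i j : ZMod N) :
    discDerivX1 N (v' s) i j + L ≤ K * (1 + 2 * (M : ℝ) ^ 2 * L * dt) := by
  have h1 := hc.ratio_mul_abs_le hv hα hstep s i j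
  have h2 := hc.ratio_mul_abs_le hv hα hstep s (i + 1) j
  have hd := (abs_le.1 (abs_pairVelocity_sub_x1_le (α := α) hc.one_le
    (gridMono_step hc hv hα hstep) s i j)).2
  rw [deriv_step hstep]
  have a1 := hv s i j
  have a2 := hv s (i + 1) j
  have a0 := hv s (i - 1) j
  have k1 := hK s i j
  have k2 := hK s (i + 1) j
  have k0 := hK s (i - 1) j
  have hc0 := hc.ratio_nonneg
  have hcd : dt / spaceStep N * (pairVelocity M α v' s (i + 1) j - pairVelocity M α v' s i j) ≤
      2 * (M : ℝ) ^ 2 * L * dt := by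
    refine (mul_le_mul_of_nonneg_left hd hc0).trans (le_of_eq ?_)
    have := (spaceStep_pos N).ne'
    field_simp
  rw [← max_zero_add_max_neg_zero] at h1 h2
  rw [← max_zero_sub_max_neg_zero (pairVelocity M α v' s (i + 1) j),
    ← max_zero_sub_max_neg_zero (pairVelocity M α v' s i j)] at hcd
  unfold upwindFlux
  set c := dt / spaceStep N
  have p1 := le_max_right (pairVelocity M α v' s i j) 0
  have p2 := le_max_right (-pairVelocity M α v' s i j) 0
  have p3 := le_max_right (pairVelocity M α v' s (i + 1) j) 0
  have p4 := le_max_right (-pairVelocity M α v' s (i + 1) j) 0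
  set x1 := max (pairVelocity M α v' s i j) 0
  set x2 := max (-pairVelocity M α v' s i j) 0
  set x3 := max (pairVelocity M α v' s (i + 1) j) 0
  set x4 := max (-pairVelocity M α v' s (i + 1) j) 0
  set t1 := discDerivX1 N (v s) i j + L
  set t2 := discDerivX1 N (v s) (i + 1) j + L
  set t0 := discDerivX1 N (v s) (i - 1) j + L
  have f1 : 0 ≤ 1 - c * x4 - c * x1 := by
    nlinarith [mul_nonneg hc0 p3, mul_nonneg hc0 p2]
  have hK0 : 0 ≤ K := a1.trans k1
  calc t1 + c * (x3 * t2 - x4 * t1 - (x1 * t1 - x2 * t0))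
      = t1 * (1 - c * x4 - c * x1) + c * x3 * t2 + c * x2 * t0 := by ring
    _ ≤ K * (1 - c * x4 - c * x1) + c * x3 * K + c * x2 * K :=
        add_le_add (add_le_add (mul_le_mul_of_nonneg_right k1 f1)
          (mul_le_mul_of_nonneg_left k2 (by positivity)))
          (mul_le_mul_of_nonneg_left k0 (by positivity))
    _ = K * (1 + c * (x3 - x4 - (x1 - x2))) := by ring
    _ ≤ _ := mul_le_mul_of_nonneg_left (by linarith) hK0

theorem abs_step_sub_le (hc : StepCond M N L A dt) (hv : ∀ s, GridMono N L (v s))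
    (hα : |α| ≤ A) (hstep : stepMap M L dt α v v' = v') {K : ℝ}
    (hK : ∀ s i j, discDerivX1 N (v s) i j + L ≤ K) (s : ℤˣ) (i j : ZMod N) :
    |v' s i j - v s i j| ≤ (A + 4 * (M : ℝ) ^ 2 * L) * K * dt := by
  rw [step_apply hstep, add_sub_cancel_left, abs_mul, abs_of_nonneg hc.dt_nonneg, mul_comm]
  refine mul_le_mul_of_nonneg_right ?_ hc.dt_nonneg
  refine (abs_upwindFlux_le (hv s i j) (hv s _ j) (hK s i j) (hK s _ j) _).trans ?_
  exact mul_le_mul_of_nonneg_right (abs_pairVelocity_le_of_step hc hv hα hstep s i j)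
    ((hv s i j).trans (hK s i j))

theorem gridSigma_add_one_sub {C : ℝ}
    (hC : ∀ x y, |sigmaKernel M x - sigmaKernel M y| ≤ C * ‖x - y‖) (l r : ZMod N) :
    |gridSigma M N l (r + 1) - gridSigma M N l r| ≤ C * spaceStep N := by
  have hper : Function.Periodic (fun y => sigmaKernel M (gridPt N l, y)) 1 := fun y =>
    (torusPeriodic_sigmaKernel M _ y).2
  have h1 := periodic_gridPt_intCast (N := N) hper ((r.val : ℤ) + 1)
  have h2 : (((r.val : ℤ) + 1 : ℤ) : ZMod N) = r + 1 := by push_cast; simp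
  rw [h2] at h1
  unfold gridSigma
  rw [h1]
  refine (hC _ _).trans (le_of_eq ?_)
  rw [Prod.mk_sub_mk, sub_self, gridPt]
  push_cast
  rw [add_mul, one_mul, add_sub_cancel_left, Prod.norm_mk, norm_zero, Real.norm_eq_abs,
    abs_of_pos (spaceStep_pos N), max_eq_right (spaceStep_pos N).le]

theorem abs_pairVelocity_sub_x2_le (hMN : M ≤ N) (hL : 0 ≤ L) {C : ℝ}
    (hC : ∀ x y, |sigmaKernel M x - sigmaKernel M y| ≤ C * ‖x - y‖)
    {x : ℤˣ → ZMod N → ZMod N → ℝ}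
    (hx : ∀ s, GridMono N L (x s)) (s : ℤˣ) (i j : ZMod N) :
    |pairVelocity M α x s i (j + 1) - pairVelocity M α x s i j| ≤ 2 * C * L * spaceStep N := by
  rw [pairVelocity_sub, gridConv_add_one_right]
  refine (abs_gridConv_le_of_osc (W := 2 * L) (gridSigma_add_one_sub hC)
    (fun r => ?_) (fun k l => ?_) i j).trans (le_of_eq (by ring))
  · rw [Finset.sum_sub_distrib]
    unfold gridSigma
    rw [sum_sigmaKernel_grid hMN, sum_sigmaKernel_grid hMN, sub_zero]
  · rw [show x 1 k l - x (-1) k l - (x 1 0 l - x (-1) 0 l) =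
      (x 1 k l - x 1 0 l) - (x (-1) k l - x (-1) 0 l) by ring]
    refine (abs_sub _ _).trans ?_
    linarith [(hx 1).abs_sub_le hL k l, (hx (-1)).abs_sub_le hL k l]

/-- Compare rows j and j + 1 with the velocity frozen at row j: the differences in x₂ form a convex
combination with weights 1 − c|λ|, cλ₊, cλ₋. The change of velocity between the rows adds a source
of order ΔtΔx, so `E` itself is not amplified. -/
theorem abs_step_x2_le (hc : StepCond M N L A dt) (hv : ∀ s, GridMono N L (v s))
    (hα : |α| ≤ A) (hstep : stepMap M L dt α v v' = v') {K E C : ℝ}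
    (hC : ∀ x y, |sigmaKernel M x - sigmaKernel M y| ≤ C * ‖x - y‖)
    (hK : ∀ s i j, discDerivX1 N (v s) i j + L ≤ K)
    (hE : ∀ s i j, |v s i (j + 1) - v s i j| ≤ E) (s : ℤˣ) (i j : ZMod N) :
    |v' s i (j + 1) - v' s i j| ≤ E + 2 * C * L * K * dt * spaceStep N := by
  have hh := spaceStep_pos N
  have h1 := hc.ratio_mul_abs_le hv hα hstep s i j
  have hd := abs_pairVelocity_sub_x2_le (α := α) hc.le hc.L_nonneg hC
    (gridMono_step hc hv hα hstep) s i j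
  have hf := abs_upwindFlux_sub_le (hv s i (j + 1)) (hv s (i - 1) (j + 1)) (hK s i (j + 1))
    (hK s (i - 1) (j + 1)) (pairVelocity M α v' s i (j + 1)) (pairVelocity M α v' s i j)
  have hK0 : 0 ≤ K := (hv s i j).trans (hK s i j)
  have hf2 := hf.trans (mul_le_mul_of_nonneg_right hd hK0)
  have e0 := hE s i j
  have e1 := hE s (i + 1) j
  have e2 := hE s (i - 1) j
  have s1 := step_apply hstep s i j
  have s2 := step_apply hstep s i (j + 1)
  have hc0 := hc.ratio_nonneg
  rw [← max_zero_add_max_neg_zero] at h1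
  set F := upwindFlux (pairVelocity M α v' s i (j + 1)) (discDerivX1 N (v s) i (j + 1) + L)
    (discDerivX1 N (v s) (i - 1) (j + 1) + L)
  set lam := pairVelocity M α v' s i j
  have p1 := le_max_right lam 0
  have p2 := le_max_right (-lam) 0
  set c := dt / spaceStep N with hcdef
  have hdt : dt = c * spaceStep N := by rw [hcdef]; field_simp
  have key : v' s i (j + 1) - v' s i j =
      (v s i (j + 1) - v s i j) * (1 - c * max lam 0 - c * max (-lam) 0) +
      c * max lam 0 * (v s (i + 1) (j + 1) - v s (i + 1) j) +
      c * max (-lam) 0 * (v s (i - 1) (j + 1) - v s (i - 1) j) +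
      dt * (F - upwindFlux lam (discDerivX1 N (v s) i (j + 1) + L)
        (discDerivX1 N (v s) (i - 1) (j + 1) + L)) := by
    rw [s1, s2]
    have d1 := spaceStep_mul_discDerivX1 (v s) i j
    have d2 := spaceStep_mul_discDerivX1 (v s) i (j + 1)
    have d3 := spaceStep_mul_discDerivX1 (v s) (i - 1) j
    have d4 := spaceStep_mul_discDerivX1 (v s) (i - 1) (j + 1)
    rw [sub_add_cancel] at d3 d4
    unfold upwindFlux
    rw [hdt]
    linear_combination c * max lam 0 * (d2 - d1) - c * max (-lam) 0 * (d4 - d3)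
  have hq : 0 ≤ 1 - c * max lam 0 - c * max (-lam) 0 := by nlinarith
  have b0 : |(v s i (j + 1) - v s i j) * (1 - c * max lam 0 - c * max (-lam) 0)| ≤
      E * (1 - c * max lam 0 - c * max (-lam) 0) := by
    rw [abs_mul, abs_of_nonneg hq]; exact mul_le_mul_of_nonneg_right e0 hq
  have b1 : |c * max lam 0 * (v s (i + 1) (j + 1) - v s (i + 1) j)| ≤ c * max lam 0 * E := by
    rw [abs_mul, abs_of_nonneg (mul_nonneg hc0 p1)]
    exact mul_le_mul_of_nonneg_left e1 (mul_nonneg hc0 p1)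
  have b2 : |c * max (-lam) 0 * (v s (i - 1) (j + 1) - v s (i - 1) j)| ≤
      c * max (-lam) 0 * E := by
    rw [abs_mul, abs_of_nonneg (mul_nonneg hc0 p2)]
    exact mul_le_mul_of_nonneg_left e2 (mul_nonneg hc0 p2)
  have b3 := mul_le_mul_of_nonneg_left hf2 hc.dt_nonneg
  rw [← abs_of_nonneg hc.dt_nonneg, ← abs_mul, abs_of_nonneg hc.dt_nonneg] at b3
  rw [key]
  refine (abs_add_le _ _).trans (le_trans (add_le_add ((abs_add_le _ _).trans (add_le_add
    ((abs_add_le _ _).trans (add_le_add b0 b1)) b2)) b3) (le_of_eq (by ring)))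

end StepEstimates

/-! ### The forcing and the CFL condition -/

/-- The essential supremum bounds `a` only almost everywhere, while the scheme samples points,
including t = T. Continuity from the left would turn a violation at t into one on an interval of
positive length inside (0,T). -/
theorem abs_le_supNormOn {T : ℝ} {a : ℝ → ℝ} (ha : ContinuousOn a (Ioc 0 T))
    (hb : MemLp a ⊤ (volume.restrict (Ioo 0 T))) {t : ℝ} (ht : t ∈ Ioc 0 T) :
    |a t| ≤ supNormOn T a := by
  by_contra! hlt
  have hae : ∀ᵐ x ∂(volume.restrict (Ioo 0 T)), |a x| ≤ supNormOn T a := by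
    filter_upwards [ae_le_eLpNormEssSup (f := a) (μ := volume.restrict (Ioo 0 T))] with x hx
    unfold supNormOn
    rw [eLpNorm_exponent_top]
    have hfin : eLpNormEssSup a (volume.restrict (Ioo 0 T)) ≠ ⊤ := by
      have := hb.2.ne
      rwa [eLpNorm_exponent_top] at this
    rw [← Real.norm_eq_abs, ← toReal_enorm]
    exact ENNReal.toReal_mono hfin hx
  have hev : ∀ᶠ x in 𝓝[Ioc 0 T] t, supNormOn T a < |a x| :=
    (ha t ht).abs.eventually (lt_mem_nhds hlt)
  obtain ⟨ε, hε, hball⟩ := Metric.mem_nhdsWithin_iff.1 hev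
  have hpos : 0 < volume (Ioo (max 0 (t - ε)) t) := by
    rw [Real.volume_Ioo, ENNReal.ofReal_pos, sub_pos]
    exact max_lt ht.1 (by linarith)
  have hzero : volume (Ioo (max 0 (t - ε)) t) = 0 := by
    rw [ae_restrict_iff' measurableSet_Ioo] at hae
    refine measure_mono_null (fun x hx => ?_) (ae_iff.1 hae)
    have h0 : 0 < x := lt_of_le_of_lt (le_max_left _ _) hx.1
    have h1 : t - ε < x := lt_of_le_of_lt (le_max_right _ _) hx.1
    have h3 : supNormOn T a < |a x| := hball ⟨by
      rw [Metric.mem_ball, Real.dist_eq, abs_lt]; constructor <;> linarith [hx.2],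
      ⟨h0, hx.2.le.trans ht.2⟩⟩
    intro hcon
    exact absurd (hcon ⟨h0, hx.2.trans_le ht.2⟩) (not_le.2 h3)
  exact hpos.ne' hzero

theorem timeStep_pos {T : ℝ} (hT : 0 < T) {NT : ℕ} (hNT : 0 < NT) : 0 < timeStep T NT := by
  unfold timeStep; positivity

theorem natCast_mul_timeStep {T : ℝ} {NT : ℕ} (hNT : 0 < NT) : NT * timeStep T NT = T := by
  have : (NT : ℝ) ≠ 0 := by positivity
  unfold timeStep; field_simp

theorem CFL.stepCond {M N NT : ℕ} [NeZero N] {L T : ℝ} {a : ℝ → ℝ} (hM : 1 ≤ M) (hMN : M ≤ N)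
    (hL : 0 < L) (hT : 0 < T) (hNT : 0 < NT)
    (h : CFL M L T a (timeStep T NT) (spaceStep N)) :
    StepCond M N L (supNormOn T a) (timeStep T NT) := by
  have hA : 0 ≤ supNormOn T a := ENNReal.toReal_nonneg
  have hM' : (0 : ℝ) < M := by positivity
  have h1 := (lt_min_iff.1 h.1).1
  have h2 := (lt_min_iff.1 h.1).2
  rw [lt_div_iff₀ (by positivity)] at h1 h2
  exact ⟨hM, hMN, hL.le, (timeStep_pos hT hNT).le, by linarith, h2.le⟩

/-! ### Existence, uniqueness and uniform bounds -/

section Scheme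

variable {M N NT : ℕ} [NeZero N] {L T : ℝ} {a : ℝ → ℝ} {ρ₀ : ℤˣ → ℝ × ℝ → ℝ}

/-- The values of the regularized initial data on the grid. -/
noncomputable def gridInitial (M N : ℕ) (L : ℝ) (ρ₀ : ℤˣ → ℝ × ℝ → ℝ) (s : ℤˣ) (i j : ZMod N) : ℝ :=
  regInitial M L (ρ₀ s) (gridPt N i, gridPt N j)

theorem gridInitial_add_one_left (s : ℤˣ) (i j : ZMod N) :
    gridInitial M N L ρ₀ s (i + 1) j =
      regInitial M L (ρ₀ s) ((gridPt N i, gridPt N j) + (spaceStep N, 0)) := by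
  have h := periodic_gridPt_intCast (N := N) (f := fun x => regInitial M L (ρ₀ s) (x, gridPt N j))
    (fun x => (torusPeriodic_regInitial M x _).1) ((i.val : ℤ) + 1)
  have h2 : (((i.val : ℤ) + 1 : ℤ) : ZMod N) = i + 1 := by push_cast; simp
  rw [h2] at h
  refine h.trans ?_
  congr 1
  ext <;> simp [gridPt]; ring

theorem gridInitial_add_one_right (s : ℤˣ) (i j : ZMod N) :
    gridInitial M N L ρ₀ s i (j + 1) =
      regInitial M L (ρ₀ s) ((gridPt N i, gridPt N j) + (0, spaceStep N)) := by
  have h := periodic_gridPt_intCast (N := N) (f := fun x => regInitial M L (ρ₀ s) (gridPt N i, x))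
    (fun x => (torusPeriodic_regInitial M _ x).2) ((j.val : ℤ) + 1)
  have h2 : (((j.val : ℤ) + 1 : ℤ) : ZMod N) = j + 1 := by push_cast; simp
  rw [h2] at h
  refine h.trans ?_
  congr 1
  ext <;> simp [gridPt]; ring

theorem gridMono_gridInitial (hM : 1 ≤ M) (hρ₀ : ∀ s, IsInitialDatum L (ρ₀ s)) (s : ℤˣ) :
    GridMono N L (gridInitial M N L ρ₀ s) := fun i j => by
  have hh := spaceStep_pos N
  have h := (hρ₀ s).regInitial_add_ge hM hh.le (gridPt N i, gridPt N j)
  rw [discDerivX1, div_add' _ _ _ hh.ne']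
  refine div_nonneg ?_ hh.le
  rw [gridInitial_add_one_left]
  exact h

/-- The values of a solution of the scheme at the new time are a fixed point of the step map. -/
theorem IsSchemeSolution.stepMap_eq (hT : 0 < T) (hNT : 0 < NT)
    {u : ℤˣ → ℕ → ZMod N → ZMod N → ℝ} (hu : IsSchemeSolution M L T a ρ₀ N NT u) {n : ℕ}
    (hn : n < NT) : stepMap M L (timeStep T NT) (a (((n : ℝ) + 1) * timeStep T NT))
      (fun s => u s n) (fun s => u s (n + 1)) = fun s => u s (n + 1) := by
  ext s i j
  have h := hu.step s n hn i j
  rw [div_eq_iff (timeStep_pos hT hNT).ne'] at h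
  unfold stepMap upwindFlux pairVelocity
  linarith

theorem isSchemeSolution_of_stepMap_eq (hT : 0 < T) (hNT : 0 < NT)
    {u : ℤˣ → ℕ → ZMod N → ZMod N → ℝ} (h0 : ∀ s, u s 0 = gridInitial M N L ρ₀ s)
    (h : ∀ n < NT, stepMap M L (timeStep T NT) (a (((n : ℝ) + 1) * timeStep T NT))
      (fun s => u s n) (fun s => u s (n + 1)) = fun s => u s (n + 1)) :
    IsSchemeSolution M L T a ρ₀ N NT u := by
  refine ⟨fun s i j => by rw [h0]; rfl, fun s n hn i j => ?_⟩
  rw [div_eq_iff (timeStep_pos hT hNT).ne']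
  have h1 := congrFun (congrFun (congrFun (h n hn) s) i) j
  unfold stepMap upwindFlux pairVelocity at h1
  linarith

theorem time_mem_Ioc (hT : 0 < T) (hNT : 0 < NT) {n : ℕ} (hn : n < NT) :
    ((n : ℝ) + 1) * timeStep T NT ∈ Ioc 0 T := by
  have hp := timeStep_pos hT hNT
  refine ⟨by positivity, ?_⟩
  nth_rewrite 2 [← natCast_mul_timeStep (T := T) hNT]
  refine mul_le_mul_of_nonneg_right ?_ hp.le
  exact_mod_cast hn

variable (hM : 1 ≤ M) (hL : 0 < L) (hT : 0 < T) (ha : ContinuousOn a (Ioc 0 T))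
  (hb : MemLp a ⊤ (volume.restrict (Ioo 0 T))) (hρ₀ : ∀ s, IsInitialDatum L (ρ₀ s))
  (hNT : 0 < NT) (hMN : M ≤ N) (hCFL : CFL M L T a (timeStep T NT) (spaceStep N))

include hM hL hT ha hb hρ₀ hNT hMN hCFL

theorem IsSchemeSolution.gridMono {u : ℤˣ → ℕ → ZMod N → ZMod N → ℝ}
    (hu : IsSchemeSolution M L T a ρ₀ N NT u) :
    ∀ n ≤ NT, ∀ s, GridMono N L (u s n) := by
  intro n
  induction n with
  | zero =>
    intro _ s
    have : u s 0 = gridInitial M N L ρ₀ s := by ext i j; exact hu.initial s i j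
    rw [this]
    exact gridMono_gridInitial hM hρ₀ s
  | succ n ih =>
    intro hn s
    exact gridMono_step (v' := fun s => u s (n + 1)) (hCFL.stepCond hM hMN hL hT hNT)
      (ih (by omega)) (abs_le_supNormOn ha hb (time_mem_Ioc hT hNT hn))
      (hu.stepMap_eq hT hNT hn) s

theorem IsSchemeSolution.unique {u v : ℤˣ → ℕ → ZMod N → ZMod N → ℝ}
    (hu : IsSchemeSolution M L T a ρ₀ N NT u) (hv : IsSchemeSolution M L T a ρ₀ N NT v) :
    ∀ n ≤ NT, (fun s => u s n) = fun s => v s n := by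
  intro n
  induction n with
  | zero =>
    intro _
    ext s i j
    rw [hu.initial, hv.initial]
  | succ n ih =>
    intro hn
    have h1 := hu.stepMap_eq hT hNT hn
    have h2 := hv.stepMap_eq hT hNT hn
    rw [← ih (by omega)] at h2
    exact (existsUnique_fixedPoint_stepMap (hCFL.stepCond hM hMN hL hT hNT)
      (hu.gridMono hM hL hT ha hb hρ₀ hNT hMN hCFL n (by omega))).unique h1 h2

theorem exists_isSchemeSolution : ∃ u, IsSchemeSolution M L T a ρ₀ N NT u := by
  have hc := hCFL.stepCond hM hMN hL hT hNT
  let X := {v : ℤˣ → ZMod N → ZMod N → ℝ // ∀ s, GridMono N L (v s)}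
  have hA : 0 ≤ supNormOn T a := ENNReal.toReal_nonneg
  -- Beyond the last step the forcing is set to 0, so that the recursion on monotone grid functions
  -- is defined for every n.
  let α : ℕ → ℝ := fun n => if n < NT then a (((n : ℝ) + 1) * timeStep T NT) else 0
  have hα : ∀ n, |α n| ≤ supNormOn T a := fun n => by
    simp only [α]
    split_ifs with h
    · exact abs_le_supNormOn ha hb (time_mem_Ioc hT hNT h)
    · simpa using hA
  have hnext : ∀ n (v : X), ∃ w : X, stepMap M L (timeStep T NT) (α n) v.1 w.1 = w.1 := by
    intro n v
    obtain ⟨w, hw, -⟩ := existsUnique_fixedPoint_stepMap (α := α n) hc v.2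
    exact ⟨⟨w, gridMono_step hc v.2 (hα n) hw⟩, hw⟩
  choose next hnext using hnext
  let seq : ℕ → X := fun n => Nat.rec ⟨gridInitial M N L ρ₀, gridMono_gridInitial hM hρ₀⟩ next n
  refine ⟨fun s n => (seq n).1 s, isSchemeSolution_of_stepMap_eq hT hNT (fun s => rfl) ?_⟩
  intro n hn
  have := hnext n (seq n)
  simp only [α, if_pos hn] at this
  exact this

end Scheme

/-! ### Bounds independent of the mesh -/

/-- Bounds on a sequence of grid functions and on its difference quotients. -/
structure GridBounds (N : ℕ) (dt K : ℝ) (w : ℕ → ZMod N → ZMod N → ℝ) : Prop where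
  bound : ∀ n i j, |w n i j| ≤ K
  diff_x1 : ∀ n i j, |w n (i + 1) j - w n i j| ≤ K * spaceStep N
  diff_x2 : ∀ n i j, |w n i (j + 1) - w n i j| ≤ K * spaceStep N
  diff_t : ∀ n i j, |w (n + 1) i j - w n i j| ≤ K * dt

/-- The bounds hold uniformly over all meshes that satisfy the CFL condition. -/
theorem exists_gridBounds {M : ℕ} {L T : ℝ} {a : ℝ → ℝ} {ρ₀ : ℤˣ → ℝ × ℝ → ℝ}
    (hM : 1 ≤ M) (hL : 0 < L) (hT : 0 < T) (ha : ContinuousOn a (Ioc 0 T))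
    (hb : MemLp a ⊤ (volume.restrict (Ioo 0 T))) (hρ₀ : ∀ s, IsInitialDatum L (ρ₀ s)) :
    ∃ K, 0 ≤ K ∧ ∀ (N NT : ℕ) [NeZero N], 0 < NT → M ≤ N →
      CFL M L T a (timeStep T NT) (spaceStep N) → ∀ u, IsSchemeSolution M L T a ρ₀ N NT u →
        ∀ s, GridBounds N (timeStep T NT) K fun n => u s (min n NT) := by
  choose C₀ hC₀ hlip₀ using fun s => (hρ₀ s).exists_lipschitz_regInitial M
  obtain ⟨Cσ, hCσ0, hCσ⟩ := (torusPeriodic_sigmaKernel M).exists_lipschitz (contDiff_sigmaKernel M)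
  have hcont : ∀ s, Continuous (regInitial M L (ρ₀ s)) := fun s =>
    (LipschitzWith.of_dist_le_mul (K := ⟨C₀ s, hC₀ s⟩) fun x y => by
      rw [Real.dist_eq, dist_eq_norm]; exact hlip₀ s x y).continuous
  choose B₀ hB₀ hbd₀ using fun s =>
    (torusPeriodic_regInitial (L := L) (ρ₀ := ρ₀ s) M).exists_bound (hcont s)
  set A := supNormOn T a with hAdef
  have hA : 0 ≤ A := ENNReal.toReal_nonneg
  set C := ∑ s, C₀ s
  have hC : 0 ≤ C := Finset.sum_nonneg fun s _ => hC₀ s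
  have hCs : ∀ s, C₀ s ≤ C := fun s =>
    Finset.single_le_sum (fun s _ => hC₀ s) (Finset.mem_univ s)
  set B := ∑ s, B₀ s
  have hB : 0 ≤ B := Finset.sum_nonneg fun s _ => hB₀ s
  have hBs : ∀ s, B₀ s ≤ B := fun s =>
    Finset.single_le_sum (fun s _ => hB₀ s) (Finset.mem_univ s)
  set q := 2 * (M : ℝ) ^ 2 * L with hq
  have hq0 : 0 ≤ q := by positivity
  -- The initial slopes are at most C + L, and n factors 1 + qΔt are at most e^{qT}.
  set Kθ := (C + L) * Real.exp (q * T) with hKθ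
  have hKθ0 : 0 ≤ Kθ := by positivity
  set Lam := A + 4 * (M : ℝ) ^ 2 * L with hLam
  have hLam0 : 0 ≤ Lam := by positivity
  -- The sum of the bounds for the differences in x₁, in x₂ and in t and for the values, so that it
  -- dominates each of them.
  refine ⟨(Kθ + L) + (C + T * (2 * Cσ * L * Kθ)) + Lam * Kθ + (B + T * (Lam * Kθ)),
    by positivity, ?_⟩
  intro N NT _ hNT hMN hCFL u hu
  have hh := spaceStep_pos N
  have hdt := timeStep_pos hT hNT
  have hc := hCFL.stepCond hM hMN hL hT hNT
  have hmono := hu.gridMono hM hL hT ha hb hρ₀ hNT hMN hCFL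
  set dt := timeStep T NT with hdtdef
  have hα : ∀ n < NT, |a (((n : ℝ) + 1) * dt)| ≤ A := fun n hn =>
    abs_le_supNormOn ha hb (time_mem_Ioc hT hNT hn)
  have htime : ∀ n ≤ NT, (n : ℝ) * dt ≤ T := fun n hn => by
    rw [← natCast_mul_timeStep (T := T) hNT]
    exact mul_le_mul_of_nonneg_right (by exact_mod_cast hn) hdt.le
  have hu0 : ∀ s, u s 0 = gridInitial M N L ρ₀ s := fun s => by ext i j; exact hu.initial s i j
  have hdiff1 : ∀ s i j, |u s 0 (i + 1) j - u s 0 i j| ≤ C * spaceStep N := fun s i j => by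
    rw [hu0, gridInitial_add_one_left]
    refine (hlip₀ s _ _).trans ?_
    rw [add_sub_cancel_left, Prod.norm_mk, norm_zero, Real.norm_eq_abs, abs_of_pos hh,
      max_eq_left hh.le]
    exact mul_le_mul_of_nonneg_right (hCs s) hh.le
  have hdiff2 : ∀ s i j, |u s 0 i (j + 1) - u s 0 i j| ≤ C * spaceStep N := fun s i j => by
    rw [hu0, gridInitial_add_one_right]
    refine (hlip₀ s _ _).trans ?_
    rw [add_sub_cancel_left, Prod.norm_mk, norm_zero, Real.norm_eq_abs, abs_of_pos hh,
      max_eq_right hh.le]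
    exact mul_le_mul_of_nonneg_right (hCs s) hh.le
  have hθ' : ∀ n ≤ NT, ∀ s i j,
      discDerivX1 N (u s n) i j + L ≤ (C + L) * Real.exp (q * (n * dt)) := by
    intro n
    induction n with
    | zero =>
      intro _ s i j
      simp only [Nat.cast_zero, zero_mul, mul_zero, Real.exp_zero, mul_one]
      gcongr
      rw [discDerivX1, div_le_iff₀ hh]
      exact (le_abs_self _).trans (hdiff1 s i j)
    | succ n ih =>
      intro hn s i j
      refine (deriv_step_le (v' := fun s => u s (n + 1)) hc (hmono n (by omega)) (hα n hn)
        (hu.stepMap_eq hT hNT hn) (ih (by omega)) s i j).trans ?_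
      rw [mul_assoc]
      refine mul_le_mul_of_nonneg_left ?_ (by positivity)
      have h1 := Real.add_one_le_exp (q * dt)
      have h2 : Real.exp (q * (((n + 1 : ℕ) : ℝ) * dt)) =
          Real.exp (q * (n * dt)) * Real.exp (q * dt) := by
        rw [← Real.exp_add]; push_cast; ring_nf
      rw [h2]
      exact mul_le_mul_of_nonneg_left (by linarith) (Real.exp_pos _).le
  have hθ : ∀ n ≤ NT, ∀ s i j, discDerivX1 N (u s n) i j + L ≤ Kθ := fun n hn s i j =>
    (hθ' n hn s i j).trans (mul_le_mul_of_nonneg_left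
      (Real.exp_le_exp.2 (mul_le_mul_of_nonneg_left (htime n hn) hq0)) (by positivity))
  have hstep : ∀ n < NT, ∀ s i j, |u s (n + 1) i j - u s n i j| ≤ Lam * Kθ * dt :=
    fun n hn s i j => abs_step_sub_le (v' := fun s => u s (n + 1)) hc (hmono n hn.le) (hα n hn)
      (hu.stepMap_eq hT hNT hn) (hθ n hn.le) s i j
  have hE : ∀ n ≤ NT, ∀ s i j,
      |u s n i (j + 1) - u s n i j| ≤ (C + n * dt * (2 * Cσ * L * Kθ)) * spaceStep N := by
    intro n
    induction n with
    | zero => intro _ s i j; simpa using hdiff2 s i j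
    | succ n ih =>
      intro hn s i j
      refine (abs_step_x2_le (v' := fun s => u s (n + 1)) hc (hmono n (by omega)) (hα n hn)
        (hu.stepMap_eq hT hNT hn) hCσ (hθ n (by omega)) (ih (by omega)) s i j).trans
        (le_of_eq ?_)
      push_cast; ring
  have hbd : ∀ n ≤ NT, ∀ s i j, |u s n i j| ≤ B + n * dt * (Lam * Kθ) := by
    intro n
    induction n with
    | zero =>
      intro _ s i j
      rw [hu.initial]
      simpa using (hbd₀ s _).trans (hBs s)
    | succ n ih =>
      intro hn s i j
      have h1 := hstep n hn s i j
      have h2 := ih (by omega) s i j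
      rw [← sub_add_cancel (u s (n + 1) i j) (u s n i j)]
      refine (abs_add_le _ _).trans ((add_le_add h1 h2).trans (le_of_eq ?_))
      push_cast; ring
  have n1 : 0 ≤ C + T * (2 * Cσ * L * Kθ) := by positivity
  have n2 : 0 ≤ Lam * Kθ := by positivity
  have n3 : 0 ≤ B + T * (Lam * Kθ) := by positivity
  have n4 : 0 ≤ Kθ + L := by positivity
  intro s
  refine ⟨fun n i j => ?_, fun n i j => ?_, fun n i j => ?_, fun n i j => ?_⟩
  · refine (hbd _ (min_le_right _ _) s i j).trans ?_
    have := mul_le_mul_of_nonneg_right (htime _ (min_le_right n NT)) n2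
    linarith
  · have h1 := hmono _ (min_le_right n NT) s i j
    have h2 := hθ _ (min_le_right n NT) s i j
    rw [← spaceStep_mul_discDerivX1, abs_mul, abs_of_pos hh, mul_comm]
    refine mul_le_mul_of_nonneg_right ?_ hh.le
    rw [abs_le]; constructor <;> linarith
  · refine (hE _ (min_le_right _ _) s i j).trans (mul_le_mul_of_nonneg_right ?_ hh.le)
    have h3 : 0 ≤ 2 * Cσ * L * Kθ := by positivity
    have := mul_le_mul_of_nonneg_right (htime _ (min_le_right n NT)) h3
    linarith
  -- From the final index on, the values are frozen and the time difference is zero.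
  · rcases lt_or_ge n NT with hn | hn
    · rw [min_eq_left hn.le, min_eq_left (by omega : n + 1 ≤ NT)]
      refine (hstep n hn s i j).trans (mul_le_mul_of_nonneg_right ?_ hdt.le)
      linarith
    · rw [min_eq_right hn, min_eq_right (by omega : NT ≤ n + 1), sub_self, abs_zero]
      positivity

/-! ### Piecewise linear interpolation -/

/-- Piecewise linear interpolation of the values `w i` at the integers `i`. -/
noncomputable def linInterp (w : ℤ → ℝ) (y : ℝ) : ℝ :=
  (1 - Int.fract y) * w ⌊y⌋ + Int.fract y * w (⌊y⌋ + 1)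

theorem linInterp_sub (w w' : ℤ → ℝ) (y : ℝ) :
    linInterp (fun i => w i - w' i) y = linInterp w y - linInterp w' y := by
  unfold linInterp; ring

theorem abs_linInterp_le {w : ℤ → ℝ} {C : ℝ} (hw : ∀ i, |w i| ≤ C) (y : ℝ) :
    |linInterp w y| ≤ C := by
  have h0 := Int.fract_nonneg y
  have h1 : 0 ≤ 1 - Int.fract y := by linarith [Int.fract_lt_one y]
  unfold linInterp
  refine (abs_add_le _ _).trans ?_
  rw [abs_mul, abs_mul, abs_of_nonneg h0, abs_of_nonneg h1]
  calc _ ≤ (1 - Int.fract y) * C + Int.fract y * C :=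
        add_le_add (mul_le_mul_of_nonneg_left (hw _) h1) (mul_le_mul_of_nonneg_left (hw _) h0)
    _ = C := by ring

theorem abs_linInterp_sub_floor_le {w : ℤ → ℝ} {C : ℝ} (hw : ∀ i, |w (i + 1) - w i| ≤ C)
    (y : ℝ) : |linInterp w y - w ⌊y⌋| ≤ C := by
  have h0 := Int.fract_nonneg y
  have h1 := (Int.fract_lt_one y).le
  have : linInterp w y - w ⌊y⌋ = Int.fract y * (w (⌊y⌋ + 1) - w ⌊y⌋) := by
    unfold linInterp; ring
  rw [this, abs_mul, abs_of_nonneg h0]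
  have := hw ⌊y⌋
  nlinarith [abs_nonneg (w (⌊y⌋ + 1) - w ⌊y⌋)]

theorem abs_sub_le_of_diff_le {w : ℤ → ℝ} {C : ℝ} (hw : ∀ i, |w (i + 1) - w i| ≤ C) (i : ℤ)
    (n : ℕ) : |w (i + n) - w i| ≤ C * n := by
  induction n with
  | zero => simp
  | succ n ih =>
    have := hw (i + n)
    rw [Nat.cast_succ, ← add_assoc, ← sub_add_sub_cancel _ (w (i + n))]
    refine (abs_add_le _ _).trans ((add_le_add this ih).trans (le_of_eq ?_))
    push_cast; ring

/-- Within one cell the interpolant is affine. Otherwise the path from x to y is cut at the nodes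
⌊x⌋ + 1 and ⌊y⌋, which are `n` whole steps apart. -/
theorem abs_linInterp_sub_le {w : ℤ → ℝ} {C : ℝ} (hw : ∀ i, |w (i + 1) - w i| ≤ C) (x y : ℝ) :
    |linInterp w x - linInterp w y| ≤ C * |x - y| := by
  have hC : 0 ≤ C := (abs_nonneg _).trans (hw 0)
  have key : ∀ x y : ℝ, x ≤ y → |linInterp w y - linInterp w x| ≤ C * (y - x) := by
    intro x y hxy
    have hf := Int.floor_mono hxy
    have ex := Int.floor_add_fract x
    have ey := Int.floor_add_fract y
    have fx := Int.fract_nonneg x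
    have fy := Int.fract_nonneg y
    have fx1 := Int.fract_lt_one x
    rcases hf.eq_or_lt with h | h
    · have e : linInterp w y - linInterp w x = (y - x) * (w (⌊x⌋ + 1) - w ⌊x⌋) := by
        unfold linInterp
        rw [← h] at ey ⊢
        rw [show Int.fract y = y - ⌊x⌋ by linarith, show Int.fract x = x - ⌊x⌋ by linarith]
        ring
      rw [e, abs_mul, abs_of_nonneg (by linarith), mul_comm]
      exact mul_le_mul_of_nonneg_right (hw _) (by linarith)
    · obtain ⟨n, hn⟩ := Int.le.dest (Int.add_one_le_of_lt h)
      have hn' : ((⌊x⌋ : ℤ) : ℝ) + 1 + n = ⌊y⌋ := by exact_mod_cast hn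
      have e : linInterp w y - linInterp w x =
          Int.fract y * (w (⌊y⌋ + 1) - w ⌊y⌋) + (w (⌊x⌋ + 1 + n) - w (⌊x⌋ + 1)) +
            (1 - Int.fract x) * (w (⌊x⌋ + 1) - w ⌊x⌋) := by
        rw [hn]; unfold linInterp; ring
      have h1 := hw ⌊y⌋
      have h2 := abs_sub_le_of_diff_le hw (⌊x⌋ + 1) n
      have h3 := hw ⌊x⌋
      rw [e]
      calc _ ≤ Int.fract y * C + C * n + (1 - Int.fract x) * C := by
            refine (abs_add_le _ _).trans (add_le_add ((abs_add_le _ _).trans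
              (add_le_add ?_ h2)) ?_)
            · rw [abs_mul, abs_of_nonneg fy]; exact mul_le_mul_of_nonneg_left h1 fy
            · rw [abs_mul, abs_of_nonneg (by linarith)]
              exact mul_le_mul_of_nonneg_left h3 (by linarith)
        _ = C * (Int.fract y + n + 1 - Int.fract x) := by ring
        _ = C * (y - x) := by congr 1; linarith
  rcases le_total x y with h | h
  · rw [abs_sub_comm, abs_sub_comm x, abs_of_nonneg (by linarith : 0 ≤ y - x)]; exact key x y h
  · rw [abs_of_nonneg (by linarith : 0 ≤ x - y)]; exact key y x h

theorem linInterp_eq_of_eq {w : ℤ → ℝ} {y C : ℝ} (h1 : w ⌊y⌋ = C) (h2 : w (⌊y⌋ + 1) = C) :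
    linInterp w y = C := by
  unfold linInterp; rw [h1, h2]; ring

theorem linInterp_intCast (w : ℤ → ℝ) (k : ℤ) : linInterp w k = w k := by
  unfold linInterp; simp

theorem linInterp_add_natCast {w : ℤ → ℝ} {N : ℕ} (hw : ∀ i : ℤ, w (i + N) = w i) (y : ℝ) :
    linInterp w (y + N) = linInterp w y := by
  unfold linInterp
  rw [Int.floor_add_natCast, Int.fract_add_natCast, hw, add_right_comm, hw]

/-! ### The `Q¹` reconstruction and its piecewise constant analogue -/

section Interp

variable {N : ℕ} [NeZero N] {dt K : ℝ} {w : ℕ → ZMod N → ZMod N → ℝ}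

/-- The `Q¹` interpolant of `w`, extended by its initial value to negative times. -/
noncomputable def gridInterp (N : ℕ) (dt : ℝ) (w : ℕ → ZMod N → ZMod N → ℝ)
    (z : ℝ × ℝ × ℝ) : ℝ :=
  linInterp (fun n => linInterp (fun i => linInterp (fun j => w n.toNat (i : ZMod N) (j : ZMod N))
    (z.2.2 / spaceStep N)) (z.2.1 / spaceStep N)) (z.1 / dt)

/-- The piecewise constant interpolant of `w`. -/
noncomputable def gridStep (N : ℕ) (dt : ℝ) (w : ℕ → ZMod N → ZMod N → ℝ)
    (z : ℝ × ℝ × ℝ) : ℝ :=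
  w ⌊z.1 / dt⌋.toNat (⌊z.2.1 / spaceStep N⌋ : ZMod N) (⌊z.2.2 / spaceStep N⌋ : ZMod N)

theorem interpSpace_eq (v : ZMod N → ZMod N → ℝ) (x₁ x₂ : ℝ) : interpSpace N v x₁ x₂ =
    linInterp (fun i => linInterp (fun j => v (i : ZMod N) (j : ZMod N)) (x₂ / spaceStep N))
      (x₁ / spaceStep N) := by
  have hh := (spaceStep_pos N).ne'
  have e : ∀ x : ℝ, (x - (⌊x / spaceStep N⌋ : ℝ) * spaceStep N) / spaceStep N =
      Int.fract (x / spaceStep N) := fun x => by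
    rw [sub_div, mul_div_cancel_right₀ _ hh]; rfl
  unfold interpSpace linInterp
  simp only [e]
  push_cast
  ring

theorem reconstruct_eq {T : ℝ} {NT : ℕ} (hT : 0 < T) (hNT : 0 < NT) {z : ℝ × ℝ × ℝ}
    (hz : 0 ≤ z.1) : reconstruct T N NT w z = gridInterp N (timeStep T NT) w z := by
  have hdt := timeStep_pos hT hNT
  have hn : 0 ≤ ⌊z.1 / timeStep T NT⌋ := Int.floor_nonneg.2 (div_nonneg hz hdt.le)
  have h1 : ⌊z.1 / timeStep T NT⌋₊ = ⌊z.1 / timeStep T NT⌋.toNat := rfl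
  have h2 : ((⌊z.1 / timeStep T NT⌋.toNat : ℕ) : ℝ) = (⌊z.1 / timeStep T NT⌋ : ℝ) := by
    have : ((⌊z.1 / timeStep T NT⌋.toNat : ℕ) : ℤ) = ⌊z.1 / timeStep T NT⌋ := Int.toNat_of_nonneg hn
    exact_mod_cast this
  have h3 : (⌊z.1 / timeStep T NT⌋ + 1).toNat = ⌊z.1 / timeStep T NT⌋.toNat + 1 := by omega
  have e : (z.1 - (⌊z.1 / timeStep T NT⌋ : ℝ) * timeStep T NT) / timeStep T NT =
      Int.fract (z.1 / timeStep T NT) := by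
    rw [sub_div, mul_div_cancel_right₀ _ hdt.ne']; rfl
  unfold reconstruct gridInterp
  simp only [h1, h2, e, interpSpace_eq]
  conv_rhs => rw [linInterp]
  rw [h3]
  ring

-- Freezing is invisible on [0,T]: only at t = T does the interpolant touch the index `NT + 1`, and
-- there its weight is zero.
omit [NeZero N] in
theorem gridInterp_min {T : ℝ} {NT : ℕ} (hT : 0 < T) (hNT : 0 < NT) {z : ℝ × ℝ × ℝ}
    (hz : z.1 ∈ Icc 0 T) : gridInterp N (timeStep T NT) (fun n => w (min n NT)) z =
      gridInterp N (timeStep T NT) w z := by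
  have hdt := timeStep_pos hT hNT
  have hle : z.1 / timeStep T NT ≤ NT := by
    rw [div_le_iff₀ hdt, natCast_mul_timeStep hNT]; exact hz.2
  have hfl : ⌊z.1 / timeStep T NT⌋ ≤ NT := by
    have : ⌊z.1 / timeStep T NT⌋ ≤ ⌊(NT : ℝ)⌋ := Int.floor_mono hle
    simpa using this
  unfold gridInterp
  rcases hfl.lt_or_eq with h | h
  · unfold linInterp
    dsimp only
    rw [min_eq_left (by omega : ⌊z.1 / timeStep T NT⌋.toNat ≤ NT),
      min_eq_left (by omega : (⌊z.1 / timeStep T NT⌋ + 1).toNat ≤ NT)]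
  · have h1 : z.1 / timeStep T NT = ((NT : ℤ) : ℝ) := by
      refine le_antisymm (by simpa using hle) ?_
      rw [← h]; exact Int.floor_le _
    rw [h1, linInterp_intCast, linInterp_intCast]
    simp

-- Being constant in time outside [0,T] reduces uniform convergence on the whole space to a compact
-- set.
omit [NeZero N] in
theorem gridInterp_eq_clamp {T : ℝ} {NT : ℕ} (hT : 0 < T) (hNT : 0 < NT) (t : ℝ) (x : ℝ × ℝ) :
    gridInterp N (timeStep T NT) (fun n => w (min n NT)) (t, x) =
      gridInterp N (timeStep T NT) (fun n => w (min n NT)) (max 0 (min t T), x) := by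
  have hdt := timeStep_pos hT hNT
  have hNTdt : T / timeStep T NT = ((NT : ℤ) : ℝ) := by
    rw [div_eq_iff hdt.ne', Int.cast_natCast, natCast_mul_timeStep hNT]
  rcases lt_or_ge t 0 with h | h
  · rw [max_eq_left ((min_le_left _ _).trans h.le)]
    unfold gridInterp
    have hfl : ⌊t / timeStep T NT⌋ < 0 := Int.floor_lt.2 (by
      simpa using div_neg_of_neg_of_pos h hdt)
    rw [zero_div]
    have e := linInterp_intCast (fun n : ℤ => linInterp (fun i => linInterp (fun j =>
      w (min n.toNat NT) (i : ZMod N) (j : ZMod N)) (x.2 / spaceStep N)) (x.1 / spaceStep N)) 0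
    rw [Int.cast_zero] at e
    rw [e]
    refine linInterp_eq_of_eq ?_ ?_
    · rw [show ⌊t / timeStep T NT⌋.toNat = 0 by omega]; rfl
    · rw [show (⌊t / timeStep T NT⌋ + 1).toNat = 0 by omega]; rfl
  · rcases le_or_gt t T with h' | h'
    · rw [min_eq_left h', max_eq_right h]
    · rw [min_eq_right h'.le, max_eq_right hT.le]
      unfold gridInterp
      have hfl : (NT : ℤ) ≤ ⌊t / timeStep T NT⌋ := by
        rw [Int.le_floor, ← hNTdt]
        exact div_le_div_of_nonneg_right h'.le hdt.le
      rw [hNTdt, linInterp_intCast]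
      refine linInterp_eq_of_eq ?_ ?_
      · dsimp only
        rw [min_eq_right (by omega : NT ≤ ⌊t / timeStep T NT⌋.toNat)]; simp
      · dsimp only
        rw [min_eq_right (by omega : NT ≤ (⌊t / timeStep T NT⌋ + 1).toNat)]; simp

theorem add_one_div_spaceStep (x : ℝ) :
    (x + 1) / spaceStep N = x / spaceStep N + N := by
  rw [add_div, ← natCast_mul_spaceStep N, mul_div_cancel_right₀ _ (spaceStep_pos N).ne']

theorem isSpacePeriodic_gridInterp : IsSpacePeriodic (gridInterp N dt w) := by
  intro t x₁ x₂
  unfold gridInterp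
  simp only [add_one_div_spaceStep]
  refine ⟨?_, ?_⟩
  · congr 1; ext n
    refine linInterp_add_natCast (fun i => ?_) _
    push_cast; simp
  · congr 1; ext n; congr 1; ext i
    refine linInterp_add_natCast (fun i => ?_) _
    push_cast; simp

theorem isSpacePeriodic_gridStep : IsSpacePeriodic (gridStep N dt w) := by
  intro t x₁ x₂
  unfold gridStep
  simp only [add_one_div_spaceStep, Int.floor_add_natCast]
  push_cast; simp

end Interp

/-! ### Lipschitz bounds for the interpolants -/

section Bounds

variable {N : ℕ} {dt K : ℝ} {w : ℕ → ZMod N → ZMod N → ℝ} (hw : GridBounds N dt K w)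

include hw

theorem GridBounds.abs_gridInterp_le (z : ℝ × ℝ × ℝ) : |gridInterp N dt w z| ≤ K :=
  abs_linInterp_le (fun _ => abs_linInterp_le (fun _ => abs_linInterp_le
    (fun _ => hw.bound _ _ _) _) _) _

theorem GridBounds.abs_gridStep_le (z : ℝ × ℝ × ℝ) : |gridStep N dt w z| ≤ K :=
  hw.bound _ _ _

theorem GridBounds.diff_t_toNat (hK : 0 ≤ K) (hdt : 0 < dt) (n : ℤ) (i j : ZMod N) :
    |w (n + 1).toNat i j - w n.toNat i j| ≤ K * dt := by
  rcases lt_or_ge n 0 with h | h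
  · rw [show (n + 1).toNat = n.toNat by omega, sub_self, abs_zero]; positivity
  · rw [show (n + 1).toNat = n.toNat + 1 by omega]; exact hw.diff_t _ _ _

theorem GridBounds.diff_t_interp (hK : 0 ≤ K) (hdt : 0 < dt) (y₁ y₂ : ℝ) (n : ℤ) :
    |linInterp (fun i => linInterp (fun j => w (n + 1).toNat (i : ZMod N) (j : ZMod N)) y₂) y₁ -
      linInterp (fun i => linInterp (fun j => w n.toNat (i : ZMod N) (j : ZMod N)) y₂) y₁| ≤
      K * dt := by
  simp only [← linInterp_sub]
  exact abs_linInterp_le (fun _ => abs_linInterp_le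
    (fun _ => hw.diff_t_toNat hK hdt _ _ _) _) _

theorem GridBounds.diff_x1_interp (y₂ : ℝ) (n i : ℤ) :
    |linInterp (fun j => w n.toNat ((i + 1 : ℤ) : ZMod N) (j : ZMod N)) y₂ -
      linInterp (fun j => w n.toNat (i : ZMod N) (j : ZMod N)) y₂| ≤ K * spaceStep N := by
  rw [← linInterp_sub]
  refine abs_linInterp_le (fun j => ?_) _
  push_cast
  exact hw.diff_x1 _ _ _

variable [NeZero N]

-- Time, x₁ and x₂ are replaced by their grid values one at a time, each at the cost of one mesh
-- difference.
omit [NeZero N] in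
theorem GridBounds.abs_gridInterp_sub_gridStep_le (hK : 0 ≤ K) (hdt : 0 < dt) (z : ℝ × ℝ × ℝ) :
    |gridInterp N dt w z - gridStep N dt w z| ≤ 3 * K * max dt (spaceStep N) := by
  have h1 := abs_linInterp_sub_floor_le (w := fun n : ℤ => linInterp (fun i => linInterp
    (fun j => w n.toNat (i : ZMod N) (j : ZMod N)) (z.2.2 / spaceStep N)) (z.2.1 / spaceStep N))
    (hw.diff_t_interp hK hdt (z.2.1 / spaceStep N)
    (z.2.2 / spaceStep N)) (z.1 / dt)
  have h2 := abs_linInterp_sub_floor_le (w := fun i : ℤ => linInterp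
    (fun j => w ⌊z.1 / dt⌋.toNat (i : ZMod N) (j : ZMod N)) (z.2.2 / spaceStep N))
    (hw.diff_x1_interp (z.2.2 / spaceStep N) ⌊z.1 / dt⌋)
    (z.2.1 / spaceStep N)
  have h3 := abs_linInterp_sub_floor_le (C := K * spaceStep N) (w := fun j : ℤ =>
    w ⌊z.1 / dt⌋.toNat (⌊z.2.1 / spaceStep N⌋ : ZMod N) (j : ZMod N))
    (fun j => by push_cast; exact hw.diff_x2 _ _ _) (z.2.2 / spaceStep N)
  have m1 := mul_le_mul_of_nonneg_left (le_max_left dt (spaceStep N)) hK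
  have m2 := mul_le_mul_of_nonneg_left (le_max_right dt (spaceStep N)) hK
  unfold gridInterp gridStep
  rw [abs_le] at *
  constructor <;> linarith [h1.1, h1.2, h2.1, h2.2, h3.1, h3.2]

/-- The variables are changed one at a time. Differences in an outer variable survive interpolation
in the inner ones, because interpolation is linear and an average; hence the factor 3. -/
theorem GridBounds.abs_gridInterp_sub_le (hK : 0 ≤ K) (hdt : 0 < dt) (z z' : ℝ × ℝ × ℝ) :
    |gridInterp N dt w z - gridInterp N dt w z'| ≤ 3 * K * ‖z - z'‖ := by
  have hh := spaceStep_pos N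
  have scale : ∀ {d : ℝ}, 0 < d → ∀ x y : ℝ, K * d * |x / d - y / d| = K * |x - y| := by
    intro d hd x y
    rw [← sub_div, abs_div, abs_of_pos hd]; field_simp
  have h1 := abs_linInterp_sub_le (w := fun n : ℤ => linInterp (fun i => linInterp
    (fun j => w n.toNat (i : ZMod N) (j : ZMod N)) (z.2.2 / spaceStep N)) (z.2.1 / spaceStep N))
    (hw.diff_t_interp hK hdt (z.2.1 / spaceStep N)
    (z.2.2 / spaceStep N)) (z.1 / dt) (z'.1 / dt)
  rw [scale hdt] at h1
  have h2 : ∀ n : ℤ, _ := fun n => abs_linInterp_sub_le (w := fun i : ℤ => linInterp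
    (fun j => w n.toNat (i : ZMod N) (j : ZMod N)) (z.2.2 / spaceStep N))
    (hw.diff_x1_interp (z.2.2 / spaceStep N) n) (z.2.1 / spaceStep N) (z'.2.1 / spaceStep N)
  simp only [scale hh] at h2
  have h2' := abs_linInterp_le h2 (z'.1 / dt)
  have h3 : ∀ n i : ℤ, _ := fun n i => abs_linInterp_sub_le (C := K * spaceStep N)
    (w := fun j : ℤ => w n.toNat (i : ZMod N) (j : ZMod N))
    (fun j => by push_cast; exact hw.diff_x2 _ _ _) (z.2.2 / spaceStep N) (z'.2.2 / spaceStep N)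
  simp only [scale hh] at h3
  have h3' := abs_linInterp_le (fun n => abs_linInterp_le (h3 n) (z'.2.1 / spaceStep N))
    (z'.1 / dt)
  have n1 : |z.1 - z'.1| ≤ ‖z - z'‖ := norm_fst_le (z - z')
  have n2 : |z.2.1 - z'.2.1| ≤ ‖z - z'‖ := (norm_fst_le (z - z').2).trans (norm_snd_le (z - z'))
  have n3 : |z.2.2 - z'.2.2| ≤ ‖z - z'‖ := (norm_snd_le (z - z').2).trans (norm_snd_le (z - z'))
  have m1 := mul_le_mul_of_nonneg_left n1 hK
  have m2 := mul_le_mul_of_nonneg_left n2 hK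
  have m3 := mul_le_mul_of_nonneg_left n3 hK
  simp only [linInterp_sub] at h2' h3'
  unfold gridInterp
  rw [abs_le] at h1 h2' h3' ⊢
  constructor <;> linarith [h1.1, h1.2, h2'.1, h2'.2, h3'.1, h3'.2]

end Bounds

/-! ### Compactness -/

theorem IsSpacePeriodic.fract {f : ℝ × ℝ × ℝ → ℝ} (hf : IsSpacePeriodic f) (t : ℝ) (x : ℝ × ℝ) :
    f (t, Int.fract x.1, Int.fract x.2) = f (t, x) :=
  TorusPeriodic.fract (f := fun x => f (t, x)) (fun x₁ x₂ => hf t x₁ x₂) x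

theorem IsSpacePeriodic.comp_add {f : ℝ × ℝ × ℝ → ℝ} (hf : IsSpacePeriodic f)
    (d : ℝ × ℝ × ℝ) : IsSpacePeriodic fun z => f (z + d) := fun t x₁ x₂ => by
  have h := hf (t + d.1) (x₁ + d.2.1) (x₂ + d.2.2)
  rw [add_right_comm x₁, add_right_comm x₂] at h
  exact h

theorem IsSpacePeriodic.mul {f g : ℝ × ℝ × ℝ → ℝ} (hf : IsSpacePeriodic f)
    (hg : IsSpacePeriodic g) : IsSpacePeriodic fun z => f z * g z := fun t x₁ x₂ => by
  simp only [(hf t x₁ x₂).1, (hf t x₁ x₂).2, (hg t x₁ x₂).1, (hg t x₁ x₂).2, and_self]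

/-- Uniformly bounded and equi-Lipschitz sequences of periodic functions that are constant in time
outside `[0,T]` have uniformly convergent subsequences. -/
theorem exists_subseq_tendstoUniformly {T : ℝ} {C K : ℝ} (hT : 0 ≤ T)
    {R : ℕ → ℤˣ → ℝ × ℝ × ℝ → ℝ} (hper : ∀ m s, IsSpacePeriodic (R m s))
    (hclamp : ∀ m s t x, R m s (t, x) = R m s (max 0 (min t T), x))
    (hlip : ∀ m s z z', |R m s z - R m s z'| ≤ C * ‖z - z'‖) (hbd : ∀ m s z, |R m s z| ≤ K) :
    ∃ (κ : ℕ → ℕ) (ρ : ℤˣ → ℝ × ℝ × ℝ → ℝ), StrictMono κ ∧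
      ∀ s, TendstoUniformly (fun k => R (κ k) s) (ρ s) atTop := by
  have hK : 0 ≤ K := (abs_nonneg _).trans (hbd 0 1 0)
  have hC : 0 ≤ C := by simpa using (abs_nonneg _).trans (hlip 0 1 (1, 0, 0) 0)
  let Q : Set (ℝ × ℝ × ℝ) := Icc 0 T ×ˢ (Icc (0 : ℝ) 1 ×ˢ Icc (0 : ℝ) 1)
  have hQ : IsCompact Q := isCompact_Icc.prod (isCompact_Icc.prod isCompact_Icc)
  have : CompactSpace Q := isCompact_iff_compactSpace.1 hQ
  have hdist : ∀ m z z', dist (fun s => R m s z) (fun s => R m s z') ≤ C * dist z z' :=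
    fun m z z' => (dist_pi_le_iff (by positivity)).2 fun s => by
      rw [Real.dist_eq, dist_eq_norm]; exact hlip m s z z'
  have hcont : ∀ m, Continuous fun z : Q => fun s => R m s z := fun m =>
    (LipschitzWith.of_dist_le_mul (K := ⟨C, hC⟩) fun z z' => hdist m z z').continuous.comp
      continuous_subtype_val
  -- Both signs are packed into one vector-valued function, so that a single extraction serves both.
  let f : ℕ → BoundedContinuousFunction Q (ℤˣ → ℝ) := fun m =>
    BoundedContinuousFunction.mkOfCompact ⟨_, hcont m⟩
  have hcomp : IsCompact (closure (range f)) := by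
    refine BoundedContinuousFunction.arzela_ascoli (Metric.closedBall 0 K)
      (isCompact_closedBall _ _) _ ?_ ?_
    · rintro _ z ⟨m, rfl⟩
      rw [mem_closedBall_zero_iff, pi_norm_le_iff_of_nonneg hK]
      exact fun s => hbd m s z
    · refine Metric.equicontinuous_of_continuity_modulus (fun r => C * r) ?_ _ ?_
      · have : Continuous fun r => C * r := by fun_prop
        simpa using this.tendsto 0
      · rintro z z' ⟨_, m, rfl⟩
        exact hdist m z z'
  obtain ⟨g, -, κ, hκ, hlim⟩ := hcomp.tendsto_subseq
    fun n => subset_closure (mem_range_self (f := f) n)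
  -- Clamping time and taking fractional parts maps every point into `Q` without changing the values
  -- of `R`.
  have hπ : ∀ z : ℝ × ℝ × ℝ,
      ((max 0 (min z.1 T), Int.fract z.2.1, Int.fract z.2.2) : ℝ × ℝ × ℝ) ∈ Q := fun z =>
    ⟨⟨le_max_left _ _, max_le hT (min_le_right _ _)⟩,
      ⟨Int.fract_nonneg _, (Int.fract_lt_one _).le⟩, ⟨Int.fract_nonneg _, (Int.fract_lt_one _).le⟩⟩
  refine ⟨κ, fun s z => g ⟨_, hπ z⟩ s, hκ, fun s => ?_⟩
  rw [Metric.tendstoUniformly_iff]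
  intro ε hε
  have h1 := Metric.tendstoUniformly_iff.1
    (BoundedContinuousFunction.tendsto_iff_tendstoUniformly.1 hlim) ε hε
  filter_upwards [h1] with k hk z
  have h2 := hk ⟨_, hπ z⟩
  have h3 : R (κ k) s z = f (κ k) ⟨_, hπ z⟩ s := by
    change _ = R (κ k) s (max 0 (min z.1 T), Int.fract z.2.1, Int.fract z.2.2)
    rw [(hper _ _).fract, ← hclamp]
  rw [h3]
  exact (dist_le_pi_dist _ _ s).trans_lt h2

/-! ### Integrals over the cylinder -/

instance isFiniteMeasure_cylinder (T : ℝ) :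
    IsFiniteMeasure (volume.restrict (cylinder T)) := by
  refine ⟨?_⟩
  rw [Measure.restrict_apply_univ]
  refine lt_of_le_of_lt (measure_mono (t := Icc 0 T ×ˢ (Icc (0 : ℝ) 1 ×ˢ Icc (0 : ℝ) 1)) ?_)
    (isCompact_Icc.prod (isCompact_Icc.prod isCompact_Icc)).measure_lt_top
  exact prod_mono Ioo_subset_Icc_self (prod_mono Ico_subset_Icc_self Ico_subset_Icc_self)

theorem measurableSet_cylinder (T : ℝ) : MeasurableSet (cylinder T) :=
  measurableSet_Ioo.prod measurableSet_unitCell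

theorem integrableOn_cylinder {T C : ℝ} {f : ℝ × ℝ × ℝ → ℝ}
    (hf : AEStronglyMeasurable f (volume.restrict (cylinder T)))
    (hC : ∀ z ∈ cylinder T, |f z| ≤ C) : IntegrableOn f (cylinder T) :=
  Integrable.of_bound hf C ((ae_restrict_iff' (measurableSet_cylinder T)).2
    (Eventually.of_forall hC))

/-- Summation by parts for translates. -/
theorem setIntegral_diff_mul {T δ K C : ℝ} {U G : ℝ × ℝ × ℝ → ℝ} {d : ℝ × ℝ × ℝ}
    (hU : Measurable U) (hG : Measurable G) (hUK : ∀ z, |U z| ≤ K) (hGC : ∀ z, |G z| ≤ C)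
    (hUp : IsSpacePeriodic U) (hGp : IsSpacePeriodic G)
    (hsupp : ∀ z, G z ≠ 0 → δ ≤ z.1 ∧ z.1 ≤ T - δ) (hd : |d.1| < δ) :
    ∫ z in cylinder T, (U (z + d) - U z) * G z = ∫ z in cylinder T, U z * (G (z - d) - G z) := by
  have hint : ∀ d₁ d₂, IntegrableOn (fun z => U (z + d₁) * G (z + d₂)) (cylinder T) :=
    fun d₁ d₂ => integrableOn_cylinder (C := K * C) ((hU.comp (measurable_add_const d₁)).mul
      (hG.comp (measurable_add_const d₂))).aestronglyMeasurable fun z _ => by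
        rw [abs_mul]
        exact mul_le_mul (hUK _) (hGC _) (abs_nonneg _) ((abs_nonneg _).trans (hUK 0))
  have i1 := hint d 0
  have i2 := hint 0 0
  have i3 := hint 0 (-d)
  simp only [add_zero, ← sub_eq_add_neg] at i1 i2 i3
  -- Only the product U(· + d)G is translated; its support in time is inherited from `G`.
  have hshift := setIntegral_cylinder_add (T := T) (G := fun z => U (z + d) * G z)
    (d := -d) (δ := δ) ((hUp.comp_add d).mul hGp) (fun z hz => hsupp z (right_ne_zero_of_mul hz))
    (by simpa using hd)
  simp only [← sub_eq_add_neg, sub_add_cancel] at hshift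
  simp only [sub_mul, mul_sub]
  rw [integral_sub i1 i2, integral_sub i3 i2, hshift]

/-- Bounded convergence on the cylinder. -/
theorem tendsto_setIntegral_cylinder {T C : ℝ} {F : ℕ → ℝ × ℝ × ℝ → ℝ} {f : ℝ × ℝ × ℝ → ℝ}
    (hF : ∀ᶠ n in atTop, AEStronglyMeasurable (F n) (volume.restrict (cylinder T)))
    (hC : ∀ᶠ n in atTop, ∀ z ∈ cylinder T, |F n z| ≤ C)
    (hlim : ∀ᵐ z, z ∈ cylinder T → Tendsto (fun n => F n z) atTop (𝓝 (f z))) :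
    Tendsto (fun n => ∫ z in cylinder T, F n z) atTop (𝓝 (∫ z in cylinder T, f z)) := by
  refine tendsto_integral_filter_of_dominated_convergence (fun _ => C) hF ?_
    (integrable_const _) ((ae_restrict_iff' (measurableSet_cylinder T)).2 hlim)
  filter_upwards [hC] with n hn
  exact (ae_restrict_iff' (measurableSet_cylinder T)).2 (Eventually.of_forall hn)

/-! ### Test functions -/

section TestFunction

variable {T : ℝ} {φ : ℝ × ℝ × ℝ → ℝ}

/-- The difference quotients of a smooth function are bounded on the cylinder. -/
theorem IsTestFunction.exists_diff_bound (hφ : IsTestFunction T φ) :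
    ∃ C, 0 ≤ C ∧ (∀ z, |φ z| ≤ C) ∧
      ∀ z ∈ cylinder T, ∀ d : ℝ × ℝ × ℝ, ‖d‖ ≤ 1 → |φ (z + d) - φ z| ≤ C * ‖d‖ := by
  -- A convex compact set that contains every unit displacement from the cylinder, as the mean value
  -- inequality needs.
  let B : Set (ℝ × ℝ × ℝ) := Icc (-1) (T + 1) ×ˢ (Icc (-1 : ℝ) 2 ×ˢ Icc (-1 : ℝ) 2)
  have hB : IsCompact B := isCompact_Icc.prod (isCompact_Icc.prod isCompact_Icc)
  have hBc : Convex ℝ B := (convex_Icc _ _).prod ((convex_Icc _ _).prod (convex_Icc _ _))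
  obtain ⟨C₁, h₁⟩ := hB.exists_bound_of_continuousOn hφ.smooth.continuous.continuousOn
  obtain ⟨C₂, h₂⟩ := hB.exists_bound_of_continuousOn
    (hφ.smooth.continuous_fderiv (by simp)).continuousOn
  have hsub : ∀ z ∈ cylinder T, ∀ d : ℝ × ℝ × ℝ, ‖d‖ ≤ 1 → z + d ∈ B := by
    rintro ⟨t, x, y⟩ ⟨ht, hx, hy⟩ ⟨d, e, f⟩ hd
    have n1 : |d| ≤ 1 := (norm_fst_le ((d, e, f) : ℝ × ℝ × ℝ)).trans hd
    have n' : ‖((e, f) : ℝ × ℝ)‖ ≤ 1 := (norm_snd_le ((d, e, f) : ℝ × ℝ × ℝ)).trans hd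
    have n2 : |e| ≤ 1 := (norm_fst_le ((e, f) : ℝ × ℝ)).trans n'
    have n3 : |f| ≤ 1 := (norm_snd_le ((e, f) : ℝ × ℝ)).trans n'
    rw [abs_le] at n1 n2 n3
    simp only [mem_Ioo, mem_Ico] at ht hx hy
    refine ⟨⟨?_, ?_⟩, ⟨?_, ?_⟩, ⟨?_, ?_⟩⟩ <;> simp only [Prod.mk_add_mk] <;> linarith
  refine ⟨max 0 (max C₁ C₂), le_max_left _ _, fun z => ?_, fun z hz d hd => ?_⟩
  · obtain ⟨δ, hδ, hsupp⟩ := hφ.support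
    by_cases h0 : φ z = 0
    · rw [h0, abs_zero]; exact le_max_left _ _
    · have ht := hsupp z h0
      rw [← hφ.periodic.fract z.1 z.2]
      refine (h₁ _ (?_ : _ ∈ B)).trans ((le_max_left _ _).trans (le_max_right _ _))
      have f1 := Int.fract_nonneg z.2.1
      have f2 := Int.fract_nonneg z.2.2
      have f3 := Int.fract_lt_one z.2.1
      have f4 := Int.fract_lt_one z.2.2
      refine ⟨⟨?_, ?_⟩, ⟨?_, ?_⟩, ⟨?_, ?_⟩⟩ <;> dsimp only <;> linarith
  · have := hBc.norm_image_sub_le_of_norm_fderiv_le (𝕜 := ℝ)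
      (fun z _ => (hφ.smooth.differentiable (by simp)) z) h₂
      (by simpa using hsub z hz 0 (by simp)) (hsub z hz d hd)
    rw [add_sub_cancel_left] at this
    exact this.trans (mul_le_mul_of_nonneg_right
      ((le_max_right _ _).trans (le_max_right _ _)) (norm_nonneg _))

theorem IsTestFunction.tendsto_quotient (hφ : IsTestFunction T φ) (z d : ℝ × ℝ × ℝ) {h : ℕ → ℝ}
    (hh : ∀ n, h n ≠ 0) (hlim : Tendsto h atTop (𝓝 0)) :
    Tendsto (fun n => (φ (z + h n • d) - φ z) / h n) atTop (𝓝 (fderiv ℝ φ z d)) := by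
  have h1 := ((hφ.smooth.differentiable (by simp)) z).hasFDerivAt.hasLineDerivAt d
  have h2 := h1.tendsto_slope_zero.comp (tendsto_nhdsWithin_iff.2
    ⟨hlim, Eventually.of_forall fun n => hh n⟩)
  refine h2.congr fun n => ?_
  simp [div_eq_inv_mul]

/-- Difference quotients of test functions, tested with a uniformly convergent sequence. -/
theorem IsTestFunction.tendsto_integral_quotient (hφ : IsTestFunction T φ) (d : ℝ × ℝ × ℝ)
    {h : ℕ → ℝ} (hh : ∀ n, h n ≠ 0) (hlim : Tendsto h atTop (𝓝 0))
    {F : ℕ → ℝ × ℝ × ℝ → ℝ} {f : ℝ × ℝ × ℝ → ℝ} {K : ℝ} (hF : ∀ n, Measurable (F n))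
    (hK : ∀ n z, |F n z| ≤ K) (hFf : ∀ z, Tendsto (fun n => F n z) atTop (𝓝 (f z))) :
    Tendsto (fun n => ∫ z in cylinder T, F n z * ((φ (z + h n • d) - φ z) / h n)) atTop
      (𝓝 (∫ z in cylinder T, f z * fderiv ℝ φ z d)) := by
  obtain ⟨C, hC0, -, hC⟩ := hφ.exists_diff_bound
  have hK0 : 0 ≤ K := (abs_nonneg _).trans (hK 0 0)
  have hcont := hφ.smooth.continuous
  refine tendsto_setIntegral_cylinder (C := K * (C * ‖d‖)) (Eventually.of_forall fun n => ?_) ?_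
    (Eventually.of_forall fun z _ => (hFf z).mul (hφ.tendsto_quotient z d hh hlim))
  · exact ((hF n).mul (Continuous.measurable (by fun_prop))).aestronglyMeasurable
  · have h0 : Tendsto (fun n => ‖h n • d‖) atTop (𝓝 0) := by
      simpa using (hlim.smul_const d).norm
    filter_upwards [h0.eventually (ge_mem_nhds (zero_lt_one' ℝ))] with n hn z hz
    rw [abs_mul]
    refine mul_le_mul (hK n z) ?_ (abs_nonneg _) hK0
    rw [abs_div, div_le_iff₀ (abs_pos.2 (hh n))]
    refine (hC z hz _ hn).trans (le_of_eq ?_)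
    rw [norm_smul, Real.norm_eq_abs]; ring

/-- A bounded periodic Lipschitz function has its line derivative as weak derivative. -/
theorem hasWeakDeriv_lineDeriv {f : ℝ × ℝ × ℝ → ℝ} {C : NNReal} {K : ℝ}
    (hf : LipschitzWith C f) (hper : IsSpacePeriodic f) (hK : ∀ z, |f z| ≤ K) (d : ℝ × ℝ × ℝ) :
    HasWeakDeriv T f (fun z => lineDeriv ℝ f z d) d := by
  intro φ hφ
  obtain ⟨δ, hδ, hsupp⟩ := hφ.support
  obtain ⟨Cφ, hC0, hCφ, -⟩ := hφ.exists_diff_bound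
  have hfc := hf.continuous
  have hφc := hφ.smooth.continuous
  let h : ℕ → ℝ := fun n => 1 / ((n : ℝ) + 1)
  have hh : ∀ n, h n ≠ 0 := fun n => by simp only [h]; positivity
  have hlim : Tendsto h atTop (𝓝 0) := tendsto_one_div_add_atTop_nhds_zero_nat
  have h1 := hφ.tendsto_integral_quotient (T := T) d hh hlim (F := fun _ => f)
    (fun _ => hfc.measurable) (fun _ => hK) (fun _ => tendsto_const_nhds)
  -- Summation by parts reverses the displacement, so the quotients of `f` tend to minus the line
  -- derivative. Pointwise convergence holds almost everywhere because `f` is Lipschitz.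
  have h2 : Tendsto (fun n => ∫ z in cylinder T, (f (z + (-h n) • d) - f z) / h n * φ z) atTop
      (𝓝 (∫ z in cylinder T, -lineDeriv ℝ f z d * φ z)) := by
    refine tendsto_setIntegral_cylinder (C := C * ‖d‖ * Cφ)
      (Eventually.of_forall fun n => Continuous.aestronglyMeasurable (by fun_prop))
      (Eventually.of_forall fun n z hz => ?_) ?_
    · rw [abs_mul]
      refine mul_le_mul ?_ (hCφ z) (abs_nonneg _) (by positivity)
      rw [abs_div, div_le_iff₀ (abs_pos.2 (hh n))]
      have := hf.dist_le_mul (z + (-h n) • d) z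
      rw [Real.dist_eq, dist_eq_norm, add_sub_cancel_left, norm_smul, norm_neg,
        Real.norm_eq_abs] at this
      linarith
    · filter_upwards [hf.ae_lineDifferentiableAt (μ := volume) d] with z hz _
      refine Tendsto.mul_const _ ?_
      have h3 := hz.hasLineDerivAt.tendsto_slope_zero.comp (tendsto_nhdsWithin_iff.2
        ⟨by simpa using hlim.neg, Eventually.of_forall fun n => neg_ne_zero.2 (hh n)⟩)
      refine h3.neg.congr fun n => ?_
      simp only [Function.comp, smul_eq_mul]
      have := hh n
      field_simp
  have h3 : ∀ᶠ n in atTop, ∫ z in cylinder T, f z * ((φ (z + h n • d) - φ z) / h n) =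
      ∫ z in cylinder T, (f (z + (-h n) • d) - f z) / h n * φ z := by
    have hsm : Tendsto (fun n => |(h n • d).1|) atTop (𝓝 0) := by
      have : Tendsto (fun n => (h n • d).1) atTop (𝓝 0) := by
        simpa using hlim.mul_const d.1
      simpa using this.abs
    filter_upwards [hsm.eventually (gt_mem_nhds hδ)] with n hn
    have hparts := setIntegral_diff_mul (d := (-h n) • d) hfc.measurable hφc.measurable hK hCφ hper
      hφ.periodic hsupp (by simpa using hn)
    have e2 : ∀ z, f z * ((φ (z + h n • d) - φ z) / h n) =
        (h n)⁻¹ * (f z * (φ (z - (-h n) • d) - φ z)) := fun z => by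
      rw [neg_smul, sub_neg_eq_add]; ring
    have e3 : ∀ z, (f (z + (-h n) • d) - f z) / h n * φ z =
        (h n)⁻¹ * ((f (z + (-h n) • d) - f z) * φ z) := fun z => by ring
    simp only [e2, e3, integral_const_mul, hparts]
  have h4 := tendsto_nhds_unique (h1.congr' h3) h2
  rw [h4, ← integral_neg]
  simp only [neg_mul]

end TestFunction

/-! ### Grid functions as step functions -/

theorem measurable_floor_comp {dt h : ℝ} (g : ℤ → ℤ → ℤ → ℝ) :
    Measurable fun z : ℝ × ℝ × ℝ => g ⌊z.1 / dt⌋ ⌊z.2.1 / h⌋ ⌊z.2.2 / h⌋ := by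
  have h1 : Measurable fun p : ℤ × ℤ × ℤ => g p.1 p.2.1 p.2.2 := Measurable.of_discrete
  have h2 : Measurable fun z : ℝ × ℝ × ℝ => (⌊z.1 / dt⌋, ⌊z.2.1 / h⌋, ⌊z.2.2 / h⌋) := by
    fun_prop
  exact h1.comp h2

theorem measurable_gridStep (N : ℕ) (dt : ℝ) (w : ℕ → ZMod N → ZMod N → ℝ) :
    Measurable (gridStep N dt w) :=
  measurable_floor_comp fun n i j => w n.toNat (i : ZMod N) (j : ZMod N)

theorem abs_floor_mul_sub_le {h : ℝ} (hh : 0 < h) (x : ℝ) : |⌊x / h⌋ * h - x| ≤ h := by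
  have h1 := Int.floor_le (x / h)
  have h2 := Int.lt_floor_add_one (x / h)
  rw [le_div_iff₀ hh] at h1
  rw [div_lt_iff₀ hh] at h2
  rw [abs_le]; constructor <;> linarith

theorem tendsto_floor_mul {h : ℕ → ℝ} (hh : ∀ k, 0 < h k) (hlim : Tendsto h atTop (𝓝 0)) (x : ℝ) :
    Tendsto (fun k => ⌊x / h k⌋ * h k) atTop (𝓝 x) := by
  rw [tendsto_iff_dist_tendsto_zero]
  exact squeeze_zero (fun _ => dist_nonneg) (fun k => by
    rw [Real.dist_eq]; exact abs_floor_mul_sub_le (hh k) x) hlim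

theorem volume_real_unitCell : volume.real unitCell = 1 := by
  unfold unitCell
  rw [Measure.volume_eq_prod, measureReal_prod_prod]
  simp

theorem floor_div_eq_iff {h : ℝ} (hh : 0 < h) (x : ℝ) (k : ℤ) :
    ⌊x / h⌋ = k ↔ x ∈ Ico (k * h) ((k + 1) * h) := by
  rw [Int.floor_eq_iff, le_div_iff₀ hh, div_lt_iff₀ hh, mem_Ico]

theorem setIntegral_unitCell_floor (N : ℕ) [NeZero N] (g : ℤ → ℤ → ℝ) :
    ∫ y in unitCell, g ⌊y.1 / spaceStep N⌋ ⌊y.2 / spaceStep N⌋ =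
      ∑ k : ZMod N, ∑ q : ZMod N, spaceStep N ^ 2 * g k.val q.val := by
  have hh := spaceStep_pos N
  set h := spaceStep N with hdef
  have hNh : N * h = 1 := natCast_mul_spaceStep N
  let piece : ZMod N × ZMod N → Set (ℝ × ℝ) := fun p =>
    Ico ((p.1.val : ℝ) * h) ((p.1.val + 1) * h) ×ˢ Ico ((p.2.val : ℝ) * h) ((p.2.val + 1) * h)
  have hmem : ∀ (p : ZMod N × ZMod N) (y : ℝ × ℝ), y ∈ piece p ↔
      ⌊y.1 / h⌋ = p.1.val ∧ ⌊y.2 / h⌋ = p.2.val := fun p y => by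
    rw [floor_div_eq_iff hh, floor_div_eq_iff hh]; simp [piece, mem_prod]
  have hone : ∀ x : ℝ, x ∈ Ico (0 : ℝ) 1 ↔ ∃ k : ZMod N, ⌊x / h⌋ = k.val := fun x => by
    constructor
    · rintro ⟨h0, h1⟩
      have f0 : 0 ≤ ⌊x / h⌋ := Int.floor_nonneg.2 (div_nonneg h0 hh.le)
      have f1 : ⌊x / h⌋ < N := by
        rw [Int.floor_lt, div_lt_iff₀ hh]; push_cast; linarith
      refine ⟨((⌊x / h⌋.toNat : ℕ) : ZMod N), ?_⟩
      rw [ZMod.val_natCast_of_lt (by omega)]; omega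
    · rintro ⟨k, hk⟩
      rw [floor_div_eq_iff hh] at hk
      have hlt := ZMod.val_lt k
      have h1 : ((k.val : ℝ) + 1) * h ≤ N * h :=
        mul_le_mul_of_nonneg_right (by exact_mod_cast hlt) hh.le
      have h2 : (0 : ℝ) ≤ (k.val : ℝ) * h := by positivity
      push_cast at hk
      exact ⟨h2.trans hk.1, by linarith [hk.2]⟩
  have hunion : unitCell = ⋃ p ∈ (Finset.univ : Finset (ZMod N × ZMod N)), piece p := by
    ext y
    simp only [Finset.mem_univ, iUnion_true, mem_iUnion, hmem, unitCell, mem_prod, hone]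
    constructor
    · rintro ⟨⟨k, hk⟩, ⟨q, hq⟩⟩; exact ⟨(k, q), hk, hq⟩
    · rintro ⟨p, h1, h2⟩; exact ⟨⟨_, h1⟩, ⟨_, h2⟩⟩
  have hmeas : ∀ p, MeasurableSet (piece p) := fun p => measurableSet_Ico.prod measurableSet_Ico
  have hvol : ∀ p, volume.real (piece p) = h ^ 2 := fun p => by
    simp only [piece]
    rw [Measure.volume_eq_prod, measureReal_prod_prod, Real.volume_real_Ico_of_le (by nlinarith),
      Real.volume_real_Ico_of_le (by nlinarith)]
    ring
  have hfin : ∀ p, volume (piece p) ≠ ⊤ := fun p => by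
    simp only [piece]
    rw [Measure.volume_eq_prod, Measure.prod_prod]
    exact ENNReal.mul_ne_top (by simp) (by simp)
  have hcongr : ∀ p, EqOn (fun y : ℝ × ℝ => g ⌊y.1 / h⌋ ⌊y.2 / h⌋)
      (fun _ => g p.1.val p.2.val) (piece p) := fun p y hy => by
    obtain ⟨h1, h2⟩ := (hmem p y).1 hy
    simp only [h1, h2]
  rw [hunion, integral_biUnion_finset _ (fun p _ => hmeas p)]
  · rw [Fintype.sum_prod_type]
    refine Finset.sum_congr rfl fun k _ => Finset.sum_congr rfl fun q _ => ?_
    rw [setIntegral_congr_fun (hmeas _) (hcongr _), setIntegral_const, hvol, smul_eq_mul]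
  · intro p _ p' _ hne
    refine disjoint_left.2 fun y hy hy' => hne ?_
    obtain ⟨h1, h2⟩ := (hmem p y).1 hy
    obtain ⟨h3, h4⟩ := (hmem p' y).1 hy'
    rw [h1] at h3
    rw [h2] at h4
    exact Prod.ext (ZMod.val_injective N (by exact_mod_cast h3))
      (ZMod.val_injective N (by exact_mod_cast h4))
  · intro p _
    exact (integrableOn_const (hfin p)).congr_fun (hcongr p).symm (hmeas p)

/-- The Riemann sum as the integral of a step function, ready for dominated convergence. The
substitution k = i − l moves the difference to the kernel, whose periodicity replaces residues
modulo N by real differences. -/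
theorem gridConv_eq_integral (M N : ℕ) [NeZero N] (v : ZMod N → ZMod N → ℝ) (i j : ℤ) :
    gridConv (gridSigma M N) v (i : ZMod N) (j : ZMod N) =
      ∫ y in unitCell, sigmaKernel M (i * spaceStep N - ⌊y.1 / spaceStep N⌋ * spaceStep N,
        j * spaceStep N - ⌊y.2 / spaceStep N⌋ * spaceStep N) *
        v (⌊y.1 / spaceStep N⌋ : ZMod N) (⌊y.2 / spaceStep N⌋ : ZMod N) := by
  rw [setIntegral_unitCell_floor N fun k q => sigmaKernel M (i * spaceStep N - k * spaceStep N,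
    j * spaceStep N - q * spaceStep N) * v (k : ZMod N) (q : ZMod N)]
  unfold gridConv
  rw [← Equiv.sum_comp (Equiv.subLeft (i : ZMod N))]
  refine Finset.sum_congr rfl fun k _ => ?_
  rw [← Equiv.sum_comp (Equiv.subLeft (j : ZMod N))]
  refine Finset.sum_congr rfl fun q _ => ?_
  simp only [Equiv.subLeft_apply, sub_sub_cancel]
  have hp := torusPeriodic_sigmaKernel M
  have e1 := fun b => periodic_gridPt_intCast (N := N) (f := fun x => sigmaKernel M (x, b))
    (fun x => (hp x b).1) (i - (k.val : ℤ))
  have e2 := fun b => periodic_gridPt_intCast (N := N) (f := fun x => sigmaKernel M (b, x))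
    (fun x => (hp b x).2) (j - (q.val : ℤ))
  push_cast at e1 e2
  simp only [ZMod.natCast_val, ZMod.cast_id', id_eq] at e1 e2
  rw [gridSigma, e1, e2]
  push_cast
  simp only [ZMod.natCast_val, ZMod.cast_id', id_eq, sub_mul, mul_assoc]

/-- The discrete convolutions converge to the convolution with the limit. -/
theorem tendsto_gridConv (M : ℕ) {N : ℕ → ℕ} [∀ k, NeZero (N k)] {dt : ℕ → ℝ}
    (hdt : ∀ k, 0 < dt k) (hdt0 : Tendsto dt atTop (𝓝 0))
    (hh0 : Tendsto (fun k => spaceStep (N k)) atTop (𝓝 0)) {K : ℝ}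
    {w : ∀ k, ℕ → ZMod (N k) → ZMod (N k) → ℝ} (hw : ∀ k n i j, |w k n i j| ≤ K)
    {W : ℝ × ℝ × ℝ → ℝ} (hW : Continuous W)
    (hlim : TendstoUniformly (fun k => gridStep (N k) (dt k) (w k)) W atTop)
    {t : ℝ} (ht : 0 ≤ t) (x : ℝ × ℝ) :
    Tendsto (fun k => gridConv (gridSigma M (N k)) (w k (⌊t / dt k⌋.toNat + 1))
      (⌊x.1 / spaceStep (N k)⌋ : ZMod (N k)) (⌊x.2 / spaceStep (N k)⌋ : ZMod (N k))) atTop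
      (𝓝 (torusConv (sigmaKernel M) (fun y => W (t, y)) x)) := by
  have hσc := (contDiff_sigmaKernel M (n := 1)).continuous
  obtain ⟨B, hB0, hB⟩ := (torusPeriodic_sigmaKernel M).exists_bound hσc
  have hfin : IsFiniteMeasure (volume.restrict unitCell) := ⟨by
    rw [Measure.restrict_apply_univ]
    by_contra h
    have := volume_real_unitCell
    rw [measureReal_def, not_lt_top_iff.1 h] at this
    simp at this⟩
  simp only [gridConv_eq_integral]
  refine tendsto_integral_of_dominated_convergence (fun _ => B * K) (fun k => ?_)
    (integrable_const _) (fun k => Eventually.of_forall fun y => ?_)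
    (Eventually.of_forall fun y => ?_)
  · have h1 := measurable_floor_comp (dt := 1) (h := spaceStep (N k)) (fun _ a b =>
      sigmaKernel M (⌊x.1 / spaceStep (N k)⌋ * spaceStep (N k) - a * spaceStep (N k),
        ⌊x.2 / spaceStep (N k)⌋ * spaceStep (N k) - b * spaceStep (N k)) *
        w k (⌊t / dt k⌋.toNat + 1) (a : ZMod (N k)) (b : ZMod (N k)))
    exact (h1.comp (measurable_prodMk_left (x := (0 : ℝ)))).aestronglyMeasurable
  · rw [Real.norm_eq_abs, abs_mul]
    exact mul_le_mul (hB _) (hw _ _ _ _) (abs_nonneg _) hB0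
  · refine Tendsto.mul ?_ ?_
    · refine (hσc.tendsto _).comp (Tendsto.prodMk_nhds ?_ ?_)
      · exact (tendsto_floor_mul (fun k => spaceStep_pos (N k)) hh0 x.1).sub
          (tendsto_floor_mul (fun k => spaceStep_pos (N k)) hh0 y.1)
      · exact (tendsto_floor_mul (fun k => spaceStep_pos (N k)) hh0 x.2).sub
          (tendsto_floor_mul (fun k => spaceStep_pos (N k)) hh0 y.2)
    -- The values are taken at the new time level, that is at t + Δt; uniform convergence to a
    -- continuous limit absorbs the moving point.
    · have h1 : Tendsto (fun k => (t + dt k, y)) atTop (𝓝 (t, y)) := by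
        refine Tendsto.prodMk_nhds ?_ tendsto_const_nhds
        simpa using hdt0.const_add t
      refine (hlim.tendsto_comp hW.continuousAt h1).congr fun k => ?_
      have h2 : (t + dt k) / dt k = t / dt k + 1 := by rw [add_div, div_self (hdt k).ne']
      have h3 : 0 ≤ ⌊t / dt k⌋ := Int.floor_nonneg.2 (div_nonneg ht (hdt k).le)
      simp only [gridStep, h2, Int.floor_add_one]
      rw [show (⌊t / dt k⌋ + 1).toNat = ⌊t / dt k⌋.toNat + 1 by omega]

/-! ### The limit velocity -/

/-- Regularity in space comes from the kernel and regularity in time from `W`. -/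
theorem exists_lipschitz_torusConv (M : ℕ) {W : ℝ × ℝ × ℝ → ℝ} {C K : ℝ} (hC : 0 ≤ C)
    (hlip : ∀ z z', |W z - W z'| ≤ C * ‖z - z'‖) (hW : Continuous W) (hK : ∀ z, |W z| ≤ K) :
    ∃ C' : ℝ, 0 ≤ C' ∧
      (∀ z : ℝ × ℝ × ℝ, |torusConv (sigmaKernel M) (fun y => W (z.1, y)) z.2| ≤ C') ∧
      ∀ z z' : ℝ × ℝ × ℝ, |torusConv (sigmaKernel M) (fun y => W (z.1, y)) z.2 -
        torusConv (sigmaKernel M) (fun y => W (z'.1, y)) z'.2| ≤ C' * ‖z - z'‖ := by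
  have hσc := (contDiff_sigmaKernel M (n := 1)).continuous
  obtain ⟨B, hB0, hB⟩ := (torusPeriodic_sigmaKernel M).exists_bound hσc
  obtain ⟨Cσ, hCσ0, hCσ⟩ := (torusPeriodic_sigmaKernel M).exists_lipschitz (contDiff_sigmaKernel M)
  have hK0 : 0 ≤ K := (abs_nonneg _).trans (hK 0)
  have hfin : volume unitCell < ⊤ := by
    by_contra h
    have := volume_real_unitCell
    rw [measureReal_def, not_lt_top_iff.1 h] at this
    simp at this
  have hint : ∀ z : ℝ × ℝ × ℝ,
      IntegrableOn (fun y => sigmaKernel M (z.2 - y) * W (z.1, y)) unitCell := fun z =>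
    integrableOn_unitCell_of_locallyIntegrable
      (Continuous.locallyIntegrable (by fun_prop))
  refine ⟨B * K + (Cσ * K + B * C), by positivity, fun z => ?_, fun z z' => ?_⟩
  · have h1 := norm_setIntegral_le_of_norm_le_const (f := fun y =>
      sigmaKernel M (z.2 - y) * W (z.1, y)) (C := B * K) hfin (fun y _ => by
        rw [Real.norm_eq_abs, abs_mul]
        exact mul_le_mul (hB _) (hK _) (abs_nonneg _) hB0)
    rw [volume_real_unitCell, mul_one] at h1
    refine h1.trans ?_
    have : 0 ≤ Cσ * K + B * C := by positivity
    linarith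
  · have h1 := norm_setIntegral_le_of_norm_le_const (f := fun y =>
      sigmaKernel M (z.2 - y) * W (z.1, y) - sigmaKernel M (z'.2 - y) * W (z'.1, y))
      (C := (Cσ * K + B * C) * ‖z - z'‖) hfin (fun y _ => by
        rw [Real.norm_eq_abs, show sigmaKernel M (z.2 - y) * W (z.1, y) -
          sigmaKernel M (z'.2 - y) * W (z'.1, y) =
          (sigmaKernel M (z.2 - y) - sigmaKernel M (z'.2 - y)) * W (z.1, y) +
          sigmaKernel M (z'.2 - y) * (W (z.1, y) - W (z'.1, y)) by ring]
        refine (abs_add_le _ _).trans ?_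
        rw [abs_mul, abs_mul, add_mul, mul_right_comm, mul_assoc B]
        refine add_le_add (mul_le_mul ?_ (hK _) (abs_nonneg _) (by positivity))
          (mul_le_mul (hB _) ?_ (abs_nonneg _) hB0)
        · refine (hCσ _ _).trans (mul_le_mul_of_nonneg_left ?_ hCσ0)
          rw [sub_sub_sub_cancel_right]
          exact norm_snd_le (z - z')
        · refine (hlip _ _).trans (mul_le_mul_of_nonneg_left ?_ hC)
          rw [Prod.mk_sub_mk, sub_self, Prod.norm_mk, norm_zero,
            max_eq_left (norm_nonneg _)]
          exact norm_fst_le (z - z'))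
    rw [volume_real_unitCell, mul_one, integral_sub (hint z) (hint z')] at h1
    refine h1.trans (mul_le_mul_of_nonneg_right ?_ (norm_nonneg _))
    have : 0 ≤ B * K := by positivity
    linarith

theorem torusPeriodic_torusConv (M : ℕ) (W : ℝ × ℝ → ℝ) :
    TorusPeriodic (torusConv (sigmaKernel M) W) := fun x₁ x₂ => by
  have hp := torusPeriodic_sigmaKernel M
  have e : ∀ x' : ℝ × ℝ, (∀ y, sigmaKernel M (x' - y) = sigmaKernel M ((x₁, x₂) - y)) →
      torusConv (sigmaKernel M) W x' = torusConv (sigmaKernel M) W (x₁, x₂) := fun x' hx' => by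
    simp only [torusConv, hx']
  refine ⟨e _ fun y => ?_, e _ fun y => ?_⟩
  · refine Eq.trans ?_ (hp (x₁ - y.1) (x₂ - y.2)).1
    congr 1; ext <;> simp; ring
  · refine Eq.trans ?_ (hp (x₁ - y.1) (x₂ - y.2)).2
    congr 1; ext <;> simp; ring

/-! ### Passage to the limit in the transport term -/

/-- The quotients of `U k` are bounded but converge only weakly. The integral splits into three
varying terms and the constant ∫LG. The error Q k − Q₀ multiplies bounded factors. The quotient of U
k − ρ is moved by summation by parts onto `G = Q₀ φ`, whose quotients are bounded, while U k − ρ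
tends to 0. The quotient of ρ converges almost everywhere. The condition `d.1 = 0` matters since
`Q₀` need not be regular in time, and `h` may have either sign so as to cover both upwind quotients.
-/
theorem tendsto_integral_transport {T L : ℝ} {φ : ℝ × ℝ × ℝ → ℝ} (hφ : IsTestFunction T φ)
    {d : ℝ × ℝ × ℝ} (hd1 : d.1 = 0) (hd : ‖d‖ ≤ 1)
    {h : ℕ → ℝ} (hh : ∀ k, h k ≠ 0) (hh0 : Tendsto h atTop (𝓝 0))
    {U : ℕ → ℝ × ℝ × ℝ → ℝ} {ρ : ℝ × ℝ × ℝ → ℝ} {K : ℝ} {C : NNReal}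
    (hU : ∀ k, Measurable (U k)) (hUK : ∀ k z, |U k z| ≤ K) (hUp : ∀ k, IsSpacePeriodic (U k))
    (hUd : ∀ k z, |U k (z + h k • d) - U k z| ≤ K * |h k|)
    (hUρ : TendstoUniformly U ρ atTop) (hρ : LipschitzWith C ρ)
    (hρK : ∀ z, |ρ z| ≤ K) (hρp : IsSpacePeriodic ρ)
    {Q : ℕ → ℝ × ℝ × ℝ → ℝ} {Q₀ : ℝ × ℝ × ℝ → ℝ} {B : ℝ} (hQ : ∀ k, Measurable (Q k))
    (hQB : ∀ k, ∀ z ∈ cylinder T, |Q k z| ≤ B) (hQ₀ : Measurable Q₀) (hQ₀B : ∀ z, |Q₀ z| ≤ B)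
    (hQ₀p : IsSpacePeriodic Q₀) (hQ₀d : ∀ z, ∀ r : ℝ, |Q₀ (z + r • d) - Q₀ z| ≤ B * |r|)
    (hQlim : ∀ z ∈ cylinder T, Tendsto (fun k => Q k z) atTop (𝓝 (Q₀ z))) :
    Tendsto (fun k => ∫ z in cylinder T, Q k z * ((U k (z + h k • d) - U k z) / h k + L) * φ z)
      atTop (𝓝 (∫ z in cylinder T, Q₀ z * (lineDeriv ℝ ρ z d + L) * φ z)) := by
  obtain ⟨δ, hδ, hsupp⟩ := hφ.support
  obtain ⟨Cφ, hC0, hφC, hφd⟩ := hφ.exists_diff_bound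
  have hφm : Measurable φ := hφ.smooth.continuous.measurable
  have hK0 : 0 ≤ K := (abs_nonneg _).trans (hρK 0)
  have hB0 : 0 ≤ B := (abs_nonneg _).trans (hQ₀B 0)
  have hρm : Measurable ρ := hρ.continuous.measurable
  have hD : ∀ k z, |(U k (z + h k • d) - U k z) / h k| ≤ K := fun k z => by
    rw [abs_div, div_le_iff₀ (abs_pos.2 (hh k))]; exact hUd k z
  have hDm : ∀ k, Measurable fun z => (U k (z + h k • d) - U k z) / h k := fun k =>
    (((hU k).comp (measurable_add_const _)).sub (hU k)).div_const _
  -- the coefficient converges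
  have hA : Tendsto (fun k => ∫ z in cylinder T,
      (Q k z - Q₀ z) * ((U k (z + h k • d) - U k z) / h k + L) * φ z) atTop
      (𝓝 (∫ z in cylinder T, (0 : ℝ))) := by
    have hbd : ∀ k z, |((U k (z + h k • d) - U k z) / h k + L) * φ z| ≤ (K + |L|) * Cφ :=
      fun k z => by
        rw [abs_mul]
        exact mul_le_mul ((abs_add_le _ _).trans (add_le_add_left (hD k z) _)) (hφC z)
          (abs_nonneg _) (by positivity)
    refine tendsto_setIntegral_cylinder (C := (B + B) * ((K + |L|) * Cφ))
      (Eventually.of_forall fun k =>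
        (((hQ k).sub hQ₀).mul ((hDm k).add_const L)).mul hφm |>.aestronglyMeasurable)
      (Eventually.of_forall fun k z hz => ?_) (Eventually.of_forall fun z hz => ?_)
    · rw [mul_assoc, abs_mul]
      exact mul_le_mul ((abs_sub _ _).trans (add_le_add (hQB k z hz) (hQ₀B z))) (hbd k z)
        (abs_nonneg _) (by positivity)
    · have h1 : Tendsto (fun k => |Q k z - Q₀ z| * ((K + |L|) * Cφ)) atTop (𝓝 0) := by
        have := ((hQlim z hz).sub_const (Q₀ z)).abs.mul_const ((K + |L|) * Cφ)
        simpa using this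
      refine squeeze_zero_norm (fun k => ?_) h1
      rw [Real.norm_eq_abs, mul_assoc, abs_mul]
      exact mul_le_mul_of_nonneg_left (hbd k z) (abs_nonneg _)
  -- the difference quotients of the test function with weight
  let G : ℝ × ℝ × ℝ → ℝ := fun z => Q₀ z * φ z
  have hGm : Measurable G := hQ₀.mul hφm
  have hGC : ∀ z, |G z| ≤ B * Cφ := fun z => by
    rw [abs_mul]; exact mul_le_mul (hQ₀B z) (hφC z) (abs_nonneg _) hB0
  have hGp : IsSpacePeriodic G := hQ₀p.mul hφ.periodic
  have hGs : ∀ z, G z ≠ 0 → δ ≤ z.1 ∧ z.1 ≤ T - δ := fun z hz =>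
    hsupp z (right_ne_zero_of_mul hz)
  have hsmall : ∀ᶠ k in atTop, |h k| ≤ 1 := by
    have : Tendsto (fun k => |h k|) atTop (𝓝 0) := by simpa using hh0.abs
    exact this.eventually (ge_mem_nhds zero_lt_one)
  have hGd : ∀ᶠ k in atTop, ∀ z ∈ cylinder T, |(G (z - h k • d) - G z) / h k| ≤ 2 * (B * Cφ) := by
    filter_upwards [hsmall] with k hk z hz
    rw [abs_div, div_le_iff₀ (abs_pos.2 (hh k))]
    have hn : ‖-(h k • d)‖ ≤ |h k| := by
      rw [norm_neg, norm_smul, Real.norm_eq_abs]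
      exact mul_le_of_le_one_right (abs_nonneg _) hd
    have e : G (z - h k • d) - G z = Q₀ (z - h k • d) * (φ (z + -(h k • d)) - φ z) +
        (Q₀ (z + (-h k) • d) - Q₀ z) * φ z := by
      simp only [G, neg_smul, ← sub_eq_add_neg]; ring
    rw [e]
    refine (abs_add_le _ _).trans ?_
    rw [abs_mul, abs_mul]
    have h1 : |φ (z + -(h k • d)) - φ z| ≤ Cφ * |h k| :=
      (hφd z hz _ (hn.trans hk)).trans (mul_le_mul_of_nonneg_left hn hC0)
    have h2 := hQ₀d z (-h k)
    rw [abs_neg] at h2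
    calc _ ≤ B * (Cφ * |h k|) + B * |h k| * Cφ := add_le_add
          (mul_le_mul (hQ₀B _) h1 (abs_nonneg _) hB0)
          (mul_le_mul h2 (hφC z) (abs_nonneg _) (by positivity))
      _ = _ := by ring
  have hGqm : ∀ k, Measurable fun z => (G (z - h k • d) - G z) / h k := fun k =>
    ((hGm.comp (measurable_sub_const _)).sub hGm).div_const _
  have hparts : ∀ (k : ℕ) (V : ℝ × ℝ × ℝ → ℝ), Measurable V → (∀ z, |V z| ≤ K) →
      IsSpacePeriodic V → ∫ z in cylinder T, (V (z + h k • d) - V z) / h k * G z =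
        ∫ z in cylinder T, V z * ((G (z - h k • d) - G z) / h k) := fun k V hV hVK hVp => by
    have := setIntegral_diff_mul (T := T) (δ := δ) (d := h k • d) hV hGm hVK hGC hVp hGp hGs
      (by simp [hd1, hδ])
    have e1 : ∀ z, (V (z + h k • d) - V z) / h k * G z =
        (h k)⁻¹ * ((V (z + h k • d) - V z) * G z) := fun z => by ring
    have e2 : ∀ z, V z * ((G (z - h k • d) - G z) / h k) =
        (h k)⁻¹ * (V z * (G (z - h k • d) - G z)) := fun z => by ring
    simp only [e1, e2, integral_const_mul, this]
  have hB' : Tendsto (fun k => ∫ z in cylinder T,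
      (U k z - ρ z) * ((G (z - h k • d) - G z) / h k)) atTop
      (𝓝 (∫ z in cylinder T, (0 : ℝ))) := by
    refine tendsto_setIntegral_cylinder (C := (K + K) * (2 * (B * Cφ)))
      (Eventually.of_forall fun k => (((hU k).sub hρm).mul (hGqm k)).aestronglyMeasurable) ?_
      (Eventually.of_forall fun z hz => ?_)
    · filter_upwards [hGd] with k hk z hz
      rw [abs_mul]
      exact mul_le_mul ((abs_sub _ _).trans (add_le_add (hUK k z) (hρK z))) (hk z hz)
        (abs_nonneg _) (by positivity)
    · have h1 : Tendsto (fun k => |U k z - ρ z| * (2 * (B * Cφ))) atTop (𝓝 0) := by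
        have := ((hUρ.tendsto_at z).sub_const (ρ z)).abs.mul_const (2 * (B * Cφ))
        simpa using this
      refine squeeze_zero_norm' ?_ h1
      filter_upwards [hGd] with k hk
      rw [Real.norm_eq_abs, abs_mul]
      exact mul_le_mul_of_nonneg_left (hk z hz) (abs_nonneg _)
  have hC' : Tendsto (fun k => ∫ z in cylinder T, (ρ (z + h k • d) - ρ z) / h k * G z) atTop
      (𝓝 (∫ z in cylinder T, lineDeriv ℝ ρ z d * G z)) := by
    refine tendsto_setIntegral_cylinder (C := C * (B * Cφ))
      (Eventually.of_forall fun k => ((((hρm.comp (measurable_add_const _)).sub hρm).div_const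
        _).mul hGm).aestronglyMeasurable)
      (Eventually.of_forall fun k z hz => ?_) ?_
    · rw [abs_mul]
      refine mul_le_mul ?_ (hGC z) (abs_nonneg _) C.2
      rw [abs_div, div_le_iff₀ (abs_pos.2 (hh k))]
      have := hρ.dist_le_mul (z + h k • d) z
      rw [Real.dist_eq, dist_eq_norm, add_sub_cancel_left, norm_smul, Real.norm_eq_abs] at this
      refine this.trans (mul_le_mul_of_nonneg_left ?_ C.2)
      exact mul_le_of_le_one_right (abs_nonneg _) hd
    · filter_upwards [hρ.ae_lineDifferentiableAt (μ := volume) d] with z hz _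
      refine Tendsto.mul_const _ ?_
      have h3 := hz.hasLineDerivAt.tendsto_slope_zero.comp (tendsto_nhdsWithin_iff.2
        ⟨hh0, Eventually.of_forall fun n => hh n⟩)
      refine h3.congr fun n => ?_
      simp only [Function.comp, smul_eq_mul]
      rw [div_eq_inv_mul]
  have hlinb : ∀ z, |lineDeriv ℝ ρ z d| ≤ C := fun z => by
    have := norm_lineDeriv_le_of_lipschitz ℝ hρ (x₀ := z) (v := d)
    exact this.trans (mul_le_of_le_one_right C.2 hd)
  have hlinm : Measurable fun z => lineDeriv ℝ ρ z d := measurable_lineDeriv hρ.continuous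
  have iL : IntegrableOn (fun z => L * G z) (cylinder T) :=
    integrableOn_cylinder (C := |L| * (B * Cφ)) (hGm.const_mul L).aestronglyMeasurable
      fun z _ => by rw [abs_mul]; exact mul_le_mul_of_nonneg_left (hGC z) (abs_nonneg _)
  have ilin : IntegrableOn (fun z => lineDeriv ℝ ρ z d * G z) (cylinder T) :=
    integrableOn_cylinder (C := C * (B * Cφ)) (hlinm.mul hGm).aestronglyMeasurable
      fun z _ => by rw [abs_mul]; exact mul_le_mul (hlinb z) (hGC z) (abs_nonneg _) C.2
  have hlimeq : ∫ z in cylinder T, Q₀ z * (lineDeriv ℝ ρ z d + L) * φ z =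
      (∫ z in cylinder T, (0 : ℝ)) + ((∫ z in cylinder T, (0 : ℝ)) +
        ∫ z in cylinder T, lineDeriv ℝ ρ z d * G z) + ∫ z in cylinder T, L * G z := by
    rw [integral_zero, zero_add, zero_add, ← integral_add ilin iL]
    congr 1; ext z; simp only [G]; ring
  rw [hlimeq]
  refine ((hA.add (hB'.add hC')).add tendsto_const_nhds).congr fun k => ?_
  -- A crude bound that depends on k, used only for integrability at fixed k.
  have hΔ : ∀ z, |(G (z - h k • d) - G z) / h k| ≤ (B * Cφ + B * Cφ) / |h k| := fun z => by
    rw [abs_div]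
    exact div_le_div_of_nonneg_right ((abs_sub _ _).trans (add_le_add (hGC _) (hGC _)))
      (abs_nonneg _)
  have iV : ∀ V : ℝ × ℝ × ℝ → ℝ, Measurable V → (∀ z, |V z| ≤ K) →
      IntegrableOn (fun z => V z * ((G (z - h k • d) - G z) / h k)) (cylinder T) :=
    fun V hV hVK => integrableOn_cylinder (hV.mul (hGqm k)).aestronglyMeasurable fun z _ => by
      rw [abs_mul]; exact mul_le_mul (hVK z) (hΔ z) (abs_nonneg _) hK0
  have iD : IntegrableOn (fun z => (U k (z + h k • d) - U k z) / h k * G z) (cylinder T) :=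
    integrableOn_cylinder ((hDm k).mul hGm).aestronglyMeasurable fun z _ => by
      rw [abs_mul]; exact mul_le_mul (hD k z) (hGC z) (abs_nonneg _) hK0
  have iA : IntegrableOn (fun z => (Q k z - Q₀ z) *
      ((U k (z + h k • d) - U k z) / h k + L) * φ z) (cylinder T) :=
    integrableOn_cylinder (C := (B + B) * (K + |L|) * Cφ) (((hQ k).sub hQ₀).mul
      ((hDm k).add_const L) |>.mul hφm).aestronglyMeasurable fun z hz => by
      rw [abs_mul, abs_mul]
      refine mul_le_mul (mul_le_mul ((abs_sub _ _).trans (add_le_add (hQB k z hz) (hQ₀B z)))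
        ((abs_add_le _ _).trans (add_le_add_left (hD k z) _)) (abs_nonneg _) (by positivity))
        (hφC z) (abs_nonneg _) (by positivity)
  have eUρ : (∫ z in cylinder T, (U k z - ρ z) * ((G (z - h k • d) - G z) / h k)) +
      ∫ z in cylinder T, (ρ (z + h k • d) - ρ z) / h k * G z =
      ∫ z in cylinder T, (U k (z + h k • d) - U k z) / h k * G z := by
    rw [hparts k (U k) (hU k) (hUK k) (hUp k), hparts k ρ hρm hρK hρp]
    simp only [sub_mul]
    rw [integral_sub (iV _ (hU k) (hUK k)) (iV _ hρm hρK), sub_add_cancel]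
  rw [eUρ, ← integral_add iA iD, ← integral_add (by exact iA.add iD) iL]
  congr 1; ext z; simp only [G]; ring

/-! ### The limit equation -/

section Limit

variable {N : ℕ} [NeZero N] {dt K L : ℝ}

theorem gridStep_add_x1 (w : ℕ → ZMod N → ZMod N → ℝ) (z : ℝ × ℝ × ℝ) :
    gridStep N dt w (z + spaceStep N • (0, 1, 0)) = w ⌊z.1 / dt⌋.toNat
      ((⌊z.2.1 / spaceStep N⌋ : ZMod N) + 1) (⌊z.2.2 / spaceStep N⌋ : ZMod N) := by
  have hh := (spaceStep_pos N).ne'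
  simp [gridStep, add_div, div_self hh]

theorem gridStep_sub_x1 (w : ℕ → ZMod N → ZMod N → ℝ) (z : ℝ × ℝ × ℝ) :
    gridStep N dt w (z + (-spaceStep N) • (0, 1, 0)) = w ⌊z.1 / dt⌋.toNat
      ((⌊z.2.1 / spaceStep N⌋ : ZMod N) - 1) (⌊z.2.2 / spaceStep N⌋ : ZMod N) := by
  have hh := (spaceStep_pos N).ne'
  simp [gridStep, ← sub_eq_add_neg, sub_div, div_self hh]

omit [NeZero N] in
theorem gridStep_add_t (hdt : 0 < dt) (w : ℕ → ZMod N → ZMod N → ℝ) {z : ℝ × ℝ × ℝ}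
    (hz : 0 ≤ z.1) : gridStep N dt w (z + dt • (1, 0, 0)) = w (⌊z.1 / dt⌋.toNat + 1)
      (⌊z.2.1 / spaceStep N⌋ : ZMod N) (⌊z.2.2 / spaceStep N⌋ : ZMod N) := by
  have h3 : 0 ≤ ⌊z.1 / dt⌋ := Int.floor_nonneg.2 (div_nonneg hz hdt.le)
  simp only [gridStep, Prod.smul_mk, smul_eq_mul, mul_one, mul_zero, Prod.fst_add, Prod.snd_add,
    add_zero, add_div, div_self hdt.ne', Int.floor_add_one]
  rw [show (⌊z.1 / dt⌋ + 1).toNat = ⌊z.1 / dt⌋.toNat + 1 by omega]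

/-- The velocity of the scheme as a step function. -/
noncomputable def stepVelocity (M N : ℕ) [NeZero N] (a : ℝ → ℝ) (dt : ℝ)
    (w : ℤˣ → ℕ → ZMod N → ZMod N → ℝ) (s : ℤˣ) (z : ℝ × ℝ × ℝ) : ℝ :=
  pairVelocity M (a (((⌊z.1 / dt⌋.toNat : ℝ) + 1) * dt)) (fun s => w s (⌊z.1 / dt⌋.toNat + 1)) s
    (⌊z.2.1 / spaceStep N⌋ : ZMod N) (⌊z.2.2 / spaceStep N⌋ : ZMod N)

theorem measurable_stepVelocity (M : ℕ) (a : ℝ → ℝ) (dt : ℝ)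
    (w : ℤˣ → ℕ → ZMod N → ZMod N → ℝ) (s : ℤˣ) : Measurable (stepVelocity M N a dt w s) :=
  measurable_floor_comp fun n i j => pairVelocity M (a (((n.toNat : ℝ) + 1) * dt))
    (fun s => w s (n.toNat + 1)) s (i : ZMod N) (j : ZMod N)

/-- The scheme holds pointwise as an identity between translates of step functions. The backward
quotient is written with the step −Δx, so that one limit lemma handles both upwind terms. -/
theorem gridStep_scheme {M : ℕ} {a : ℝ → ℝ} (hdt : 0 < dt) {w : ℤˣ → ℕ → ZMod N → ZMod N → ℝ}
    {z : ℝ × ℝ × ℝ} (hz : 0 ≤ z.1)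
    (hstep : stepMap M L dt (a (((⌊z.1 / dt⌋.toNat : ℝ) + 1) * dt))
      (fun s => w s ⌊z.1 / dt⌋.toNat) (fun s => w s (⌊z.1 / dt⌋.toNat + 1)) =
        fun s => w s (⌊z.1 / dt⌋.toNat + 1)) (s : ℤˣ) :
    (gridStep N dt (w s) (z + dt • (1, 0, 0)) - gridStep N dt (w s) z) / dt =
      max (stepVelocity M N a dt w s z) 0 *
        ((gridStep N dt (w s) (z + spaceStep N • (0, 1, 0)) - gridStep N dt (w s) z) /
          spaceStep N + L) -
      max (-stepVelocity M N a dt w s z) 0 *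
        ((gridStep N dt (w s) (z + (-spaceStep N) • (0, 1, 0)) - gridStep N dt (w s) z) /
          (-spaceStep N) + L) := by
  have h := step_apply hstep s (⌊z.2.1 / spaceStep N⌋ : ZMod N) (⌊z.2.2 / spaceStep N⌋ : ZMod N)
  rw [gridStep_add_t hdt _ hz, gridStep_add_x1, gridStep_sub_x1, div_eq_iff hdt.ne', gridStep, h]
  unfold upwindFlux discDerivX1 stepVelocity
  rw [sub_add_cancel]
  ring

end Limit

theorem floor_lt_of_mem_Ioo {T : ℝ} (hT : 0 < T) {NT : ℕ} (hNT : 0 < NT) {t : ℝ}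
    (ht : t ∈ Ioo 0 T) : ⌊t / timeStep T NT⌋.toNat < NT := by
  have hdt := timeStep_pos hT hNT
  have h1 : ⌊t / timeStep T NT⌋ < NT := by
    rw [Int.floor_lt, div_lt_iff₀ hdt, Int.cast_natCast, natCast_mul_timeStep hNT]
    exact ht.2
  omega

theorem tendsto_forcing {T : ℝ} (hT : 0 < T) {a : ℝ → ℝ} (ha : ContinuousOn a (Ioc 0 T))
    {NT : ℕ → ℕ} (hNT : ∀ k, 0 < NT k) (hdt0 : Tendsto (fun k => timeStep T (NT k)) atTop (𝓝 0))
    {t : ℝ} (ht : t ∈ Ioo 0 T) :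
    Tendsto (fun k => a (((⌊t / timeStep T (NT k)⌋.toNat : ℝ) + 1) * timeStep T (NT k))) atTop
      (𝓝 (a t)) := by
  refine (ha t ⟨ht.1, ht.2.le⟩).tendsto.comp (tendsto_nhdsWithin_iff.2
    ⟨?_, Eventually.of_forall fun k => time_mem_Ioc hT (hNT k) (floor_lt_of_mem_Ioo hT (hNT k) ht)⟩)
  have h1 := (tendsto_floor_mul (fun k => timeStep_pos hT (hNT k)) hdt0 t).add hdt0
  rw [add_zero] at h1
  refine h1.congr fun k => ?_
  have h3 : 0 ≤ ⌊t / timeStep T (NT k)⌋ :=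
    Int.floor_nonneg.2 (div_nonneg ht.1.le (timeStep_pos hT (hNT k)).le)
  have h4 : ((⌊t / timeStep T (NT k)⌋.toNat : ℕ) : ℝ) = ⌊t / timeStep T (NT k)⌋ := by
    exact_mod_cast Int.toNat_of_nonneg h3
  rw [h4]; ring

/-- The limit of the scheme solves the transport equation in the sense of distributions. -/
theorem hasWeakDeriv_time_of_tendsto {M : ℕ} (hM : 1 ≤ M) {L T : ℝ} (hT : 0 < T) {a : ℝ → ℝ}
    (ha : ContinuousOn a (Ioc 0 T)) (hb : MemLp a ⊤ (volume.restrict (Ioo 0 T)))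
    {N NT : ℕ → ℕ} [∀ k, NeZero (N k)] (hNT : ∀ k, 0 < NT k)
    (hdt0 : Tendsto (fun k => timeStep T (NT k)) atTop (𝓝 0))
    (hh0 : Tendsto (fun k => spaceStep (N k)) atTop (𝓝 0)) {K : ℝ}
    {w : ∀ k, ℤˣ → ℕ → ZMod (N k) → ZMod (N k) → ℝ}
    (hw : ∀ k s, GridBounds (N k) (timeStep T (NT k)) K (w k s))
    (hstep : ∀ k n, n < NT k → stepMap M L (timeStep T (NT k))
      (a (((n : ℝ) + 1) * timeStep T (NT k))) (fun s => w k s n) (fun s => w k s (n + 1)) =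
        fun s => w k s (n + 1))
    {ρ : ℤˣ → ℝ × ℝ × ℝ → ℝ} {C : NNReal} (hρ : ∀ s, LipschitzWith C (ρ s))
    (hρK : ∀ s z, |ρ s z| ≤ K) (hρp : ∀ s, IsSpacePeriodic (ρ s))
    (hlim : ∀ s, TendstoUniformly (fun k => gridStep (N k) (timeStep T (NT k)) (w k s)) (ρ s)
      atTop) (s : ℤˣ) :
    HasWeakDeriv T (ρ s) (fun z => -(sgnVal s) * velocity M a ρ z *
      (lineDeriv ℝ (ρ s) z (0, 1, 0) + L)) (1, 0, 0) := by
  intro φ hφ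
  obtain ⟨δ, hδ, hsupp⟩ := hφ.support
  obtain ⟨Cφ, hC0, hφC, -⟩ := hφ.exists_diff_bound
  have hφm : Measurable φ := hφ.smooth.continuous.measurable
  have hK0 : 0 ≤ K := (abs_nonneg _).trans (hρK 1 0)
  have hdt : ∀ k, 0 < timeStep T (NT k) := fun k => timeStep_pos hT (hNT k)
  have hh : ∀ k, 0 < spaceStep (N k) := fun k => spaceStep_pos (N k)
  let W : ℝ × ℝ × ℝ → ℝ := fun z => ρ 1 z - ρ (-1) z
  have hWc : Continuous W := (hρ 1).continuous.sub (hρ (-1)).continuous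
  have hlip : ∀ s z z', |ρ s z - ρ s z'| ≤ C * ‖z - z'‖ := fun s z z' => by
    rw [← Real.dist_eq, ← dist_eq_norm]; exact (hρ s).dist_le_mul z z'
  have hWlip : ∀ z z', |W z - W z'| ≤ (C + C) * ‖z - z'‖ := fun z z' => by
    rw [show W z - W z' = (ρ 1 z - ρ 1 z') - (ρ (-1) z - ρ (-1) z') by simp only [W]; ring, add_mul]
    exact (abs_sub _ _).trans (add_le_add (hlip 1 z z') (hlip (-1) z z'))
  have hWK : ∀ z, |W z| ≤ K + K := fun z =>
    (abs_sub _ _).trans (add_le_add (hρK 1 z) (hρK (-1) z))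
  obtain ⟨C', hC'0, hconvB, hconvL⟩ := exists_lipschitz_torusConv M (by positivity) hWlip hWc hWK
  let conv : ℝ × ℝ × ℝ → ℝ := fun z => torusConv (sigmaKernel M) (fun y => W (z.1, y)) z.2
  have hconvc : Continuous conv :=
    (LipschitzWith.of_dist_le_mul (K := ⟨C', hC'0⟩) fun z z' => by
      rw [Real.dist_eq, dist_eq_norm]; exact hconvL z z').continuous
  -- The cut-off forcing is measurable and bounded on the whole line and agrees with `a` on the
  -- cylinder.
  let a' : ℝ → ℝ := (Ioo 0 T).indicator a
  have ha'm : Measurable a' := by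
    have : Measurable ((Ioo 0 T).piecewise a 0) :=
      (ha.mono Ioo_subset_Ioc_self).measurable_piecewise continuousOn_const measurableSet_Ioo
    rwa [piecewise_eq_indicator] at this
  set A := supNormOn T a
  have hA0 : 0 ≤ A := ENNReal.toReal_nonneg
  have ha'A : ∀ t, |a' t| ≤ A := fun t => by
    by_cases ht : t ∈ Ioo 0 T
    · simp only [a', indicator_of_mem ht]
      exact abs_le_supNormOn ha hb ⟨ht.1, ht.2.le⟩
    · simp only [a', indicator_of_notMem ht, abs_zero]; exact hA0
  let lam : ℕ → ℝ × ℝ × ℝ → ℝ := fun k => stepVelocity M (N k) a (timeStep T (NT k)) (w k) s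
  let lam₀ : ℝ × ℝ × ℝ → ℝ := fun z => -(sgnVal s) * (a' z.1 + conv z)
  have hlamm : ∀ k, Measurable (lam k) := fun k => measurable_stepVelocity _ _ _ _ _
  have hlam₀m : Measurable lam₀ :=
    ((ha'm.comp measurable_fst).add hconvc.measurable).const_mul _
  -- The middle term bounds the discrete convolution; the last one bounds the limit convolution and
  -- its Lipschitz constant.
  set B := A + (M : ℝ) ^ 2 * (K + K) + C'
  have habs : ∀ x, |-(sgnVal s) * x| = |x| := fun x => by
    rw [abs_mul, abs_neg, abs_sgnVal, one_mul]
  have hlamB : ∀ k, ∀ z ∈ cylinder T, |lam k z| ≤ B := fun k z hz => by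
    simp only [lam, stepVelocity, pairVelocity, discVelocity_eq, habs]
    have h1 := abs_le_supNormOn ha hb (time_mem_Ioc hT (hNT k)
      (floor_lt_of_mem_Ioo hT (hNT k) hz.1))
    have h2 := abs_gridConv_le (abs_gridSigma_le (N := N k) hM)
      (w := fun i j => w k 1 (⌊z.1 / timeStep T (NT k)⌋.toNat + 1) i j -
        w k (-1) (⌊z.1 / timeStep T (NT k)⌋.toNat + 1) i j) (W := K + K)
      (fun i j => (abs_sub _ _).trans (add_le_add ((hw k 1).bound _ _ _) ((hw k (-1)).bound _ _ _)))
      (⌊z.2.1 / spaceStep (N k)⌋ : ZMod (N k)) (⌊z.2.2 / spaceStep (N k)⌋ : ZMod (N k))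
    exact (abs_add_le _ _).trans ((add_le_add h1 h2).trans (le_add_of_nonneg_right hC'0))
  have hlam₀B : ∀ z, |lam₀ z| ≤ B := fun z => by
    simp only [lam₀, habs]
    refine (abs_add_le _ _).trans ((add_le_add (ha'A _) (hconvB z)).trans ?_)
    have : 0 ≤ (M : ℝ) ^ 2 * (K + K) := by positivity
    simp only [B]; linarith
  have hlam₀p : IsSpacePeriodic lam₀ := fun t x₁ x₂ => by
    have := torusPeriodic_torusConv M (fun y => W (t, y)) x₁ x₂
    simp only [lam₀, conv, this.1, this.2, and_self]
  have hlam₀d : ∀ z, ∀ r : ℝ, |lam₀ (z + r • (0, 1, 0)) - lam₀ z| ≤ B * |r| := fun z r => by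
    have h1 := hconvL (z + r • (0, 1, 0)) z
    rw [add_sub_cancel_left, norm_smul] at h1
    have h2 : ‖((0 : ℝ), (1 : ℝ), (0 : ℝ))‖ = 1 := by simp [Prod.norm_def]
    rw [h2, mul_one, Real.norm_eq_abs] at h1
    -- The forcing cancels, so no regularity of `a` in time is required.
    have e : lam₀ (z + r • (0, 1, 0)) - lam₀ z =
        -(sgnVal s) * (conv (z + r • (0, 1, 0)) - conv z) := by
      simp only [lam₀, Prod.fst_add, Prod.smul_fst, smul_zero, add_zero]; ring
    rw [e, habs]
    refine h1.trans (mul_le_mul_of_nonneg_right ?_ (abs_nonneg _))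
    have : 0 ≤ (M : ℝ) ^ 2 * (K + K) := by positivity
    simp only [B]; linarith
  have hlamlim : ∀ z ∈ cylinder T, Tendsto (fun k => lam k z) atTop (𝓝 (lam₀ z)) := fun z hz => by
    simp only [lam, stepVelocity, pairVelocity, discVelocity_eq]
    refine Tendsto.const_mul _ (Tendsto.add ?_ ?_)
    · simp only [a', indicator_of_mem hz.1]
      exact tendsto_forcing hT ha hNT hdt0 hz.1
    · exact tendsto_gridConv M hdt hdt0 hh0
        (w := fun k n i j => w k 1 n i j - w k (-1) n i j) (K := K + K)
        (fun k n i j => (abs_sub _ _).trans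
          (add_le_add ((hw k 1).bound _ _ _) ((hw k (-1)).bound _ _ _))) hWc
        ((hlim 1).sub (hlim (-1))) hz.1.1.le z.2
  let U : ℕ → ℝ × ℝ × ℝ → ℝ := fun k => gridStep (N k) (timeStep T (NT k)) (w k s)
  have hUm : ∀ k, Measurable (U k) := fun k => measurable_gridStep _ _ _
  have hUK : ∀ k z, |U k z| ≤ K := fun k z => (hw k s).abs_gridStep_le z
  have hUp : ∀ k, IsSpacePeriodic (U k) := fun k => isSpacePeriodic_gridStep
  have hUd₁ : ∀ k z, |U k (z + spaceStep (N k) • (0, 1, 0)) - U k z| ≤ K * |spaceStep (N k)| :=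
    fun k z => by
      simp only [U, gridStep_add_x1, abs_of_pos (hh k)]
      exact (hw k s).diff_x1 _ _ _
  have hUd₂ : ∀ k z, |U k (z + (-spaceStep (N k)) • (0, 1, 0)) - U k z| ≤
      K * |-spaceStep (N k)| := fun k z => by
    rw [abs_neg, abs_of_pos (hh k), abs_sub_comm]
    simp only [U, gridStep_sub_x1]
    have := (hw k s).diff_x1 ⌊z.1 / timeStep T (NT k)⌋.toNat
      ((⌊z.2.1 / spaceStep (N k)⌋ : ZMod (N k)) - 1) (⌊z.2.2 / spaceStep (N k)⌋ : ZMod (N k))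
    rwa [sub_add_cancel] at this
  have hnorm : ‖((0 : ℝ), (1 : ℝ), (0 : ℝ))‖ ≤ 1 := by simp [Prod.norm_def]
  have hmax : ∀ x b : ℝ, |x| ≤ b → |max x 0| ≤ b := fun x b hx => by
    rw [abs_of_nonneg (le_max_right _ _)]
    exact max_le ((le_abs_self x).trans hx) ((abs_nonneg x).trans hx)
  have hmaxd : ∀ x y : ℝ, |max x 0 - max y 0| ≤ |x - y| := fun x y =>
    abs_max_sub_max_le_abs x y 0
  have hpos := tendsto_integral_transport (L := L) hφ (d := (0, 1, 0)) rfl hnorm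
    (fun k => (hh k).ne') hh0 hUm hUK hUp hUd₁ (hlim s) (hρ s) (hρK s) (hρp s)
    (Q := fun k z => max (lam k z) 0) (Q₀ := fun z => max (lam₀ z) 0) (B := B)
    (fun k => (hlamm k).max measurable_const) (fun k z hz => hmax _ _ (hlamB k z hz))
    (hlam₀m.max measurable_const) (fun z => hmax _ _ (hlam₀B z))
    (fun t x₁ x₂ => by simp only [(hlam₀p t x₁ x₂).1, (hlam₀p t x₁ x₂).2, and_self])
    (fun z r => (hmaxd _ _).trans (hlam₀d z r))
    (fun z hz => (hlamlim z hz).max tendsto_const_nhds)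
  have hneg := tendsto_integral_transport (L := L) hφ (d := (0, 1, 0)) rfl hnorm
    (fun k => neg_ne_zero.2 (hh k).ne') (by simpa using hh0.neg) hUm hUK hUp hUd₂ (hlim s) (hρ s)
    (hρK s) (hρp s)
    (Q := fun k z => max (-lam k z) 0) (Q₀ := fun z => max (-lam₀ z) 0) (B := B)
    (fun k => (hlamm k).neg.max measurable_const)
    (fun k z hz => hmax _ _ ((abs_neg _).trans_le (hlamB k z hz)))
    (hlam₀m.neg.max measurable_const) (fun z => hmax _ _ ((abs_neg _).trans_le (hlam₀B z)))
    (fun t x₁ x₂ => by simp only [(hlam₀p t x₁ x₂).1, (hlam₀p t x₁ x₂).2, and_self])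
    (fun z r => (hmaxd _ _).trans (by
      rw [neg_sub_neg, abs_sub_comm]; exact hlam₀d z r))
    (fun z hz => (hlamlim z hz).neg.max tendsto_const_nhds)
  have htime := hφ.tendsto_integral_quotient (T := T) (1, 0, 0)
    (h := fun k => -timeStep T (NT k)) (fun k => neg_ne_zero.2 (hdt k).ne')
    (by simpa using hdt0.neg) hUm hUK fun z => (hlim s).tendsto_at z
  -- Summation by parts in time, valid once Δt is below the distance `δ` of the support of `φ` from
  -- the times 0 and T.
  have hev : ∀ᶠ k in atTop, -∫ z in cylinder T, U k z * ((φ (z + (-timeStep T (NT k)) • (1, 0, 0)) -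
      φ z) / (-timeStep T (NT k))) =
      (∫ z in cylinder T, max (lam k z) 0 * ((U k (z + spaceStep (N k) • (0, 1, 0)) - U k z) /
        spaceStep (N k) + L) * φ z) -
      ∫ z in cylinder T, max (-lam k z) 0 * ((U k (z + (-spaceStep (N k)) • (0, 1, 0)) - U k z) /
        (-spaceStep (N k)) + L) * φ z := by
    filter_upwards [hdt0.eventually (gt_mem_nhds hδ)] with k hk
    have hparts := setIntegral_diff_mul (T := T) (δ := δ) (d := timeStep T (NT k) • (1, 0, 0))
      (hUm k) hφm (hUK k) hφC (hUp k) hφ.periodic hsupp (by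
        simpa [abs_of_pos (hdt k)] using hk)
    have e1 : ∀ z, U k z * ((φ (z + (-timeStep T (NT k)) • (1, 0, 0)) - φ z) /
        (-timeStep T (NT k))) = -(timeStep T (NT k))⁻¹ *
          (U k z * (φ (z - timeStep T (NT k) • (1, 0, 0)) - φ z)) := fun z => by
      rw [neg_smul, ← sub_eq_add_neg, div_neg]; ring
    have hint : ∀ (Q : ℝ × ℝ × ℝ → ℝ) (r : ℝ), r ≠ 0 → Measurable Q →
        (∀ z ∈ cylinder T, |Q z| ≤ B) → (∀ z, |U k (z + r • (0, 1, 0)) - U k z| ≤ K * |r|) →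
        IntegrableOn (fun z => Q z * ((U k (z + r • (0, 1, 0)) - U k z) / r + L) * φ z)
          (cylinder T) := fun Q r hr hQ hQB hUr =>
      integrableOn_cylinder (C := B * (K + |L|) * Cφ) ((hQ.mul
        (((((hUm k).comp (measurable_add_const _)).sub (hUm k)).div_const _).add_const L)).mul
          hφm).aestronglyMeasurable fun z hz => by
        have hB0 : 0 ≤ B := (abs_nonneg _).trans (hQB z hz)
        rw [abs_mul, abs_mul]
        refine mul_le_mul (mul_le_mul (hQB z hz) ((abs_add_le _ _).trans
          (add_le_add_left ?_ _)) (abs_nonneg _) hB0) (hφC z) (abs_nonneg _) (by positivity)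
        rw [abs_div, div_le_iff₀ (abs_pos.2 hr)]; exact hUr z
    simp only [e1, integral_const_mul]
    rw [← hparts, neg_mul, neg_neg, ← integral_const_mul, ← integral_sub
      (hint (fun z => max (lam k z) 0) _ (hh k).ne' ((hlamm k).max measurable_const)
        (fun z hz => hmax _ _ (hlamB k z hz)) (hUd₁ k))
      (hint (fun z => max (-lam k z) 0) _ (neg_ne_zero.2 (hh k).ne') ((hlamm k).neg.max measurable_const)
        (fun z hz => hmax _ _ ((abs_neg _).trans_le (hlamB k z hz))) (hUd₂ k))]
    refine setIntegral_congr_fun (measurableSet_cylinder T) fun z hz => ?_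
    have h1 := gridStep_scheme (hdt k) hz.1.1.le
      (hstep k _ (floor_lt_of_mem_Ioo hT (hNT k) hz.1)) s
    simp only [U, lam]
    rw [← sub_mul, ← h1]
    ring
  have hfinal := tendsto_nhds_unique (htime.neg.congr' hev) (hpos.sub hneg)
  have hlinm : Measurable fun z => lineDeriv ℝ (ρ s) z (0, 1, 0) :=
    measurable_lineDeriv (hρ s).continuous
  have hint₀ : ∀ Q : ℝ × ℝ × ℝ → ℝ, Measurable Q → (∀ z, |Q z| ≤ B) →
      IntegrableOn (fun z => Q z * (lineDeriv ℝ (ρ s) z (0, 1, 0) + L) * φ z) (cylinder T) :=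
    fun Q hQ hQB => integrableOn_cylinder (C := B * (C + |L|) * Cφ)
      ((hQ.mul (hlinm.add_const L)).mul hφm).aestronglyMeasurable fun z _ => by
        have hB0 : 0 ≤ B := (abs_nonneg _).trans (hQB z)
        rw [abs_mul, abs_mul]
        refine mul_le_mul (mul_le_mul (hQB z) ((abs_add_le _ _).trans
          (add_le_add_left ?_ _)) (abs_nonneg _) hB0) (hφC z) (abs_nonneg _) (by positivity)
        have := norm_lineDeriv_le_of_lipschitz ℝ (hρ s) (x₀ := z) (v := (0, 1, 0))
        exact this.trans (mul_le_of_le_one_right C.2 hnorm)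
  rw [← integral_sub (hint₀ (fun z => max (lam₀ z) 0) (hlam₀m.max measurable_const) fun z => hmax _ _ (hlam₀B z))
    (hint₀ (fun z => max (-lam₀ z) 0) (hlam₀m.neg.max measurable_const)
      fun z => hmax _ _ ((abs_neg _).trans_le (hlam₀B z)))] at hfinal
  rw [← neg_eq_iff_eq_neg, hfinal]
  refine setIntegral_congr_fun (measurableSet_cylinder T) fun z hz => ?_
  have h1 : lam₀ z = -(sgnVal s) * velocity M a ρ z := by
    simp only [lam₀, a', indicator_of_mem hz.1, velocity, conv, W]; ring
  simp only
  rw [← sub_mul, ← sub_mul, max_zero_sub_max_neg_zero, h1]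

/-! ### Convergence -/

theorem memLInfty_lineDeriv {T : ℝ} {f : ℝ × ℝ × ℝ → ℝ} {C : NNReal} (hf : LipschitzWith C f)
    (d : ℝ × ℝ × ℝ) : MemLInfty T fun z => lineDeriv ℝ f z d :=
  memLp_top_of_bound (measurable_lineDeriv hf.continuous).aestronglyMeasurable (C * ‖d‖)
    (Eventually.of_forall fun _ => norm_lineDeriv_le_of_lipschitz ℝ hf)

theorem memW1Infty_of_lipschitz {T : ℝ} {f : ℝ × ℝ × ℝ → ℝ} {C : NNReal} {K : ℝ}
    (hf : LipschitzWith C f) (hper : IsSpacePeriodic f) (hK : ∀ z, |f z| ≤ K) :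
    MemW1Infty T f where
  periodic := hper
  bounded := memLp_top_of_bound hf.continuous.aestronglyMeasurable K (Eventually.of_forall hK)
  deriv_t := ⟨_, memLInfty_lineDeriv hf _, hasWeakDeriv_lineDeriv hf hper hK _⟩
  deriv_x1 := ⟨_, memLInfty_lineDeriv hf _, hasWeakDeriv_lineDeriv hf hper hK _⟩
  deriv_x2 := ⟨_, memLInfty_lineDeriv hf _, hasWeakDeriv_lineDeriv hf hper hK _⟩

theorem gridStep_zero_of_initial {M N NT : ℕ} [NeZero N] {L T dt : ℝ} {a : ℝ → ℝ}
    {ρ₀ : ℤˣ → ℝ × ℝ → ℝ} {u : ℤˣ → ℕ → ZMod N → ZMod N → ℝ}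
    (hu : IsSchemeSolution M L T a ρ₀ N NT u) (s : ℤˣ) (x : ℝ × ℝ) :
    gridStep N dt (fun n => u s (min n NT)) (0, x) = regInitial M L (ρ₀ s)
      (⌊x.1 / spaceStep N⌋ * spaceStep N, ⌊x.2 / spaceStep N⌋ * spaceStep N) := by
  have hp := torusPeriodic_regInitial (L := L) (ρ₀ := ρ₀ s) M
  simp only [gridStep, zero_div, Int.floor_zero, Int.toNat_zero, Nat.zero_min, hu.initial]
  rw [periodic_gridPt_intCast (f := fun y => regInitial M L (ρ₀ s) (y, _))
    (fun y => (hp y _).1), periodic_gridPt_intCast (f := fun y => regInitial M L (ρ₀ s) (_, y))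
    (fun y => (hp _ y).2)]

theorem theorem2 (M : ℕ) (hM : 1 ≤ M) (L T : ℝ) (hL : 0 < L) (hT : 0 < T)
    (a : ℝ → ℝ) (ha : ContinuousOn a (Ioc 0 T)) (ha_bdd : MemLp a ⊤ (volume.restrict (Ioo 0 T)))
    (ρ₀ : ℤˣ → ℝ × ℝ → ℝ) (hρ₀ : ∀ s, IsInitialDatum L (ρ₀ s))
    (N NT : ℕ → ℕ) [∀ m, NeZero (N m)] (hNT : ∀ m, 0 < NT m) (hMN : ∀ m, M ≤ N m)
    (hCFL : ∀ m, CFL M L T a (timeStep T (NT m)) (spaceStep (N m)))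
    (hmesh : Tendsto (fun m => max (timeStep T (NT m)) (spaceStep (N m))) atTop (𝓝 0)) :
    (∀ m, (∃ u, IsSchemeSolution M L T a ρ₀ (N m) (NT m) u) ∧
      ∀ u v, IsSchemeSolution M L T a ρ₀ (N m) (NT m) u →
        IsSchemeSolution M L T a ρ₀ (N m) (NT m) v → ∀ s, ∀ n ≤ NT m, u s n = v s n) ∧
    ∀ u : (m : ℕ) → ℤˣ → ℕ → ZMod (N m) → ZMod (N m) → ℝ,
      (∀ m, IsSchemeSolution M L T a ρ₀ (N m) (NT m) (u m)) →
      ∃ (κ : ℕ → ℕ) (ρ : ℤˣ → ℝ × ℝ × ℝ → ℝ), StrictMono κ ∧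
        (∀ s, MemW1Infty T (ρ s)) ∧
        (∀ s, ContinuousOn (ρ s) (Icc 0 T ×ˢ univ)) ∧
        (∀ s, TendstoUniformlyOn
          (fun k => reconstruct T (N (κ k)) (NT (κ k)) (u (κ k) s)) (ρ s) atTop
          (Icc 0 T ×ˢ univ)) ∧
        IsDistributionalSolution M L T a ρ₀ ρ := by
  refine ⟨fun m => ⟨exists_isSchemeSolution hM hL hT ha ha_bdd hρ₀ (hNT m) (hMN m) (hCFL m),
    fun u v hu hv s n hn => congrFun (IsSchemeSolution.unique hM hL hT ha ha_bdd hρ₀ (hNT m)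
      (hMN m) (hCFL m) hu hv n hn) s⟩, fun u hu => ?_⟩
  obtain ⟨K, hK, hbounds⟩ := exists_gridBounds hM hL hT ha ha_bdd hρ₀
  -- A solution is unconstrained beyond the index `NT m`, so it is frozen there before uniform
  -- bounds are claimed.
  let w : ∀ m, ℤˣ → ℕ → ZMod (N m) → ZMod (N m) → ℝ := fun m s n => u m s (min n (NT m))
  have hw : ∀ m s, GridBounds (N m) (timeStep T (NT m)) K (w m s) := fun m =>
    hbounds (N m) (NT m) (hNT m) (hMN m) (hCFL m) (u m) (hu m)
  have hdt : ∀ m, 0 < timeStep T (NT m) := fun m => timeStep_pos hT (hNT m)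
  have hh : ∀ m, 0 < spaceStep (N m) := fun m => spaceStep_pos (N m)
  let R : ℕ → ℤˣ → ℝ × ℝ × ℝ → ℝ := fun m s => gridInterp (N m) (timeStep T (NT m)) (w m s)
  have hRlip : ∀ m s z z', |R m s z - R m s z'| ≤ 3 * K * ‖z - z'‖ := fun m s =>
    (hw m s).abs_gridInterp_sub_le hK (hdt m)
  have hRK : ∀ m s z, |R m s z| ≤ K := fun m s => (hw m s).abs_gridInterp_le
  have hRp : ∀ m s, IsSpacePeriodic (R m s) := fun m s => isSpacePeriodic_gridInterp
  obtain ⟨κ, ρ, hκ, hρlim⟩ := exists_subseq_tendstoUniformly hT.le hRp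
    (fun m s t x => gridInterp_eq_clamp hT (hNT m) t x) hRlip hRK
  have hmeshκ := hmesh.comp hκ.tendsto_atTop
  have hdt0 : Tendsto (fun k => timeStep T (NT (κ k))) atTop (𝓝 0) :=
    squeeze_zero (fun k => (hdt _).le) (fun k => le_max_left _ _) hmeshκ
  have hh0 : Tendsto (fun k => spaceStep (N (κ k))) atTop (𝓝 0) :=
    squeeze_zero (fun k => (hh _).le) (fun k => le_max_right _ _) hmeshκ
  have hpt : ∀ s z, Tendsto (fun k => R (κ k) s z) atTop (𝓝 (ρ s z)) := fun s z =>
    (hρlim s).tendsto_at z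
  have hρlip : ∀ s, LipschitzWith ⟨3 * K, by positivity⟩ (ρ s) := fun s =>
    LipschitzWith.of_dist_le_mul fun z z' => by
      rw [Real.dist_eq, dist_eq_norm]
      exact le_of_tendsto ((hpt s z).sub (hpt s z')).abs (Eventually.of_forall fun k =>
        hRlip (κ k) s z z')
  have hρK : ∀ s z, |ρ s z| ≤ K := fun s z =>
    le_of_tendsto (hpt s z).abs (Eventually.of_forall fun k => hRK (κ k) s z)
  have hρp : ∀ s, IsSpacePeriodic (ρ s) := fun s t x₁ x₂ =>
    ⟨tendsto_nhds_unique (hpt s _) ((hpt s (t, x₁, x₂)).congr fun k =>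
      ((hRp (κ k) s t x₁ x₂).1).symm),
    tendsto_nhds_unique (hpt s _) ((hpt s (t, x₁, x₂)).congr fun k =>
      ((hRp (κ k) s t x₁ x₂).2).symm)⟩
  have hstepLim : ∀ s, TendstoUniformly
      (fun k => gridStep (N (κ k)) (timeStep T (NT (κ k))) (w (κ k) s)) (ρ s) atTop := fun s => by
    rw [Metric.tendstoUniformly_iff]
    intro ε hε
    have h3 : Tendsto (fun k => 3 * K * max (timeStep T (NT (κ k))) (spaceStep (N (κ k)))) atTop
        (𝓝 0) := by simpa using hmeshκ.const_mul (3 * K)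
    filter_upwards [Metric.tendstoUniformly_iff.1 (hρlim s) (ε / 2) (half_pos hε),
      h3.eventually (gt_mem_nhds (half_pos hε))] with k h1 h2 z
    have h4 := (hw (κ k) s).abs_gridInterp_sub_gridStep_le hK (hdt _) z
    rw [← Real.dist_eq] at h4
    exact (dist_triangle _ _ _).trans_lt
      ((add_lt_add (h1 z) (h4.trans_lt h2)).trans_eq (add_halves ε))
  refine ⟨κ, ρ, hκ, fun s => memW1Infty_of_lipschitz (hρlip s) (hρp s) (hρK s),
    fun s => (hρlip s).continuous.continuousOn, fun s => ?_, fun s => ⟨⟨fun z =>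
      lineDeriv ℝ (ρ s) z (0, 1, 0), memLInfty_lineDeriv (hρlip s) _,
      hasWeakDeriv_lineDeriv (hρlip s) (hρp s) (hρK s) _, ?_⟩,
      (hρlip s).continuous.continuousOn, fun x => ?_⟩⟩
  · refine (hρlim s).tendstoUniformlyOn.congr (Eventually.of_forall fun k z hz => ?_)
    simp only [R, w]
    rw [reconstruct_eq hT (hNT _) hz.1.1, gridInterp_min hT (hNT _) hz.1]
  · refine hasWeakDeriv_time_of_tendsto hM hT ha ha_bdd (fun k => hNT (κ k)) hdt0 hh0
      (fun k => hw (κ k)) (fun k n hn => ?_) hρlip hρK hρp hstepLim s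
    simp only [w, min_eq_left hn.le, min_eq_left (Nat.succ_le_of_lt hn)]
    exact (hu (κ k)).stepMap_eq hT (hNT _) hn
  · obtain ⟨C₀, hC₀, hlip₀⟩ := (hρ₀ s).exists_lipschitz_regInitial M
    have hcont : Continuous (regInitial M L (ρ₀ s)) :=
      (LipschitzWith.of_dist_le_mul (K := ⟨C₀, hC₀⟩) fun x y => by
        rw [Real.dist_eq, dist_eq_norm]; exact hlip₀ x y).continuous
    -- At t = 0 the step function is the regularized datum at the corner of the cell of x, and this
    -- corner tends to x.
    refine tendsto_nhds_unique ((hstepLim s).tendsto_at (0, x)) ?_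
    simp only [w, gridStep_zero_of_initial (hu (κ _))]
    exact (hcont.tendsto x).comp ((tendsto_floor_mul (fun k => hh _) hh0 x.1).prodMk_nhds
      (tendsto_floor_mul (fun k => hh _) hh0 x.2))
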